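/- Let $S$ and $S_\rho$ be connected symplectic manifolds and $P$ a Poisson manifold (all smooth and finite-dimensional), let $P^-$ be $P$ with minus its Poisson bracket, and let $J:S\to P^-$ and $\rho:S_\rho\to P$ be smooth Poisson maps. Let $\omega$ be the product symplectic form on $S\times S_\rho$. Put $$M=S*_PS_\rho=\{(x,y)\in S\times S_\rho \mid J(x)=\rho(y)\},\qquad T_{(x,y)}M=\{X+Y\mid X\in T_xS,\ Y\in T_yS_\rho,\ J_*X=\rho_*Y\}$$ (at points where $M$ is singular this is the definition of $T_{(x,y)}M$), and write $\perp$ for the symplectic orthogonal with respect to $\omega$. For $f\in C^\infty(P)$ let $\hat X_f$ be the vector field on $S\times S_\rho$ with $\hat X_f g=\{J^*f-\rho^*f,g\}$, where $\{\cdot,\cdot\}$ is the product Poisson bracket. For a distribution $D$ on $M$, a connected integral manifold of $D$ is a connected injectively immersed submanifold of $S\times S_\rho$ that is contained in $M$ and whose tangent space at each of its points is the one given by $D$; a leaf is a maximal connected integral manifold; and $D$ defines a (generally singular) foliation of $M$ if there is a leaf through every point of $M$ and every vector $v\in D_z$, $z\in M$, extends to a smooth vector field on $S\times S_\rho$ whose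 values at the points of $M$ lie in $D$. Then: 1. $M$ is co-isotropic: for all $z\in M$ one has $(T_zM)^\perp\subseteq T_zM$, and the vectors $\hat X_f(z)$, $f\in C^\infty(P)$, span exactly $(T_zM)^\perp$. In particular, every injectively immersed submanifold $\iota:N\to S\times S_\rho$ with $\iota(N)\subseteq M$ and $\iota_*T_nN=T_{\iota(n)}M$ for all $n\in N$ (for instance $M$ itself, if it is a submanifold with these tangent spaces) is co-isotropically immersed, and the kernel of $\iota^*\omega$ at $n$ is mapped by $\iota_*$ onto the span of the $\hat X_f(\iota(n))$. 2. The span of the vector fields $\hat X_f$ defines a (generally singular) foliation $\mathcal F$ of $M$, whose leaves are the orbits of the local flows of the $\hat X_f$. 3. The characteristic (null) distribution $z\mapsto T_zM\cap(T_zM)^\perp$ also defines a (generally singular) foliation of $M$. Two points of $M$ lie on the same leaf of $\mathcal F$ if and only if they lie on the same leaf of this characteristic foliation, and this is an equivalence relation on $M$; hence the leaf space $S^\rho=M/\mathcal F$ coincides, as a topological space, with the quotient of $M$ by its characteristic (null) foliation. -/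

import Mathlib

open scoped Manifold ContDiff Topology

namespace SymplecticInduction

noncomputable section

universe u

/-! ### Two-forms, symplectic forms, Hamiltonian vector fields -/

section TwoForms

variable {E H : Type*} [NormedAddCommGroup E] [NormedSpace ℝ E] [TopologicalSpace H]
  (I : ModelWithCorners ℝ E H) (X : Type*) [TopologicalSpace X] [ChartedSpace H X]

/-- A field of bilinear forms on the tangent spaces of `X` (no regularity yet). -/
abbrev FormField : Type _ :=
  ∀ x : X, LinearMap.BilinForm ℝ (TangentSpace I x)

variable {X}

/-- The differential of a real function, as a linear functional on the tangent space. -/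
def differential (h : X → ℝ) (x : X) : TangentSpace I x →ₗ[ℝ] ℝ :=
  (mfderiv I 𝓘(ℝ, ℝ) h x).toLinearMap

variable {I}

/-- The Hamiltonian vector field `X_h` of a function `h`: the vector field with
`Ω(w, X_h) = dh(w)` for all `w`. For nondegenerate alternating `Ω` in finite dimension it exists
and is unique (`hamiltonian_spec`, `hamiltonian_unique`). -/
def hamiltonian (Ω : FormField I X) (h : X → ℝ) (x : X) : TangentSpace I x :=
  Classical.epsilon fun v : TangentSpace I x =>
    ∀ w : TangentSpace I x, Ω x w v = differential I h x w

/-- The bracket `{f, g} = Ω(X_f, X_g)`, so that `X_f g = {f, g}`. -/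
def bracket (Ω : FormField I X) (f g : X → ℝ) (x : X) : ℝ :=
  Ω x (hamiltonian Ω f x) (hamiltonian Ω g x)

theorem hamiltonian_spec [FiniteDimensional ℝ E] (Ω : FormField I X)
    (hΩ : ∀ x, (Ω x).Nondegenerate) (h : X → ℝ) (x : X) (w : TangentSpace I x) :
    Ω x w (hamiltonian Ω h x) = differential I h x w := by
  have key : ∃ v : TangentSpace I x, ∀ w : TangentSpace I x,
      Ω x w v = differential I h x w := by
    have : FiniteDimensional ℝ (TangentSpace I x) := inferInstanceAs (FiniteDimensional ℝ E)
    have hn : (LinearMap.BilinForm.Nondegenerate (Ω x).flip) := by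
      exact ⟨(hΩ x).2, (hΩ x).1⟩
    refine ⟨((LinearMap.BilinForm.toDual _ hn).symm (differential I h x)), fun w => ?_⟩
    exact LinearMap.BilinForm.apply_toDual_symm_apply (B := (Ω x).flip) (hB := hn)
      (differential I h x) w
  exact Classical.epsilon_spec key w

theorem hamiltonian_unique [FiniteDimensional ℝ E] (Ω : FormField I X)
    (hΩ : ∀ x, (Ω x).Nondegenerate) (h : X → ℝ) (x : X) (v : TangentSpace I x)
    (hv : ∀ w : TangentSpace I x, Ω x w v = differential I h x w) :
    v = hamiltonian Ω h x := by
  refine sub_eq_zero.1 ((hΩ x).2 _ fun w => ?_)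
  rw [map_sub, hv, hamiltonian_spec Ω hΩ, sub_self]

/-- `X_f g = {f, g}`. -/
theorem differential_hamiltonian [FiniteDimensional ℝ E] (Ω : FormField I X)
    (hΩ : ∀ x, (Ω x).Nondegenerate) (f g : X → ℝ) (x : X) :
    differential I g x (hamiltonian Ω f x) = bracket Ω f g x :=
  (hamiltonian_spec Ω hΩ g x _).symm

end TwoForms

section Symplectic

variable {E : Type*} [NormedAddCommGroup E] [NormedSpace ℝ E]
  {S : Type*} [TopologicalSpace S] [ChartedSpace E S]

/-- The coordinate expression of a form field in the chart around `x₀`: the pull-back of the form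
along the inverse of the chart. It is meaningful on the target of the chart. -/
def localForm (Ω : FormField 𝓘(ℝ, E) S) (x₀ : S) (y : E) : LinearMap.BilinForm ℝ E :=
  (Ω ((extChartAt 𝓘(ℝ, E) x₀).symm y)).compl₁₂
    (mfderiv 𝓘(ℝ, E) 𝓘(ℝ, E) (extChartAt 𝓘(ℝ, E) x₀).symm y).toLinearMap
    (mfderiv 𝓘(ℝ, E) 𝓘(ℝ, E) (extChartAt 𝓘(ℝ, E) x₀).symm y).toLinearMap

theorem localForm_apply (Ω : FormField 𝓘(ℝ, E) S) (x₀ : S) (y v w : E) :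
    localForm Ω x₀ y v w = Ω ((extChartAt 𝓘(ℝ, E) x₀).symm y)
      (mfderiv 𝓘(ℝ, E) 𝓘(ℝ, E) (extChartAt 𝓘(ℝ, E) x₀).symm y v)
      (mfderiv 𝓘(ℝ, E) 𝓘(ℝ, E) (extChartAt 𝓘(ℝ, E) x₀).symm y w) := rfl

variable (E S)

/-- A symplectic form on a smooth manifold `S` without boundary modelled on `E`: a smooth, closed,
nondegenerate two-form. Smoothness (of all components) and closedness are expressed in the charts;
for an alternating `Ω` the cyclic sum below is `dΩ(u, v, w)`. -/
structure SymplecticForm where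
  /-- the underlying form -/
  form : FormField 𝓘(ℝ, E) S
  alternating : ∀ x, (form x).IsAlt
  nondegenerate : ∀ x, (form x).Nondegenerate
  smooth : ∀ (x₀ : S) (v w : E),
    ContDiffOn ℝ ∞ (fun y => localForm form x₀ y v w) (extChartAt 𝓘(ℝ, E) x₀).target
  closed : ∀ x₀ : S, ∀ y ∈ (extChartAt 𝓘(ℝ, E) x₀).target, ∀ u v w : E,
    fderiv ℝ (fun y => localForm form x₀ y v w) y u
      + fderiv ℝ (fun y => localForm form x₀ y w u) y v
      + fderiv ℝ (fun y => localForm form x₀ y u v) y w = 0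

end Symplectic

section ProductForm

variable {E E' : Type*} [NormedAddCommGroup E] [NormedSpace ℝ E]
  [NormedAddCommGroup E'] [NormedSpace ℝ E']
  {S S' : Type*} [TopologicalSpace S] [ChartedSpace E S] [TopologicalSpace S'] [ChartedSpace E' S']

/-- The product form `pr₁^* Ω + pr₂^* Ω'` on `S × S'`. -/
def prodForm (Ω : FormField 𝓘(ℝ, E) S) (Ω' : FormField 𝓘(ℝ, E') S') :
    FormField (𝓘(ℝ, E).prod 𝓘(ℝ, E')) (S × S') := fun z =>
  (Ω z.1).compl₁₂
      (mfderiv (𝓘(ℝ, E).prod 𝓘(ℝ, E')) 𝓘(ℝ, E) Prod.fst z).toLinearMap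
      (mfderiv (𝓘(ℝ, E).prod 𝓘(ℝ, E')) 𝓘(ℝ, E) Prod.fst z).toLinearMap +
    (Ω' z.2).compl₁₂
      (mfderiv (𝓘(ℝ, E).prod 𝓘(ℝ, E')) 𝓘(ℝ, E') Prod.snd z).toLinearMap
      (mfderiv (𝓘(ℝ, E).prod 𝓘(ℝ, E')) 𝓘(ℝ, E') Prod.snd z).toLinearMap

theorem prodForm_apply (Ω : FormField 𝓘(ℝ, E) S) (Ω' : FormField 𝓘(ℝ, E') S') (x : S) (y : S')
    (v v' : E) (w w' : E') :
    prodForm Ω Ω' (x, y) (v, w) (v', w') = Ω x v v' + Ω' y w w' := by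
  simp only [prodForm, mfderiv_fst, mfderiv_snd]
  rfl

theorem prodForm_nondegenerate (Ω : FormField 𝓘(ℝ, E) S) (Ω' : FormField 𝓘(ℝ, E') S')
    (h : ∀ x, (Ω x).Nondegenerate) (h' : ∀ y, (Ω' y).Nondegenerate) (z : S × S') :
    (prodForm Ω Ω' z).Nondegenerate := by
  obtain ⟨x, y⟩ := z
  refine ⟨?_, ?_⟩
  · rintro ⟨v, w⟩ hvw
    refine Prod.ext ((h x).1 v fun a => ?_) ((h' y).1 w fun b => ?_)
    · have h0 := (prodForm_apply Ω Ω' x y v a w 0).symm.trans (hvw (a, (0 : E')))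
      rwa [show Ω' y w (0 : E') = 0 from map_zero _, add_zero] at h0
    · have h0 := (prodForm_apply Ω Ω' x y v 0 w b).symm.trans (hvw ((0 : E), b))
      rwa [show Ω x v (0 : E) = 0 from map_zero _, zero_add] at h0
  · rintro ⟨v, w⟩ hvw
    refine Prod.ext ((h x).2 v fun a => ?_) ((h' y).2 w fun b => ?_)
    · have h0 := (prodForm_apply Ω Ω' x y a v 0 w).symm.trans (hvw (a, (0 : E')))
      rwa [show Ω' y (0 : E') w = 0 from LinearMap.map_zero₂ _ _, add_zero] at h0
    · have h0 := (prodForm_apply Ω Ω' x y 0 v b w).symm.trans (hvw ((0 : E), b))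
      rwa [show Ω x (0 : E) v = 0 from LinearMap.map_zero₂ _ _, zero_add] at h0

end ProductForm

/-! ### Poisson manifolds and Poisson maps -/

section Poisson

variable (E : Type*) [NormedAddCommGroup E] [NormedSpace ℝ E]
  (P : Type*) [TopologicalSpace P] [ChartedSpace E P]

/-- A Poisson structure on `P`: a Lie bracket on `C^∞(P)` that is a derivation in each argument. -/
structure PoissonStructure where
  /-- the Poisson bracket -/
  bracket : C^∞⟮𝓘(ℝ, E), P; ℝ⟯ → C^∞⟮𝓘(ℝ, E), P; ℝ⟯ → C^∞⟮𝓘(ℝ, E), P; ℝ⟯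
  add_left : ∀ f g h, bracket (f + g) h = bracket f h + bracket g h
  smul_left : ∀ (c : ℝ) (f g), bracket (c • f) g = c • bracket f g
  skew : ∀ f g, bracket f g = -bracket g f
  leibniz : ∀ f g h, bracket f (g * h) = bracket f g * h + g * bracket f h
  jacobi : ∀ f g h,
    bracket f (bracket g h) + bracket g (bracket h f) + bracket h (bracket f g) = 0

variable {E P}

/-- The Poisson manifold `P^-`: the same manifold with minus the Poisson bracket. -/
def PoissonStructure.opposite (π : PoissonStructure E P) : PoissonStructure E P where
  bracket f g := -π.bracket f g
  add_left f g h := by rw [π.add_left, neg_add]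
  smul_left c f g := by rw [π.smul_left, smul_neg]
  skew f g := by rw [π.skew f g]
  leibniz f g h := by rw [π.leibniz]; ring
  jacobi f g h := by
    have neg_right : ∀ a b, π.bracket a (-b) = -π.bracket a b := fun a b => by
      have : π.bracket (-b) a = -π.bracket b a := by
        simpa using π.smul_left (-1) b a
      rw [π.skew, this, ← π.skew]
    simpa [neg_right] using π.jacobi f g h

/-- A smooth map `J : S → P` from a symplectic manifold to a Poisson manifold is a Poisson map if
`{J^*f, J^*g}_S = J^*{f, g}_P` for all `f, g ∈ C^∞(P)`. -/
def IsPoissonMap {E' : Type*} [NormedAddCommGroup E'] [NormedSpace ℝ E']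
    {S : Type*} [TopologicalSpace S] [ChartedSpace E' S]
    (Ω : SymplecticForm E' S) (π : PoissonStructure E P) (J : S → P) : Prop :=
  ContMDiff 𝓘(ℝ, E') 𝓘(ℝ, E) ∞ J ∧
    ∀ (f g : C^∞⟮𝓘(ℝ, E), P; ℝ⟯) (x : S),
      SymplecticInduction.bracket Ω.form (f ∘ J) (g ∘ J) x = π.bracket f g (J x)

end Poisson

/-! ### Immersed submanifolds, singular foliations and leaf spaces -/

section Foliations

variable {E H : Type*} [NormedAddCommGroup E] [NormedSpace ℝ E] [TopologicalSpace H]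
  (I : ModelWithCorners ℝ E H) (X : Type u) [TopologicalSpace X] [ChartedSpace H X]

/-- An immersed submanifold of `X`: a smooth manifold (finite-dimensional, without boundary) with
an injective smooth immersion into `X`. -/
structure ImmersedSubmanifold where
  /-- the underlying manifold -/
  Carrier : Type u
  /-- its dimension -/
  dim : ℕ
  [topology : TopologicalSpace Carrier]
  [charts : ChartedSpace (EuclideanSpace ℝ (Fin dim)) Carrier]
  [isManifold : IsManifold 𝓘(ℝ, EuclideanSpace ℝ (Fin dim)) ∞ Carrier]
  /-- the immersion -/
  incl : Carrier → X
  incl_injective : Function.Injective incl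
  incl_smooth : ContMDiff 𝓘(ℝ, EuclideanSpace ℝ (Fin dim)) I ∞ incl
  incl_immersion : ∀ n,
    Function.Injective (mfderiv 𝓘(ℝ, EuclideanSpace ℝ (Fin dim)) I incl n)

attribute [instance] ImmersedSubmanifold.topology ImmersedSubmanifold.charts
  ImmersedSubmanifold.isManifold

/-- A (possibly singular) distribution: a linear subspace of each tangent space. -/
abbrev Distribution : Type _ := ∀ x : X, Submodule ℝ (TangentSpace I x)

variable {I X}

/-- The image of an immersed submanifold in the ambient manifold. -/
def ImmersedSubmanifold.image (N : ImmersedSubmanifold I X) : Set X := Set.range N.incl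

/-- The differential of the immersion. -/
def ImmersedSubmanifold.inclDeriv (N : ImmersedSubmanifold I X) (n : N.Carrier) :
    TangentSpace 𝓘(ℝ, EuclideanSpace ℝ (Fin N.dim)) n →ₗ[ℝ] TangentSpace I (N.incl n) :=
  (mfderiv 𝓘(ℝ, EuclideanSpace ℝ (Fin N.dim)) I N.incl n).toLinearMap

/-- The tangent space of an immersed submanifold, as a subspace of the ambient tangent space. -/
def ImmersedSubmanifold.tangent (N : ImmersedSubmanifold I X) (n : N.Carrier) :
    Submodule ℝ (TangentSpace I (N.incl n)) :=
  LinearMap.range (N.inclDeriv n)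

/-- The pull-back `ι^*Ω` of a form to an immersed submanifold. -/
def ImmersedSubmanifold.pullback (N : ImmersedSubmanifold I X) (Ω : FormField I X) :
    FormField 𝓘(ℝ, EuclideanSpace ℝ (Fin N.dim)) N.Carrier := fun n =>
  (Ω (N.incl n)).compl₁₂ (N.inclDeriv n) (N.inclDeriv n)

/-- `N` is co-isotropically immersed: `(T_n N)^⊥ ⊆ T_n N` at every point. -/
def ImmersedSubmanifold.IsCoisotropic (N : ImmersedSubmanifold I X) (Ω : FormField I X) : Prop :=
  ∀ n, (Ω (N.incl n)).orthogonal (N.tangent n) ≤ N.tangent n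

/-- A connected integral manifold in the subset `M` of the distribution `D`: a connected immersed
submanifold contained in `M` whose tangent space at each point is the one prescribed by `D`. -/
def IsIntegralManifold (D : Distribution I X) (M : Set X) (N : ImmersedSubmanifold I X) : Prop :=
  ConnectedSpace N.Carrier ∧ N.image ⊆ M ∧ ∀ n, N.tangent n = D (N.incl n)

/-- A leaf of `D` in `M`: a maximal connected integral manifold. -/
def IsLeaf (D : Distribution I X) (M : Set X) (L : ImmersedSubmanifold I X) : Prop :=
  IsIntegralManifold D M L ∧
    ∀ N : ImmersedSubmanifold I X, IsIntegralManifold D M N →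
      (N.image ∩ L.image).Nonempty → N.image ⊆ L.image

/-- The vector field `V` on `X` is smooth. -/
def IsSmoothVectorField [IsManifold I 1 X] (V : ∀ x : X, TangentSpace I x) : Prop :=
  ContMDiff I I.tangent ∞ fun x => (⟨x, V x⟩ : TangentBundle I X)

/-- The distribution `D` defines a (generally singular) foliation of the subset `M`, in the sense of
Stefan and Sussmann: `D` is smooth along `M` (every vector of `D` extends to a smooth vector field
with values in `D` along `M`) and completely integrable (through every point of `M` there
is a leaf). The dimension of the leaves may vary. -/
def DefinesSingularFoliation [IsManifold I 1 X] (D : Distribution I X) (M : Set X) : Prop :=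
  (∀ m ∈ M, ∀ v ∈ D m, ∃ V : ∀ x : X, TangentSpace I x,
      IsSmoothVectorField V ∧ V m = v ∧ ∀ x ∈ M, V x ∈ D x) ∧
    ∀ m ∈ M, ∃ L : ImmersedSubmanifold I X, IsLeaf D M L ∧ m ∈ L.image

/-- Two points of `M` lie on the same leaf of `D` in `M`. -/
def SameLeaf (D : Distribution I X) (M : Set X) (m m' : M) : Prop :=
  ∃ L : ImmersedSubmanifold I X, IsLeaf D M L ∧ m.1 ∈ L.image ∧ m'.1 ∈ L.image

/-- The leaf space of `D` in `M`, with the quotient topology of the subspace topology on `M`. -/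
abbrev LeafSpace (D : Distribution I X) (M : Set X) : Type u := Quot (SameLeaf D M)

/-- `z'` can be reached from `z` by moving along an integral curve of one of the vector fields of
the family `V`. -/
def FlowStep {ι : Type*} (V : ι → ∀ x : X, TangentSpace I x) (z z' : X) : Prop :=
  ∃ (i : ι) (γ : ℝ → X) (a b s t : ℝ), s ∈ Set.Ioo a b ∧ t ∈ Set.Ioo a b ∧
    IsMIntegralCurveOn γ (V i) (Set.Ioo a b) ∧ γ s = z ∧ γ t = z'

/-- `z'` lies in the orbit of `z` under the local flows of the family `V` of vector fields. -/
def SameOrbit {ι : Type*} (V : ι → ∀ x : X, TangentSpace I x) : X → X → Prop :=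
  Relation.ReflTransGen (FlowStep V)

end Foliations

/-! ### The fibre product and the vector fields `X̂_f` -/

section FibreProduct

variable {ES ER EP : Type*} [NormedAddCommGroup ES] [NormedSpace ℝ ES]
  [NormedAddCommGroup ER] [NormedSpace ℝ ER] [NormedAddCommGroup EP] [NormedSpace ℝ EP]
  {S R P : Type*} [TopologicalSpace S] [ChartedSpace ES S] [TopologicalSpace R]
  [ChartedSpace ER R] [TopologicalSpace P] [ChartedSpace EP P]

/-- The fibre product `S *_P R = {(x, y) | J x = ρ y}`. -/
def fibreProduct (J : S → P) (ρ : R → P) : Set (S × R) := {z | J z.1 = ρ z.2}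

/-- The tangent space of the fibre product at `z = (x, y)`: the tangent vectors of `S × R` with
`J_* X = ρ_* Y`. For `J x = ρ y` both sides lie in the same tangent space of `P`. (The definition
is only used at points of the fibre product.) -/
def fibreTangent (ES ER EP : Type*) [NormedAddCommGroup ES] [NormedSpace ℝ ES]
    [NormedAddCommGroup ER] [NormedSpace ℝ ER] [NormedAddCommGroup EP] [NormedSpace ℝ EP]
    [ChartedSpace ES S] [ChartedSpace ER R] [ChartedSpace EP P] (J : S → P) (ρ : R → P) :
    Distribution (𝓘(ℝ, ES).prod 𝓘(ℝ, ER)) (S × R) := fun z =>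
  LinearMap.eqLocus
    (M₂ := EP)
    (mfderiv (𝓘(ℝ, ES).prod 𝓘(ℝ, ER)) 𝓘(ℝ, EP) (fun z : S × R => J z.1) z).toLinearMap
    (mfderiv (𝓘(ℝ, ES).prod 𝓘(ℝ, ER)) 𝓘(ℝ, EP) (fun z : S × R => ρ z.2) z).toLinearMap

/-- The vector field `X̂_f` on `S × R`: the Hamiltonian vector field of `J^*f - ρ^*f`
for the product symplectic form, so that `X̂_f g = {J^*f - ρ^*f, g}`. -/
def hatField (ΩS : SymplecticForm ES S) (ΩR : SymplecticForm ER R) (J : S → P) (ρ : R → P)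
    (f : C^∞⟮𝓘(ℝ, EP), P; ℝ⟯) (z : S × R) :
    TangentSpace (𝓘(ℝ, ES).prod 𝓘(ℝ, ER)) z :=
  hamiltonian (prodForm ΩS.form ΩR.form) (fun z : S × R => f (J z.1) - f (ρ z.2)) z

/-- The distribution spanned by the vector fields `X̂_f`, `f ∈ C^∞(P)`. -/
def hatSpan (EP : Type*) [NormedAddCommGroup EP] [NormedSpace ℝ EP] [ChartedSpace EP P]
    (ΩS : SymplecticForm ES S) (ΩR : SymplecticForm ER R) (J : S → P) (ρ : R → P) :
    Distribution (𝓘(ℝ, ES).prod 𝓘(ℝ, ER)) (S × R) := fun z =>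
  Submodule.span ℝ
    (Set.range fun f : C^∞⟮𝓘(ℝ, EP), P; ℝ⟯ => hatField ΩS ΩR J ρ f z)

/-- The characteristic (null) distribution of the fibre product `M`: the kernel
`T_zM ∩ (T_zM)^⊥` of the restriction of the symplectic form to `T_zM`. -/
def nullDistribution (EP : Type*) [NormedAddCommGroup EP] [NormedSpace ℝ EP] [ChartedSpace EP P]
    (ΩS : SymplecticForm ES S) (ΩR : SymplecticForm ER R) (J : S → P) (ρ : R → P) :
    Distribution (𝓘(ℝ, ES).prod 𝓘(ℝ, ER)) (S × R) := fun z =>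
  fibreTangent ES ER EP J ρ z ⊓
    (prodForm ΩS.form ΩR.form z).orthogonal (fibreTangent ES ER EP J ρ z)

end FibreProduct

end

end SymplecticInduction

/-! Co-isotropy is linear algebra. Put `L = J_* - ρ_*`, so that `TM = ker L` along `M`. There the
defining property of Hamiltonian fields reads `ω(·, X̂_f) = df ∘ L`. The range of the transpose of
`L` is the annihilator of `ker L`, and every covector of `P` is some `df`; as `ω` is nondegenerate,
the values of the `X̂_f` fill exactly `(TM)^⊥` (`hatSpan_eq_orthogonal`). Moreover `X̂_f = (X_{f∘J},
-X_{f∘ρ})`, and both components are mapped to minus the Hamiltonian field of `f` on `P`: for the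
first the sign comes from `P^-`, for the second it is visible. So `X̂_f` is tangent to `M`
(`hatSpan_le_fibreTangent`), and along `M` the null distribution is the span of the `X̂_f`
(`nullDistribution_eq_hatSpan`). Leaves see a distribution only along `M`, so the null foliation
needs no argument of its own.

The work lies in the integrability of a distribution of varying rank along a possibly singular set.
Three facts, collected in `InvolutiveAnchor`, replace the hypotheses of Frobenius. The fields are
closed under brackets, `[X̂_f, X̂_g] = X̂_{-{f,g}}`. At a point of `M` the vector `X̂_f` depends
only on the differential of `f` at the common image in `P`, so finitely many functions suffice
locally, though for this only along `M`. Motions along the fields preserve `M`, because the images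
of the moving point under `J` and `ρ` solve the same differential equation on `P`
(`eq_along_hatChartField`).

Near a point, a projection splits the fields into a frame and a vertical part that measures the
excess of rank. By involutivity the vertical part solves a homogeneous linear equation along every
motion, so the rank is preserved (`AdaptedFrame.vert_eq_zero_along`). Where it vanishes the frame
fields commute, and integration along rays yields a plaque (`hasFDerivAt_of_integrable_along`,
`InvolutiveAnchor.exists_plaque`). Plaques absorb nearby integral manifolds and flow curves that
meet them. Hence an orbit, with the topology generated by its plaques, is a connected integral
manifold (`PlaqueFamily.leaf`), and every connected integral manifold lies in one orbit
(`PlaqueFamily.sameOrbit_of_isIntegralManifold`). So leaves are orbits, and lying on the same leaf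
is an equivalence relation. -/

namespace SymplecticInduction

universe u

open Set Metric Module

/-! ### Differential equations depending linearly on a parameter, and integration along rays -/

section LinearFamilies

variable {E K : Type*} [NormedAddCommGroup E] [NormedSpace ℝ E] [NormedAddCommGroup K]
  [NormedSpace ℝ K]

/-- A `C²` map satisfies uniform first and second order estimates on a small ball. -/
theorem exists_ball_estimates {G : E → K} {z₀ : E} (hG : ContDiffAt ℝ 2 G z₀) :
    ∃ ρ > 0, ∃ C : NNReal, 1 ≤ C ∧ (∀ z ∈ ball z₀ ρ, ‖G z‖ ≤ C) ∧
      LipschitzOnWith C G (ball z₀ ρ) ∧ (∀ z ∈ ball z₀ ρ, ‖fderiv ℝ G z‖ ≤ C) ∧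
      ∀ z ∈ ball z₀ ρ, ∀ z' ∈ ball z₀ ρ,
        ‖G z' - G z - fderiv ℝ G z (z' - z)‖ ≤ C * ‖z' - z‖ ^ 2 := by
  obtain ⟨C₁, s₁, hs₁, hC₁⟩ := (hG.of_le one_le_two).exists_lipschitzOnWith
  have hG' : ContDiffAt ℝ 1 (fderiv ℝ G) z₀ := hG.fderiv_right (by norm_num [one_add_one_eq_two])
  obtain ⟨C₂, s₂, hs₂, hC₂⟩ := hG'.exists_lipschitzOnWith
  have hd : ∀ᶠ z in 𝓝 z₀, DifferentiableAt ℝ G z := by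
    filter_upwards [hG.eventually (by simp)] with z hz using hz.differentiableAt (by norm_num)
  have hb₁ : ∀ᶠ z in 𝓝 z₀, ‖G z‖ < ‖G z₀‖ + 1 :=
    (hG.continuousAt.norm).eventually_lt continuousAt_const (by simp)
  have hb₂ : ∀ᶠ z in 𝓝 z₀, ‖fderiv ℝ G z‖ < ‖fderiv ℝ G z₀‖ + 1 :=
    (hG'.continuousAt.norm).eventually_lt continuousAt_const (by simp)
  obtain ⟨ρ, hρ, hball⟩ := Metric.eventually_nhds_iff_ball.1
    ((Filter.eventually_mem_set.2 hs₁).and ((Filter.eventually_mem_set.2 hs₂).and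
      (hd.and (hb₁.and hb₂))))
  -- A single constant that dominates the two Lipschitz constants and the two bounds, and is at
  -- least 1.
  let C : NNReal := C₁ + C₂ + ‖G z₀‖₊ + ‖fderiv ℝ G z₀‖₊ + 1
  have hC : (C : ℝ) = C₁ + C₂ + ‖G z₀‖ + ‖fderiv ℝ G z₀‖ + 1 := by simp [C]
  have h₁ := C₁.2
  have h₂ := C₂.2
  have h₃ := norm_nonneg (G z₀)
  have h₄ := norm_nonneg (fderiv ℝ G z₀)
  simp only [NNReal.val_eq_coe] at h₁ h₂
  refine ⟨ρ, hρ, C, ?_, fun z hz => ?_, ?_, fun z hz => ?_, fun z hz z' hz' => ?_⟩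
  · rw [← NNReal.coe_le_coe, hC, NNReal.coe_one]; linarith
  · have := (hball z hz).2.2.2.1
    rw [hC]; linarith
  · refine (hC₁.mono fun z hz => (hball z hz).1).weaken ?_
    rw [← NNReal.coe_le_coe, hC]; linarith
  · have := (hball z hz).2.2.2.2
    rw [hC]; linarith
  · have hseg : segment ℝ z z' ⊆ ball z₀ ρ := (convex_ball z₀ ρ).segment_subset hz hz'
    have key := (convex_segment z z').norm_image_sub_le_of_norm_hasFDerivWithin_le'
      (f := G) (f' := fderiv ℝ G) (φ := fderiv ℝ G z) (C := C₂ * ‖z' - z‖) (x := z) (y := z')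
      (fun y hy => ((hball y (hseg hy)).2.2.1.hasFDerivAt).hasFDerivWithinAt)
      (fun y hy => ?_) (left_mem_segment ℝ z z') (right_mem_segment ℝ z z')
    · refine key.trans ?_
      rw [mul_assoc, ← sq]
      gcongr
      rw [← NNReal.coe_le_coe, hC]; linarith
    · have h := hC₂.norm_sub_le (hball y (hseg hy)).2.1 (hball z hz).2.1
      refine h.trans ?_
      gcongr
      exact norm_sub_le_of_mem_segment hy

/-- Solutions of the family of autonomous equations `u' = G(u) x`, `u(0) = z₀`, exist on a fixed
time interval when the parameter `x` is small. -/
theorem exists_linear_family_solutions [CompleteSpace E] {G : E → K →L[ℝ] E} {z₀ : E}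
    (hG : ContDiffAt ℝ 1 G z₀) {ρ : ℝ} (hρ : 0 < ρ) :
    ∃ r > 0, ∀ x : K, ‖x‖ < r → ∃ u : ℝ → E, u 0 = z₀ ∧
      ∀ t ∈ Ioo (-2 : ℝ) 2, u t ∈ ball z₀ ρ ∧ HasDerivAt u (G (u t) x) t := by
  obtain ⟨C₁, s₁, hs₁, hC₁⟩ := hG.exists_lipschitzOnWith
  have hb₁ : ∀ᶠ z in 𝓝 z₀, ‖G z‖ < ‖G z₀‖ + 1 :=
    (hG.continuousAt.norm).eventually_lt continuousAt_const (by simp)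
  obtain ⟨δ, hδ, hball⟩ := Metric.eventually_nhds_iff_ball.1
    ((Filter.eventually_mem_set.2 hs₁).and hb₁)
  let a : NNReal := ⟨min δ ρ / 2, by positivity⟩
  have ha : (a : ℝ) = min δ ρ / 2 := rfl
  have ha0 : 0 < (a : ℝ) := by rw [ha]; positivity
  have haδ : closedBall z₀ (a : ℝ) ⊆ ball z₀ δ :=
    closedBall_subset_ball (by rw [ha]; linarith [min_le_left δ ρ])
  have haρ : closedBall z₀ (a : ℝ) ⊆ ball z₀ ρ :=
    closedBall_subset_ball (by rw [ha]; linarith [min_le_right δ ρ])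
  let B : NNReal := ‖G z₀‖₊ + 1
  have hB : (B : ℝ) = ‖G z₀‖ + 1 := by simp [B]
  have hB0 : 0 < (B : ℝ) := by rw [hB]; positivity
  -- The speed is at most `B * ‖x‖`, so for such `x` a solution moves by at most `a` in time 2. The
  -- time interval exceeds `[0, 1]` so that derivatives at 0 and 1 are two-sided.
  refine ⟨a / (2 * B), by positivity, fun x hx => ?_⟩
  have hpl : IsPicardLindelof (fun (_ : ℝ) (z : E) => G z x)
      (⟨0, by norm_num⟩ : Icc (-2 : ℝ) 2) z₀ a 0 (B * ‖x‖₊) (C₁ * ‖x‖₊) := by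
    refine ⟨fun t _ => ?_, fun z _ => continuousOn_const, fun t _ z hz => ?_, ?_⟩
    · refine LipschitzOnWith.of_dist_le_mul fun z hz z' hz' => ?_
      have h := hC₁.dist_le_mul z (hball z (haδ hz)).1 z' (hball z' (haδ hz')).1
      rw [dist_eq_norm] at h ⊢
      rw [← sub_apply]
      refine ((G z - G z').le_opNorm x).trans ?_
      push_cast
      calc ‖G z - G z'‖ * ‖x‖ ≤ (C₁ * dist z z') * ‖x‖ := by gcongr
        _ = C₁ * ‖x‖ * dist z z' := by ring
    · refine ((G z).le_opNorm x).trans ?_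
      push_cast
      gcongr
      rw [hB]
      exact (hball z (haδ hz)).2.le
    · have hx' := hx.le
      rw [le_div_iff₀ (by positivity)] at hx'
      push_cast
      norm_num
      linarith
  -- The Picard fixed point is used directly, because the solution must also be known to stay in the
  -- closed ball of radius `a`.
  obtain ⟨α, hα⟩ := ODE.FunSpace.exists_isFixedPt_next hpl (mem_closedBall_self le_rfl)
  refine ⟨α.compProj, ?_, fun t ht => ⟨haρ (α.compProj_mem_closedBall hpl.mul_max_le), ?_⟩⟩
  · have h := ODE.FunSpace.compProj_val (α := α) (t := ⟨0, by norm_num⟩)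
    rw [← hα, ODE.FunSpace.next_apply₀, hα] at h
    exact h
  · have ht' : t ∈ Icc (-2 : ℝ) 2 := Ioo_subset_Icc_self ht
    have h := ODE.hasDerivWithinAt_picard_Icc (f := fun (_ : ℝ) (z : E) => G z x)
      (⟨0, by norm_num⟩ : Icc (-2 : ℝ) 2).2 hpl.continuousOn_uncurry
      α.continuous_compProj.continuousOn (fun _ _ => α.compProj_mem_closedBall hpl.mul_max_le)
      z₀ ht'
    refine (HasDerivWithinAt.congr_of_mem h ?_ ht').hasDerivAt (Icc_mem_nhds ht.1 ht.2)
    intro t' ht'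
    nth_rw 1 [← hα]
    rw [ODE.FunSpace.compProj_of_mem ht', ODE.FunSpace.next_apply]

theorem gronwallBound_zero_one_le {C ε : ℝ} (hC : 1 ≤ C) (hε : 0 ≤ ε) {t : ℝ}
    (ht : t ∈ Icc (0 : ℝ) 1) : gronwallBound 0 C ε t ≤ ε * Real.exp C := by
  rw [gronwallBound_of_K_ne_0 (by linarith)]
  have h0 : 0 < Real.exp (C * t) := Real.exp_pos _
  have h1 : Real.exp (C * t) ≤ Real.exp C :=
    Real.exp_le_exp.2 (by nlinarith [ht.2])
  have h1' : 1 ≤ Real.exp (C * t) := Real.one_le_exp (mul_nonneg (by linarith) ht.1)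
  have h2 : ε / C ≤ ε := div_le_self hε hC
  have : ε / C * (Real.exp (C * t) - 1) ≤ ε * Real.exp C :=
    mul_le_mul h2 (by linarith) (by linarith) hε
  simpa using this

/-- The end points of the solutions of `u' = G(u) x`, `u(0) = z₀`, depend on `x` in a strictly
differentiable way at `x = 0`. -/
theorem hasStrictFDerivAt_linear_family {G : E → K →L[ℝ] E} {z₀ : E} {ρ r : ℝ}
    {C : NNReal} (hC : 1 ≤ C) (hGb : ∀ z ∈ ball z₀ ρ, ‖G z‖ ≤ C)
    (hGl : LipschitzOnWith C G (ball z₀ ρ)) (hr : 0 < r) {u : K → ℝ → E}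
    (hu : ∀ x, ‖x‖ < r → u x 0 = z₀ ∧
      ∀ t ∈ Icc (0 : ℝ) 1, u x t ∈ ball z₀ ρ ∧ HasDerivAt (u x) (G (u x t) x) t) :
    HasStrictFDerivAt (fun x => u x 1) (G z₀) 0 := by
  have hC0 : (1 : ℝ) ≤ C := by exact_mod_cast hC
  have hz₀ : z₀ ∈ ball z₀ ρ := by
    have h := hu 0 (by simpa using hr)
    have := (h.2 0 (by norm_num)).1
    rwa [h.1] at this
  have hcont : ∀ x, ‖x‖ < r → ContinuousOn (u x) (Icc 0 1) := fun x hx t ht =>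
    ((hu x hx).2 t ht).2.continuousAt.continuousWithinAt
  have hdist : ∀ x, ‖x‖ < r → ∀ t ∈ Icc (0 : ℝ) 1, ‖u x t - z₀‖ ≤ C * ‖x‖ := by
    intro x hx t ht
    have h := norm_image_sub_le_of_norm_deriv_le_segment' (f := u x) (a := 0) (b := 1)
      (C := C * ‖x‖) (fun s hs => ((hu x hx).2 s hs).2.hasDerivWithinAt)
      (fun s hs => ((G (u x s)).le_opNorm x).trans
        (by gcongr; exact hGb _ ((hu x hx).2 s (Ico_subset_Icc_self hs)).1)) t ht
    rw [(hu x hx).1] at h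
    refine h.trans ?_
    have : (C : ℝ) * ‖x‖ * (t - 0) ≤ C * ‖x‖ * 1 := by
      gcongr
      linarith [ht.2]
    linarith
  have hlip : ∀ x, ‖x‖ < r → ‖x‖ ≤ 1 → ∀ y, ‖y‖ < r → ∀ t ∈ Icc (0 : ℝ) 1,
      ‖u x t - u y t‖ ≤ C * ‖x - y‖ * Real.exp C := by
    intro x hx hx1 y hy t ht
    -- `u y` is an approximate solution of the equation with parameter `x`, with error `C * ‖x -
    -- y‖`; the condition `‖x‖ ≤ 1` makes `C` a Lipschitz constant of that equation.
    have h := dist_le_of_approx_trajectories_ODE_of_mem (v := fun _ z => G z x) (K := C)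
      (s := fun _ => ball z₀ ρ) (f := u x) (g := u y) (a := 0) (b := 1) (δ := 0) (εf := 0)
      (εg := C * ‖x - y‖) (f' := fun t => G (u x t) x) (g' := fun t => G (u y t) y)
      (fun s _ => ?_) (hcont x hx)
      (fun s hs => ((hu x hx).2 s (Ico_subset_Icc_self hs)).2.hasDerivWithinAt)
      (fun s hs => by simp) (fun s hs => ((hu x hx).2 s (Ico_subset_Icc_self hs)).1) (hcont y hy)
      (fun s hs => ((hu y hy).2 s (Ico_subset_Icc_self hs)).2.hasDerivWithinAt)
      (fun s hs => ?_) (fun s hs => ((hu y hy).2 s (Ico_subset_Icc_self hs)).1)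
      (by rw [(hu x hx).1, (hu y hy).1, dist_self]) t ht
    · rw [dist_eq_norm, zero_add, sub_zero] at h
      exact h.trans (gronwallBound_zero_one_le hC0 (by positivity) ht)
    · refine LipschitzOnWith.of_dist_le_mul fun z hz z' hz' => ?_
      have h := hGl.dist_le_mul z hz z' hz'
      rw [dist_eq_norm] at h ⊢
      rw [← sub_apply]
      refine ((G z - G z').le_opNorm x).trans ?_
      calc ‖G z - G z'‖ * ‖x‖ ≤ (C * dist z z') * 1 := by gcongr
        _ = C * dist z z' := by ring
    · rw [dist_eq_norm, ← map_sub, norm_sub_rev x y]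
      refine ((G (u y s)).le_opNorm _).trans ?_
      gcongr
      exact hGb _ ((hu y hy).2 s (Ico_subset_Icc_self hs)).1
  -- The error is a product of `‖x - y‖` with a quantity that tends to 0, which is strict
  -- differentiability at 0. It comes from splitting the difference of velocities into `(G(u x) -
  -- G(u y)) x` and `(G(u y) - G z₀)(x - y)`.
  have hmain : ∀ x, ‖x‖ < r → ‖x‖ ≤ 1 → ∀ y, ‖y‖ < r →
      ‖u x 1 - u y 1 - G z₀ (x - y)‖ ≤
        C * C * Real.exp C * (‖x‖ + ‖y‖) * ‖x - y‖ := by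
    intro x hx hx1 y hy
    have h := norm_image_sub_le_of_norm_deriv_le_segment_01'
      (f := fun t => u x t - u y t - t • G z₀ (x - y))
      (f' := fun t => G (u x t) x - G (u y t) y - G z₀ (x - y))
      (C := C * C * Real.exp C * (‖x‖ + ‖y‖) * ‖x - y‖)
      (fun s hs => by
        have h := (((hu x hx).2 s hs).2.sub ((hu y hy).2 s hs).2).sub
          ((hasDerivAt_id s).smul_const (G z₀ (x - y)))
        rw [one_smul] at h
        exact h.hasDerivWithinAt) (fun s hs => ?_)
    · simpa [(hu x hx).1, (hu y hy).1] using h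
    · have hs' := Ico_subset_Icc_self hs
      have hxs := ((hu x hx).2 s hs').1
      have hys := ((hu y hy).2 s hs').1
      have e : G (u x s) x - G (u y s) y - G z₀ (x - y) =
          (G (u x s) - G (u y s)) x + (G (u y s) - G z₀) (x - y) := by
        simp only [sub_apply, map_sub]
        abel
      rw [e]
      have h1 : ‖(G (u x s) - G (u y s)) x‖ ≤ C * (C * ‖x - y‖ * Real.exp C) * ‖x‖ := by
        refine ((G (u x s) - G (u y s)).le_opNorm x).trans ?_
        gcongr
        refine (hGl.norm_sub_le hxs hys).trans ?_
        gcongr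
        exact hlip x hx hx1 y hy s hs'
      have h2 : ‖(G (u y s) - G z₀) (x - y)‖ ≤ C * (C * ‖y‖) * ‖x - y‖ := by
        refine ((G (u y s) - G z₀).le_opNorm _).trans ?_
        gcongr
        refine (hGl.norm_sub_le hys hz₀).trans ?_
        gcongr
        exact hdist y hy s hs'
      have h3 : C * (C * ‖y‖) * ‖x - y‖ ≤ C * (C * ‖y‖) * ‖x - y‖ * Real.exp C :=
        le_mul_of_one_le_right (by positivity) (Real.one_le_exp (by linarith))
      calc _ ≤ C * (C * ‖x - y‖ * Real.exp C) * ‖x‖ + C * (C * ‖y‖) * ‖x - y‖ * Real.exp C :=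
            (norm_add_le _ _).trans (add_le_add h1 (h2.trans h3))
        _ = _ := by ring
  refine .of_isLittleO (Asymptotics.isLittleO_iff.2 fun c hc => ?_)
  set D : ℝ := C * C * Real.exp C with hD
  have hD0 : 0 < D := by positivity
  have hnear : ∀ᶠ x : K in 𝓝 0, ‖x‖ < min r (min 1 (c / (2 * D))) := by
    have := ball_mem_nhds (0 : K) (ε := min r (min 1 (c / (2 * D)))) (by positivity)
    filter_upwards [this] with x hx
    simpa using hx
  have hnear2 : ∀ᶠ p : K × K in 𝓝 (0, 0), ‖p.1‖ < min r (min 1 (c / (2 * D))) ∧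
      ‖p.2‖ < min r (min 1 (c / (2 * D))) := by
    rw [nhds_prod_eq]
    exact hnear.prod_mk hnear
  filter_upwards [hnear2] with p hp
  obtain ⟨h1, h2⟩ := hp
  rw [lt_min_iff, lt_min_iff] at h1 h2
  refine (hmain p.1 h1.1 h1.2.1.le p.2 h2.1).trans ?_
  gcongr
  have h3 := h1.2.2.le
  have h4 := h2.2.2.le
  calc D * (‖p.1‖ + ‖p.2‖) ≤ D * (c / (2 * D) + c / (2 * D)) := by gcongr
    _ = c := by field_simp; ring

/-- Solutions of `D σ = W ∘ σ` by integration along rays: if the integrability condition holds along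
the solution `u x`, then `x ↦ u x 1` is differentiable with derivative `W (u x 1)`. -/
theorem hasFDerivAt_of_integrable_along {W : E → K →L[ℝ] E} {z₀ : E} {ρ r : ℝ}
    {C : NNReal} (hC : 1 ≤ C) (hρ : 0 < ρ)
    (hWd : ∀ z ∈ ball z₀ ρ, DifferentiableAt ℝ W z)
    (hWb : ∀ z ∈ ball z₀ ρ, ‖W z‖ ≤ C)
    (hWl : LipschitzOnWith C W (ball z₀ ρ))
    (hWd' : ∀ z ∈ ball z₀ ρ, ‖fderiv ℝ W z‖ ≤ C)
    (hW₂ : ∀ z ∈ ball z₀ ρ, ∀ z' ∈ ball z₀ ρ,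
        ‖W z' - W z - fderiv ℝ W z (z' - z)‖ ≤ C * ‖z' - z‖ ^ 2)
    {u : K → ℝ → E}
    (hu : ∀ x, ‖x‖ < r → u x 0 = z₀ ∧
      ∀ t ∈ Icc (0 : ℝ) 1, u x t ∈ ball z₀ (ρ / 2) ∧ HasDerivAt (u x) (W (u x t) x) t)
    {x : K} (hx : ‖x‖ < r)
    (hint : ∀ t ∈ Icc (0 : ℝ) 1, ∀ h : K,
      fderiv ℝ W (u x t) (W (u x t) x) h = fderiv ℝ W (u x t) (W (u x t) h) x) :
    HasFDerivAt (fun x => u x 1) (W (u x 1)) x := by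
  have hC0 : (1 : ℝ) ≤ C := by exact_mod_cast hC
  have hsub : ball z₀ (ρ / 2) ⊆ ball z₀ ρ := ball_subset_ball (by linarith)
  have hcont : ∀ x, ‖x‖ < r → ContinuousOn (u x) (Icc 0 1) := fun x hx t ht =>
    ((hu x hx).2 t ht).2.continuousAt.continuousWithinAt
  set N : NNReal := C * (‖x‖₊ + 1) with hN
  have hN' : (N : ℝ) = C * (‖x‖ + 1) := by simp [hN]
  have hN1 : 1 ≤ (N : ℝ) := by
    rw [hN']
    exact one_le_mul_of_one_le_of_one_le hC0 (by linarith [norm_nonneg x])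
  set D : ℝ := C * C + C * C ^ 2 * (‖x‖ + 1) with hD
  have hD0 : 0 ≤ D := by positivity
  -- The first-order guess for `u (x + h) t` is `u x t + t • W (u x t) h`. It solves the equation
  -- with parameter `x + h` up to an error of order `‖h‖ ^ 2`, and Gronwall carries this estimate to
  -- time 1.
  have hmain : ∀ h : K, ‖h‖ ≤ 1 → ‖x + h‖ < r → C * ‖h‖ < ρ / 2 →
      ‖u (x + h) 1 - u x 1 - W (u x 1) h‖ ≤ D * Real.exp N * ‖h‖ ^ 2 := by
    intro h hh1 hxh hhρ
    have hxn : ‖x + h‖ ≤ ‖x‖ + 1 := (norm_add_le _ _).trans (by linarith)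
    have hub : ∀ t ∈ Icc (0 : ℝ) 1, u x t ∈ ball z₀ ρ := fun t ht => hsub ((hu x hx).2 t ht).1
    have hstep : ∀ t ∈ Icc (0 : ℝ) 1, ‖t • W (u x t) h‖ ≤ C * ‖h‖ := by
      intro t ht
      rw [norm_smul, Real.norm_of_nonneg ht.1]
      calc t * ‖W (u x t) h‖ ≤ 1 * (C * ‖h‖) := by
            gcongr
            · exact ht.2
            · exact ((W (u x t)).le_opNorm h).trans (by gcongr; exact hWb _ (hub t ht))
        _ = _ := one_mul _
    have hwmem : ∀ t ∈ Icc (0 : ℝ) 1, u x t + t • W (u x t) h ∈ ball z₀ ρ := by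
      intro t ht
      have h1 := ((hu x hx).2 t ht).1
      rw [mem_ball, dist_eq_norm] at h1 ⊢
      rw [add_sub_right_comm]
      refine (norm_add_le _ _).trans_lt ?_
      linarith [hstep t ht]
    have hwd : ∀ t ∈ Icc (0 : ℝ) 1, HasDerivAt (fun t => u x t + t • W (u x t) h)
        (W (u x t) x + (t • fderiv ℝ W (u x t) (W (u x t) x) h + W (u x t) h)) t := by
      intro t ht
      have h1 := ((hu x hx).2 t ht).2
      have h2 : HasDerivAt (fun t => W (u x t)) (fderiv ℝ W (u x t) (W (u x t) x)) t :=
        ((hWd _ (hub t ht)).hasFDerivAt).comp_hasDerivAt t h1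
      have h3 := h2.clm_apply (hasDerivAt_const t h)
      have h4 := h1.add ((hasDerivAt_id t).smul h3)
      simp only [map_zero, add_zero, id_eq, one_smul] at h4
      exact h4
    have key := dist_le_of_approx_trajectories_ODE_of_mem (v := fun _ z => W z (x + h)) (K := N)
      (s := fun _ => ball z₀ ρ) (f := u (x + h)) (g := fun t => u x t + t • W (u x t) h)
      (a := 0) (b := 1) (δ := 0) (εf := 0)
      (εg := D * ‖h‖ ^ 2) (f' := fun t => W (u (x + h) t) (x + h))
      (g' := fun t => W (u x t) x + (t • fderiv ℝ W (u x t) (W (u x t) x) h + W (u x t) h))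
      (fun s _ => ?_) (hcont _ hxh)
      (fun s hs => ((hu _ hxh).2 s (Ico_subset_Icc_self hs)).2.hasDerivWithinAt)
      (fun s hs => by simp) (fun s hs => hsub ((hu _ hxh).2 s (Ico_subset_Icc_self hs)).1)
      (fun s hs => (hwd s hs).continuousAt.continuousWithinAt)
      (fun s hs => (hwd s (Ico_subset_Icc_self hs)).hasDerivWithinAt)
      (fun s hs => ?_) (fun s hs => hwmem s (Ico_subset_Icc_self hs))
      (by simp [(hu x hx).1, (hu _ hxh).1]) 1 (by norm_num)
    · rw [dist_eq_norm, zero_add, sub_zero, one_smul, ← sub_sub] at key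
      refine key.trans ((gronwallBound_zero_one_le hN1 (by positivity) (by norm_num)).trans ?_)
      rw [mul_right_comm]
    · refine LipschitzOnWith.of_dist_le_mul fun z hz z' hz' => ?_
      have h' := hWl.dist_le_mul z hz z' hz'
      rw [dist_eq_norm] at h' ⊢
      rw [← sub_apply, hN']
      refine ((W z - W z').le_opNorm _).trans ?_
      calc ‖W z - W z'‖ * ‖x + h‖ ≤ (C * dist z z') * (‖x‖ + 1) := by gcongr
        _ = _ := by ring
    · have hs' := Ico_subset_Icc_self hs
      set z := u x s with hz
      set k := s • W z h with hk
      have hR := hW₂ z (hub s hs') (z + k) (hwmem s hs')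
      rw [add_sub_cancel_left] at hR
      have hk' : ‖k‖ ≤ C * ‖h‖ := hstep s hs'
      have e : W z x + (s • fderiv ℝ W z (W z x) h + W z h) - W (z + k) (x + h) =
          -(s • fderiv ℝ W z (W z h) h) - (W (z + k) - W z - fderiv ℝ W z k) (x + h) := by
        -- Integrability exchanges the two slots of the derivative of `W`, so the terms linear in
        -- `h` cancel. A term quadratic in `h` and the Taylor remainder are left.
        rw [hint s hs' h, hk]
        simp only [sub_apply, map_smul, map_add,
          smul_apply]
        module
      rw [dist_eq_norm, e]
      have h1 : ‖-(s • fderiv ℝ W z (W z h) h)‖ ≤ C * C * ‖h‖ ^ 2 := by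
        rw [norm_neg, norm_smul, Real.norm_of_nonneg hs'.1]
        have h2 : ‖fderiv ℝ W z (W z h) h‖ ≤ C * (C * ‖h‖) * ‖h‖ := by
          refine ((fderiv ℝ W z (W z h)).le_opNorm h).trans ?_
          gcongr
          refine ((fderiv ℝ W z).le_opNorm _).trans ?_
          gcongr
          · exact hWd' z (hub s hs')
          · refine ((W z).le_opNorm _).trans ?_
            gcongr
            exact hWb z (hub s hs')
        calc s * ‖fderiv ℝ W z (W z h) h‖ ≤ 1 * (C * (C * ‖h‖) * ‖h‖) := by
              gcongr
              exact hs'.2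
          _ = _ := by ring
      have h2 : ‖(W (z + k) - W z - fderiv ℝ W z k) (x + h)‖ ≤
          C * (C * ‖h‖) ^ 2 * (‖x‖ + 1) := by
        refine (ContinuousLinearMap.le_opNorm _ _).trans ?_
        gcongr
        refine hR.trans ?_
        gcongr
      calc _ ≤ C * C * ‖h‖ ^ 2 + C * (C * ‖h‖) ^ 2 * (‖x‖ + 1) :=
            (norm_sub_le _ _).trans (add_le_add h1 h2)
        _ = _ := by rw [hD]; ring
  rw [hasFDerivAt_iff_isLittleO_nhds_zero]
  have hO : (fun h : K => u (x + h) 1 - u x 1 - W (u x 1) h) =O[𝓝 0]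
      fun h : K => ‖h‖ ^ 2 := by
    refine Asymptotics.IsBigO.of_bound (D * Real.exp N) ?_
    have hε : 0 < min 1 (min (r - ‖x‖) (ρ / (2 * C))) := by
      have := sub_pos.2 hx
      positivity
    filter_upwards [ball_mem_nhds (0 : K) hε] with h hh
    rw [mem_ball_zero_iff, lt_min_iff, lt_min_iff] at hh
    have h3 := hh.2.2
    rw [lt_div_iff₀ (by positivity)] at h3
    refine (hmain h hh.1.le ?_ (by linarith)).trans (by simp)
    exact (norm_add_le _ _).trans_lt (by linarith [hh.2.1])
  refine hO.trans_isLittleO ?_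
  simpa using (Asymptotics.isLittleO_norm_pow_id (E' := K) one_lt_two)

end LinearFamilies

/-! ### Involutive families of vector fields of varying rank: frame and vertical part -/

section InvolutiveAnchor

variable {E F K : Type*} [NormedAddCommGroup E] [NormedSpace ℝ E]
  [NormedAddCommGroup F] [NormedSpace ℝ F]
  [NormedAddCommGroup K] [NormedSpace ℝ K]

/-- A family of smooth vector fields on an open subset of `E`, depending linearly on a parameter in
`F`, that is involutive along a subset (the locus) which is invariant under all
motions along the fields of the family. -/
structure InvolutiveAnchor (E F : Type*) [NormedAddCommGroup E] [NormedSpace ℝ E]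
    [NormedAddCommGroup F] [NormedSpace ℝ F] where
  /-- the domain of the vector fields -/
  domain : Set E
  isOpen_domain : IsOpen domain
  /-- the invariant subset -/
  locus : Set E
  /-- the vector fields -/
  anchor : E → F →L[ℝ] E
  smooth : ContDiffOn ℝ ∞ anchor domain
  /-- the structure functions -/
  bracket : E → F →L[ℝ] F →L[ℝ] F
  continuousOn_bracket : ContinuousOn bracket domain
  bracket_spec : ∀ z ∈ domain, z ∈ locus → ∀ a b,
    fderiv ℝ anchor z (anchor z a) b - fderiv ℝ anchor z (anchor z b) a =
      anchor z (bracket z a b)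
  invariant : ∀ (γ : ℝ → E) (a : ℝ → F), ContinuousOn a (Icc 0 1) →
    (∀ t ∈ Icc (0 : ℝ) 1, γ t ∈ domain) →
    (∀ t ∈ Icc (0 : ℝ) 1, HasDerivWithinAt γ (anchor (γ t) (a t)) (Icc 0 1) t) →
    γ 0 ∈ locus → ∀ t ∈ Icc (0 : ℝ) 1, γ t ∈ locus

/-- A partial splitting of the fields of `A`: near the given point, the fields `anchor ∘ coeff` are
a frame that projects to constant fields under `proj`. -/
structure AdaptedFrame (A : InvolutiveAnchor E F) (K : Type*) [NormedAddCommGroup K]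
    [NormedSpace ℝ K] where
  /-- the domain of the frame -/
  domain : Set E
  isOpen_domain : IsOpen domain
  domain_subset : domain ⊆ A.domain
  /-- the projection -/
  proj : E →L[ℝ] K
  /-- the coefficients of the frame -/
  coeff : E → K →L[ℝ] F
  smooth_coeff : ContDiffOn ℝ ∞ coeff domain
  proj_anchor : ∀ z ∈ domain, ∀ x, proj (A.anchor z (coeff z x)) = x

/-- At `z₀` a projection `pr` onto the range, identified with `K`, and a choice `ι` of parameters
give `pr ∘ anchor z₀ ∘ ι = 1`. Away from `z₀` the map `M z = pr ∘ anchor z ∘ ι` is no longer the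
identity, but it is invertible on an open set, and composition with its inverse normalises the
frame. -/
theorem AdaptedFrame.exists_of_finrank [FiniteDimensional ℝ E] [FiniteDimensional ℝ F]
    [FiniteDimensional ℝ K] (A : InvolutiveAnchor E F) {z₀ : E} (hz₀ : z₀ ∈ A.domain)
    (hk : finrank ℝ (LinearMap.range (A.anchor z₀).toLinearMap) = finrank ℝ K) :
    ∃ Φ : AdaptedFrame A K, z₀ ∈ Φ.domain := by
  have : CompleteSpace K := FiniteDimensional.complete ℝ K
  set T := LinearMap.range (A.anchor z₀).toLinearMap
  let e : T ≃ₗ[ℝ] K := LinearEquiv.ofFinrankEq _ _ hk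
  obtain ⟨p, hp⟩ := T.subtype.exists_leftInverse_of_injective T.ker_subtype
  obtain ⟨j, hj⟩ := (A.anchor z₀).toLinearMap.rangeRestrict.exists_rightInverse_of_surjective
    (LinearMap.range_rangeRestrict _)
  let pr : E →L[ℝ] K := LinearMap.toContinuousLinearMap (e.toLinearMap ∘ₗ p)
  let ι : K →L[ℝ] F := LinearMap.toContinuousLinearMap (j ∘ₗ e.symm.toLinearMap)
  have hprι : ∀ x, pr (A.anchor z₀ (ι x)) = x := by
    intro x
    have h1 : ((A.anchor z₀).toLinearMap.rangeRestrict (j (e.symm x))) = e.symm x :=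
      LinearMap.congr_fun hj (e.symm x)
    have h2 : A.anchor z₀ (ι x) = T.subtype (e.symm x) := by
      rw [← h1]; rfl
    have h3 : p (T.subtype (e.symm x)) = e.symm x := LinearMap.congr_fun hp (e.symm x)
    change e (p (A.anchor z₀ (ι x))) = x
    rw [h2, h3, e.apply_symm_apply]
  let M : E → K →L[ℝ] K := fun z => pr ∘L (A.anchor z ∘L ι)
  have hM : ContDiffOn ℝ ∞ M A.domain :=
    contDiffOn_const.clm_comp (A.smooth.clm_comp contDiffOn_const)
  have hM₀ : M z₀ = 1 := by
    ext x
    exact hprι x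
  let U : Set E := A.domain ∩ M ⁻¹' {m | IsUnit m}
  have hU : IsOpen U := hM.continuousOn.isOpen_inter_preimage A.isOpen_domain Units.isOpen
  refine ⟨⟨U, hU, inter_subset_left, pr, fun z => ι ∘L Ring.inverse (M z), ?_, ?_⟩, hz₀, ?_⟩
  · refine contDiffOn_const.clm_comp fun z hz => ?_
    obtain ⟨m, hm⟩ := hz.2
    have h1 : ContDiffAt ℝ ∞ Ring.inverse (M z) := by
      rw [← hm]; exact contDiffAt_ringInverse ℝ m
    exact h1.comp_contDiffWithinAt z (hM.mono inter_subset_left z hz)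
  · intro z hz x
    change (M z * Ring.inverse (M z)) x = x
    rw [Ring.mul_inverse_cancel _ hz.2]
    rfl
  · change IsUnit (M z₀)
    rw [hM₀]
    exact isUnit_one

namespace AdaptedFrame

variable {A : InvolutiveAnchor E F} (Φ : AdaptedFrame A K)

/-- The frame fields. -/
def frame (z : E) : K →L[ℝ] E := A.anchor z ∘L Φ.coeff z

/-- The parameter of the vertical part. -/
def vertCoeff (z : E) : F →L[ℝ] F :=
  ContinuousLinearMap.id ℝ F - Φ.coeff z ∘L Φ.proj ∘L A.anchor z

/-- The vertical part of the fields of the family. -/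
def vert (z : E) : F →L[ℝ] E := A.anchor z ∘L Φ.vertCoeff z

theorem smooth_anchor : ContDiffOn ℝ ∞ A.anchor Φ.domain := A.smooth.mono Φ.domain_subset

theorem smooth_frame : ContDiffOn ℝ ∞ Φ.frame Φ.domain :=
  Φ.smooth_anchor.clm_comp Φ.smooth_coeff

theorem smooth_vertCoeff : ContDiffOn ℝ ∞ Φ.vertCoeff Φ.domain :=
  contDiffOn_const.sub (Φ.smooth_coeff.clm_comp (contDiffOn_const.clm_comp Φ.smooth_anchor))

theorem smooth_vert : ContDiffOn ℝ ∞ Φ.vert Φ.domain :=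
  Φ.smooth_anchor.clm_comp Φ.smooth_vertCoeff

theorem vert_apply (z : E) (b : F) :
    Φ.vert z b = A.anchor z b - Φ.frame z (Φ.proj (A.anchor z b)) := by
  simp [vert, vertCoeff, frame]

theorem proj_frame {z : E} (hz : z ∈ Φ.domain) (x : K) : Φ.proj (Φ.frame z x) = x :=
  Φ.proj_anchor z hz x

theorem proj_vert {z : E} (hz : z ∈ Φ.domain) (b : F) : Φ.proj (Φ.vert z b) = 0 := by
  rw [vert_apply, map_sub, Φ.proj_frame hz, sub_self]

theorem differentiableAt_of_smooth {G : Type*} [NormedAddCommGroup G] [NormedSpace ℝ G]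
    {f : E → G} (hf : ContDiffOn ℝ ∞ f Φ.domain) {z : E} (hz : z ∈ Φ.domain) :
    DifferentiableAt ℝ f z :=
  (hf.contDiffAt (Φ.isOpen_domain.mem_nhds hz)).differentiableAt (by simp)

theorem continuousOn_fderiv_of_smooth {G : Type*} [NormedAddCommGroup G] [NormedSpace ℝ G]
    {f : E → G} (hf : ContDiffOn ℝ ∞ f Φ.domain) : ContinuousOn (fderiv ℝ f) Φ.domain :=
  hf.continuousOn_fderiv_of_isOpen Φ.isOpen_domain (by simp)

theorem proj_fderiv_vert {z : E} (hz : z ∈ Φ.domain) (w : E) (b : F) :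
    Φ.proj (fderiv ℝ Φ.vert z w b) = 0 := by
  have h1 : HasFDerivAt (fun y => Φ.proj (Φ.vert y b))
      (Φ.proj ∘L ((fderiv ℝ Φ.vert z).flip b)) z := by
    have := (Φ.differentiableAt_of_smooth Φ.smooth_vert hz).hasFDerivAt.clm_apply
      (hasFDerivAt_const b z)
    have h := Φ.proj.hasFDerivAt.comp z this
    convert! h using 1
    ext; simp
  have h2 : (fun y => Φ.proj (Φ.vert y b)) =ᶠ[𝓝 z] fun _ => (0 : K) := by
    filter_upwards [Φ.isOpen_domain.mem_nhds hz] with y hy using Φ.proj_vert hy b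
  have h3 := h1.unique ((hasFDerivAt_const (0 : K) z).congr_of_eventuallyEq h2)
  exact congrArg (fun L => L w) h3

theorem proj_fderiv_frame {z : E} (hz : z ∈ Φ.domain) (w : E) (x : K) :
    Φ.proj (fderiv ℝ Φ.frame z w x) = 0 := by
  have h1 : HasFDerivAt (fun y => Φ.proj (Φ.frame y x))
      (Φ.proj ∘L ((fderiv ℝ Φ.frame z).flip x)) z := by
    have := (Φ.differentiableAt_of_smooth Φ.smooth_frame hz).hasFDerivAt.clm_apply
      (hasFDerivAt_const x z)
    have h := Φ.proj.hasFDerivAt.comp z this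
    convert! h using 1
    ext; simp
  have h2 : (fun y => Φ.proj (Φ.frame y x)) =ᶠ[𝓝 z] fun _ => x := by
    filter_upwards [Φ.isOpen_domain.mem_nhds hz] with y hy using Φ.proj_frame hy x
  have h3 := h1.unique ((hasFDerivAt_const x z).congr_of_eventuallyEq h2)
  exact congrArg (fun L => L w) h3

theorem fderiv_anchor_comp {G : Type*} [NormedAddCommGroup G] [NormedSpace ℝ G]
    {f : E → G →L[ℝ] F} (hf : ContDiffOn ℝ ∞ f Φ.domain) {z : E} (hz : z ∈ Φ.domain)
    (w : E) (x : G) :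
    fderiv ℝ (fun y => A.anchor y ∘L f y) z w x =
      A.anchor z (fderiv ℝ f z w x) + fderiv ℝ A.anchor z w (f z x) := by
  have h := (Φ.differentiableAt_of_smooth Φ.smooth_anchor hz).hasFDerivAt.clm_comp
    (Φ.differentiableAt_of_smooth hf hz).hasFDerivAt
  rw [h.fderiv]
  simp

/-- The product rule and involutivity turn the derivative of `vert` into a term containing `vert z
b` plus a value of the anchor. Derivatives of `vert` have projection zero; this determines the
projection of that value, which therefore splits into a frame part again containing `vert z b` and a
vertical part. So every term contains `vert`: along a motion it satisfies a homogeneous linear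
equation. -/
theorem fderiv_vert {z : E} (hz : z ∈ Φ.domain) (hM : z ∈ A.locus) (a b : F) :
    fderiv ℝ Φ.vert z (A.anchor z a) b =
      fderiv ℝ A.anchor z (Φ.vert z b) a
        - Φ.frame z (Φ.proj (fderiv ℝ A.anchor z (Φ.vert z b) a))
        + Φ.vert z (A.bracket z a (Φ.vertCoeff z b)
          + fderiv ℝ Φ.vertCoeff z (A.anchor z a) b) := by
  have h1 : fderiv ℝ Φ.vert z (A.anchor z a) b = _ :=
    Φ.fderiv_anchor_comp Φ.smooth_vertCoeff hz (A.anchor z a) b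
  have h2 := A.bracket_spec z (Φ.domain_subset hz) hM a (Φ.vertCoeff z b)
  have h3 := Φ.proj_fderiv_vert hz (A.anchor z a) b
  rw [show A.anchor z (Φ.vertCoeff z b) = Φ.vert z b from rfl, sub_eq_iff_eq_add] at h2
  have h4 : fderiv ℝ Φ.vert z (A.anchor z a) b =
      A.anchor z (A.bracket z a (Φ.vertCoeff z b) + fderiv ℝ Φ.vertCoeff z (A.anchor z a) b)
        + fderiv ℝ A.anchor z (Φ.vert z b) a := by
    rw [h1, h2, map_add]; abel
  rw [h4, map_add] at h3
  rw [h4, Φ.vert_apply z (A.bracket z a (Φ.vertCoeff z b) + _), eq_neg_of_add_eq_zero_left h3,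
    map_neg]
  abel

/-- The difference of the two sides is a bracket of frame fields, hence a value of the anchor. Its
projection vanishes because the frame projects to constant fields, and where `vert` vanishes a value
of the anchor is determined by its projection. This is the integrability condition of Frobenius, at
the points of minimal rank only. -/
theorem fderiv_frame_symm {z : E} (hz : z ∈ Φ.domain) (hM : z ∈ A.locus) (h0 : Φ.vert z = 0)
    (x y : K) :
    fderiv ℝ Φ.frame z (Φ.frame z x) y = fderiv ℝ Φ.frame z (Φ.frame z y) x := by
  have h1 : ∀ x y, fderiv ℝ Φ.frame z (Φ.frame z x) y = _ := fun x y =>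
    Φ.fderiv_anchor_comp Φ.smooth_coeff hz (Φ.frame z x) y
  have h2 := A.bracket_spec z (Φ.domain_subset hz) hM (Φ.coeff z x) (Φ.coeff z y)
  have hf : ∀ x, A.anchor z (Φ.coeff z x) = Φ.frame z x := fun _ => rfl
  rw [hf, hf] at h2
  set e := A.bracket z (Φ.coeff z x) (Φ.coeff z y)
    + (fderiv ℝ Φ.coeff z (Φ.frame z x) y - fderiv ℝ Φ.coeff z (Φ.frame z y) x) with he
  have h3 : fderiv ℝ Φ.frame z (Φ.frame z x) y - fderiv ℝ Φ.frame z (Φ.frame z y) x =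
      A.anchor z e := by
    rw [h1, h1, he, map_add, map_sub, ← h2]; abel
  have h4 : Φ.proj (A.anchor z e) = 0 := by
    rw [← h3, map_sub, Φ.proj_fderiv_frame hz, Φ.proj_fderiv_frame hz, sub_self]
  have h5 := Φ.vert_apply z e
  rw [h4, h0, map_zero, sub_zero] at h5
  rw [← sub_eq_zero, h3, ← h5]
  rfl

theorem frame_injective {z : E} (hz : z ∈ Φ.domain) : Function.Injective (Φ.frame z) :=
  Function.LeftInverse.injective (Φ.proj_frame hz)

theorem range_frame_le (z : E) : LinearMap.range (Φ.frame z).toLinearMap ≤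
    LinearMap.range (A.anchor z).toLinearMap := by
  rintro _ ⟨x, rfl⟩
  exact ⟨Φ.coeff z x, rfl⟩

theorem anchor_eq_of_vert_eq_zero {z : E} (h0 : Φ.vert z = 0) (b : F) :
    A.anchor z b = Φ.frame z (Φ.proj (A.anchor z b)) := by
  have h5 := Φ.vert_apply z b
  rw [h0] at h5
  exact (sub_eq_zero.1 h5.symm)

theorem range_frame_of_vert_eq_zero {z : E} (h0 : Φ.vert z = 0) :
    LinearMap.range (Φ.frame z).toLinearMap = LinearMap.range (A.anchor z).toLinearMap := by
  refine le_antisymm (Φ.range_frame_le z) ?_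
  rintro _ ⟨b, rfl⟩
  exact ⟨_, (Φ.anchor_eq_of_vert_eq_zero h0 b).symm⟩

theorem finrank_range_frame {z : E} (hz : z ∈ Φ.domain) :
    finrank ℝ (LinearMap.range (Φ.frame z).toLinearMap) = finrank ℝ K :=
  LinearMap.finrank_range_of_inj (Φ.frame_injective hz)

/-- The frame always has rank `finrank ℝ K`, so `vert` detects any excess of rank of the anchor.
Constancy of the rank becomes the vanishing of the solution of a linear equation. -/
theorem vert_eq_zero_iff [FiniteDimensional ℝ E] {z : E} (hz : z ∈ Φ.domain) :
    Φ.vert z = 0 ↔ finrank ℝ (LinearMap.range (A.anchor z).toLinearMap) = finrank ℝ K := by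
  refine ⟨fun h => ?_, fun h => ?_⟩
  · rw [← Φ.range_frame_of_vert_eq_zero h, Φ.finrank_range_frame hz]
  · have h1 : LinearMap.range (Φ.frame z).toLinearMap =
        LinearMap.range (A.anchor z).toLinearMap :=
      Submodule.eq_of_le_of_finrank_eq (Φ.range_frame_le z) ((Φ.finrank_range_frame hz).trans h.symm)
    ext b
    have h2 : A.anchor z b ∈ LinearMap.range (Φ.frame z).toLinearMap := h1 ▸ ⟨b, rfl⟩
    obtain ⟨x, hx⟩ := h2
    replace hx : Φ.frame z x = A.anchor z b := hx
    rw [Φ.vert_apply, ← hx, Φ.proj_frame hz, sub_self]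
    rfl

/-- The vertical part satisfies a linear differential equation along the motions of the family. -/
theorem vert_eq_zero_along {γ : ℝ → E} {a : ℝ → F} (ha : ContinuousOn a (Icc 0 1))
    (hγ : ∀ t ∈ Icc (0 : ℝ) 1, γ t ∈ Φ.domain)
    (hγ' : ∀ t ∈ Icc (0 : ℝ) 1, HasDerivWithinAt γ (A.anchor (γ t) (a t)) (Icc 0 1) t)
    (hM : ∀ t ∈ Icc (0 : ℝ) 1, γ t ∈ A.locus) (h0 : Φ.vert (γ 0) = 0) :
    ∀ t ∈ Icc (0 : ℝ) 1, Φ.vert (γ t) = 0 := by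
  have hγc : ContinuousOn γ (Icc 0 1) := fun t ht => (hγ' t ht).continuousWithinAt
  -- The norms of the coefficients in `fderiv_vert`, summed. Being continuous on a compact interval,
  -- `κ` is bounded by some `B`, and the derivative of `vert` along the motion is at most `B` times
  -- `vert` in norm.
  set κ : ℝ → ℝ := fun t =>
    ‖fderiv ℝ A.anchor (γ t)‖ * ‖a t‖
      + ‖Φ.frame (γ t)‖ * (‖Φ.proj‖ * (‖fderiv ℝ A.anchor (γ t)‖ * ‖a t‖))
      + (‖A.bracket (γ t)‖ * ‖a t‖ * ‖Φ.vertCoeff (γ t)‖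
        + ‖fderiv ℝ Φ.vertCoeff (γ t)‖ * (‖A.anchor (γ t)‖ * ‖a t‖)) with hκ
  have hκc : ContinuousOn κ (Icc 0 1) := by
    have c1 := ((Φ.continuousOn_fderiv_of_smooth Φ.smooth_anchor).comp hγc hγ).norm
    have c2 := (Φ.smooth_frame.continuousOn.comp hγc hγ).norm
    have c3 : ContinuousOn (fun t => ‖A.bracket (γ t)‖) (Icc 0 1) :=
      Continuous.comp_continuousOn (g := fun c : F →L[ℝ] F →L[ℝ] F => ‖c‖)
        (continuous_norm (E := F →L[ℝ] F →L[ℝ] F))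
        ((A.continuousOn_bracket.mono Φ.domain_subset).comp hγc hγ)
    have c4 := (Φ.smooth_vertCoeff.continuousOn.comp hγc hγ).norm
    have c5 := ((Φ.continuousOn_fderiv_of_smooth Φ.smooth_vertCoeff).comp hγc hγ).norm
    have c6 := (Φ.smooth_anchor.continuousOn.comp hγc hγ).norm
    have c7 := ha.norm
    exact ((c1.mul c7).add (c2.mul (continuousOn_const.mul (c1.mul c7)))).add
      (((c3.mul c7).mul c4).add (c5.mul (c6.mul c7)))
  obtain ⟨B, hB⟩ := isCompact_Icc.bddAbove_image hκc
  refine eq_zero_of_abs_deriv_le_mul_abs_self_of_eq_zero_right (f := fun t => Φ.vert (γ t))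
    (f' := fun t => fderiv ℝ Φ.vert (γ t) (A.anchor (γ t) (a t))) (K := B)
    (Φ.smooth_vert.continuousOn.comp hγc hγ) (fun t ht => ?_) h0 (fun t ht => ?_)
  · have ht' := Ico_subset_Icc_self ht
    have := (Φ.differentiableAt_of_smooth Φ.smooth_vert (hγ t ht')).hasFDerivAt
      |>.comp_hasDerivWithinAt t (hγ' t ht')
    exact this.mono_of_mem_nhdsWithin (Icc_mem_nhdsGE_of_mem ht)
  · have ht' := Ico_subset_Icc_self ht
    have hBt : κ t ≤ B := hB (mem_image_of_mem κ ht')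
    refine le_trans ?_ (mul_le_mul_of_nonneg_right hBt (norm_nonneg _))
    refine ContinuousLinearMap.opNorm_le_bound _ (by positivity) fun b => ?_
    rw [Φ.fderiv_vert (hγ t ht') (hM t ht')]
    have hb := (Φ.vert (γ t)).le_opNorm b
    have h1 : ‖fderiv ℝ A.anchor (γ t) (Φ.vert (γ t) b) (a t)‖ ≤
        ‖fderiv ℝ A.anchor (γ t)‖ * (‖Φ.vert (γ t)‖ * ‖b‖) * ‖a t‖ := by
      refine (ContinuousLinearMap.le_opNorm _ _).trans ?_
      gcongr
      refine (ContinuousLinearMap.le_opNorm _ _).trans ?_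
      gcongr
    have h2 : ‖Φ.frame (γ t) (Φ.proj (fderiv ℝ A.anchor (γ t) (Φ.vert (γ t) b) (a t)))‖ ≤
        ‖Φ.frame (γ t)‖ * (‖Φ.proj‖ *
          (‖fderiv ℝ A.anchor (γ t)‖ * (‖Φ.vert (γ t)‖ * ‖b‖) * ‖a t‖)) := by
      refine (ContinuousLinearMap.le_opNorm _ _).trans ?_
      gcongr
      refine (ContinuousLinearMap.le_opNorm _ _).trans ?_
      gcongr
    have h3 : ‖A.bracket (γ t) (a t) (Φ.vertCoeff (γ t) b)‖ ≤
        ‖A.bracket (γ t)‖ * ‖a t‖ * (‖Φ.vertCoeff (γ t)‖ * ‖b‖) := by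
      refine (ContinuousLinearMap.le_opNorm _ _).trans ?_
      gcongr
      · exact ContinuousLinearMap.le_opNorm _ _
      · exact ContinuousLinearMap.le_opNorm _ _
    have h4 : ‖fderiv ℝ Φ.vertCoeff (γ t) (A.anchor (γ t) (a t)) b‖ ≤
        ‖fderiv ℝ Φ.vertCoeff (γ t)‖ * (‖A.anchor (γ t)‖ * ‖a t‖) * ‖b‖ := by
      refine (ContinuousLinearMap.le_opNorm _ _).trans ?_
      gcongr
      refine (ContinuousLinearMap.le_opNorm _ _).trans ?_
      gcongr
      exact ContinuousLinearMap.le_opNorm _ _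
    have h5 : ‖Φ.vert (γ t) (A.bracket (γ t) (a t) (Φ.vertCoeff (γ t) b)
          + fderiv ℝ Φ.vertCoeff (γ t) (A.anchor (γ t) (a t)) b)‖ ≤
        ‖Φ.vert (γ t)‖ * (‖A.bracket (γ t)‖ * ‖a t‖ * (‖Φ.vertCoeff (γ t)‖ * ‖b‖)
          + ‖fderiv ℝ Φ.vertCoeff (γ t)‖ * (‖A.anchor (γ t)‖ * ‖a t‖) * ‖b‖) := by
      refine (ContinuousLinearMap.le_opNorm _ _).trans ?_
      gcongr
      exact (norm_add_le _ _).trans (add_le_add h3 h4)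
    calc _ ≤ _ := (norm_add_le _ _).trans (add_le_add ((norm_sub_le _ _).trans
            (add_le_add h1 h2)) h5)
      _ = _ := by rw [hκ]; ring

end AdaptedFrame

end InvolutiveAnchor

/-! ### Plaques of an involutive family -/

section Plaques

variable {E F K : Type*} [NormedAddCommGroup E] [NormedSpace ℝ E]
  [NormedAddCommGroup F] [NormedSpace ℝ F]
  [NormedAddCommGroup K] [NormedSpace ℝ K]

/-- A solution of the total differential equation `D σ = W ∘ σ` with smooth `W` is smooth. -/
theorem contDiffOn_of_hasFDerivAt_comp {W : E → K →L[ℝ] E} {V : Set E} {U : Set K} {σ : K → E}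
    (hU : IsOpen U) (hW : ContDiffOn ℝ ∞ W V) (hσ : ∀ x ∈ U, σ x ∈ V)
    (hσ' : ∀ x ∈ U, HasFDerivAt σ (W (σ x)) x) : ContDiffOn ℝ ∞ σ U := by
  refine contDiffOn_infty.2 fun n => ?_
  induction n with
  | zero =>
    exact contDiffOn_zero.2 fun x hx => (hσ' x hx).continuousAt.continuousWithinAt
  | succ n ih =>
    rw [show ((n + 1 : ℕ) : WithTop ℕ∞) = (n : WithTop ℕ∞) + 1 by push_cast; rfl,
      contDiffOn_succ_iff_fderiv_of_isOpen hU]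
    refine ⟨fun x hx => (hσ' x hx).differentiableAt.differentiableWithinAt, by simp, ?_⟩
    exact ((hW.of_le (by exact_mod_cast le_top)).comp ih hσ).congr
      fun x hx => (hσ' x hx).fderiv

/-- Uniqueness of the solutions of `D σ = W ∘ σ`, tested along curves: a curve that is
tangent to the frame `W` and starts on the graph of `σ` stays on it. -/
theorem eq_of_tangent_of_eq {W : E → K →L[ℝ] E} {V : Set E} {C : NNReal}
    (hW : LipschitzOnWith C W V) {σ : K → E} {U : Set K} (hσ : ∀ x ∈ U, σ x ∈ V)
    (hσ' : ∀ x ∈ U, HasFDerivAt σ (W (σ x)) x) {γ : ℝ → E} {p : ℝ → K} {p' : ℝ → K} {B : NNReal}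
    (hp : ∀ t ∈ Icc (0 : ℝ) 1, p t ∈ U ∧ HasDerivWithinAt p (p' t) (Icc 0 1) t ∧ ‖p' t‖ ≤ B)
    (hγ : ∀ t ∈ Icc (0 : ℝ) 1, γ t ∈ V ∧ HasDerivWithinAt γ (W (γ t) (p' t)) (Icc 0 1) t)
    (h0 : γ 0 = σ (p 0)) : ∀ t ∈ Icc (0 : ℝ) 1, γ t = σ (p t) := by
  -- Both `γ` and `σ ∘ p` solve `z' = W z (p' t)`. The bound on `p'` provides a Lipschitz constant
  -- that is uniform in `t`; no continuity of `p'` is involved.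
  have hd : ∀ t ∈ Icc (0 : ℝ) 1,
      HasDerivWithinAt (fun t => σ (p t)) (W (σ (p t)) (p' t)) (Icc 0 1) t := fun t ht =>
    (hσ' _ (hp t ht).1).comp_hasDerivWithinAt t (hp t ht).2.1
  refine ODE_solution_unique_of_mem_Icc_right (v := fun t z => W z (p' t)) (K := C * B)
    (s := fun _ => V) (fun t ht => ?_) (fun t ht => (hγ t ht).2.continuousWithinAt)
    (fun t ht => (hγ t (Ico_subset_Icc_self ht)).2.mono_of_mem_nhdsWithin
      (Icc_mem_nhdsGE_of_mem ht))
    (fun t ht => (hγ t (Ico_subset_Icc_self ht)).1)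
    (fun t ht => (hd t ht).continuousWithinAt)
    (fun t ht => (hd t (Ico_subset_Icc_self ht)).mono_of_mem_nhdsWithin
      (Icc_mem_nhdsGE_of_mem ht))
    (fun t ht => hσ _ (hp t (Ico_subset_Icc_self ht)).1) h0
  refine LipschitzOnWith.of_dist_le_mul fun z hz z' hz' => ?_
  have h' := hW.dist_le_mul z hz z' hz'
  have hB := (hp t (Ico_subset_Icc_self ht)).2.2
  rw [dist_eq_norm] at h' ⊢
  rw [← sub_apply]
  refine ((W z - W z').le_opNorm _).trans ?_
  push_cast
  calc ‖W z - W z'‖ * ‖p' t‖ ≤ (C * dist z z') * B := by gcongr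
    _ = _ := by ring

theorem eq_add_smul_of_hasDerivAt {f : ℝ → K} {x : K}
    (hf : ∀ t ∈ Icc (0 : ℝ) 1, HasDerivWithinAt f x (Icc 0 1) t) : f 1 = f 0 + x := by
  have h := norm_image_sub_le_of_norm_deriv_le_segment_01' (f := fun t => f t - t • x)
    (f' := fun _ => 0) (C := 0) (fun t ht => by
      have h := (hf t ht).sub ((hasDerivWithinAt_id t (Icc 0 1)).smul_const x)
      rw [one_smul, sub_self] at h
      exact h) (by simp)
  simp only [one_smul, zero_smul, sub_zero, norm_le_zero_iff] at h
  rw [sub_sub, sub_eq_zero, add_comm] at h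
  exact h

variable [FiniteDimensional ℝ E] [FiniteDimensional ℝ F] [FiniteDimensional ℝ K]

/-- Through every point of the locus of an involutive anchor there passes a plaque: the image of a
smooth section `σ` of a projection whose tangent spaces are spanned by the fields. -/
theorem InvolutiveAnchor.exists_plaque (A : InvolutiveAnchor E F) {z₀ : E} (hz₀ : z₀ ∈ A.domain)
    (hM₀ : z₀ ∈ A.locus)
    (hk : finrank ℝ (LinearMap.range (A.anchor z₀).toLinearMap) = finrank ℝ K) :
    ∃ (V : Set E) (pr : E →L[ℝ] K) (r : ℝ) (σ : K → E),
      IsOpen V ∧ z₀ ∈ V ∧ V ⊆ A.domain ∧ 0 < r ∧ σ 0 = z₀ ∧ ContDiffOn ℝ ∞ σ (ball 0 r) ∧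
      (∀ x ∈ ball (0 : K) r, σ x ∈ V ∧ σ x ∈ A.locus ∧ pr (σ x) = pr z₀ + x ∧
        LinearMap.range (fderiv ℝ σ x).toLinearMap =
          LinearMap.range (A.anchor (σ x)).toLinearMap) ∧
      (∀ (γ : ℝ → E) (d : ℝ → E) (B : ℝ),
        (∀ t ∈ Icc (0 : ℝ) 1, γ t ∈ V ∧ pr (γ t) - pr z₀ ∈ ball 0 r ∧
          HasDerivWithinAt γ (d t) (Icc 0 1) t ∧ ‖d t‖ ≤ B ∧
          d t ∈ LinearMap.range (A.anchor (γ t)).toLinearMap ∧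
          finrank ℝ (LinearMap.range (A.anchor (γ t)).toLinearMap) = finrank ℝ K) →
        γ 0 = σ (pr (γ 0) - pr z₀) →
        ∀ t ∈ Icc (0 : ℝ) 1, γ t = σ (pr (γ t) - pr z₀)) ∧
      (∀ (γ : ℝ → E) (a : ℝ → F), ContinuousOn a (Icc 0 1) → γ 0 = z₀ →
        (∀ t ∈ Icc (0 : ℝ) 1, γ t ∈ V ∧
          HasDerivWithinAt γ (A.anchor (γ t) (a t)) (Icc 0 1) t) →
        ∀ t ∈ Icc (0 : ℝ) 1, γ t ∈ A.locus ∧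
          finrank ℝ (LinearMap.range (A.anchor (γ t)).toLinearMap) = finrank ℝ K) ∧
      ∀ x ∈ ball (0 : K) r, ∃ (b : F) (γ : ℝ → E), γ 0 = z₀ ∧ γ 1 = σ x ∧
        ∀ t ∈ Ioo (-2 : ℝ) 2, γ t ∈ V ∧ HasDerivAt γ (A.anchor (γ t) b) t := by
  have : CompleteSpace E := FiniteDimensional.complete ℝ E
  have : CompleteSpace K := FiniteDimensional.complete ℝ K
  obtain ⟨Φ, hΦ⟩ := AdaptedFrame.exists_of_finrank A hz₀ hk
  have hnhds := Φ.isOpen_domain.mem_nhds hΦ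
  have hWs : ContDiffAt ℝ ∞ Φ.frame z₀ := Φ.smooth_frame.contDiffAt hnhds
  obtain ⟨ρ₁, hρ₁, C, hC, hWb, hWl, hWd', hW₂⟩ :=
    exists_ball_estimates (contDiffAt_infty.1 hWs 2 : ContDiffAt ℝ 2 Φ.frame z₀)
  obtain ⟨ρ₂, hρ₂, hball⟩ := Metric.mem_nhds_iff.1 hnhds
  set ρ := min ρ₁ ρ₂ with hρdef
  have hρ : 0 < ρ := lt_min hρ₁ hρ₂
  have hV₁ : ball z₀ ρ ⊆ ball z₀ ρ₁ := ball_subset_ball (min_le_left _ _)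
  have hV₂ : ball z₀ ρ ⊆ Φ.domain := (ball_subset_ball (min_le_right _ _)).trans hball
  have hhalf : ball z₀ (ρ / 2) ⊆ ball z₀ ρ := ball_subset_ball (by linarith)
  have h0mem : (0 : ℝ) ∈ Icc (0 : ℝ) 1 := by norm_num
  have h1mem : (1 : ℝ) ∈ Icc (0 : ℝ) 1 := by norm_num
  have hIcc : ∀ t ∈ Icc (0 : ℝ) 1, t ∈ Ioo (-2 : ℝ) 2 := fun t ht =>
    ⟨by linarith [ht.1], by linarith [ht.2]⟩
  -- The rays are confined to half the radius, which leaves room for the comparison curves in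
  -- `hasFDerivAt_of_integrable_along`.
  obtain ⟨r, hr, hu⟩ := exists_linear_family_solutions (K := K) (G := Φ.frame)
    (hWs.of_le (by exact_mod_cast le_top)) (half_pos hρ)
  choose! u hu0 hu using hu
  have hvert₀ : Φ.vert z₀ = 0 := (Φ.vert_eq_zero_iff hΦ).2 hk
  -- the rank and the locus are preserved along the motions that start at `z₀`
  have hstay : ∀ (γ : ℝ → E) (a : ℝ → F), ContinuousOn a (Icc 0 1) → γ 0 = z₀ →
      (∀ t ∈ Icc (0 : ℝ) 1, γ t ∈ ball z₀ ρ ∧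
        HasDerivWithinAt γ (A.anchor (γ t) (a t)) (Icc 0 1) t) →
      ∀ t ∈ Icc (0 : ℝ) 1, γ t ∈ A.locus ∧ Φ.vert (γ t) = 0 := by
    intro γ a ha hγ0 hγ
    have hM := A.invariant γ a ha (fun t ht => Φ.domain_subset (hV₂ (hγ t ht).1))
      (fun t ht => (hγ t ht).2) (by rw [hγ0]; exact hM₀)
    exact fun t ht => ⟨hM t ht, Φ.vert_eq_zero_along ha (fun t ht => hV₂ (hγ t ht).1)
      (fun t ht => (hγ t ht).2) hM (by rw [hγ0]; exact hvert₀) t ht⟩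
  have hray : ∀ x, ‖x‖ < r → ∀ t ∈ Icc (0 : ℝ) 1, u x t ∈ A.locus ∧ Φ.vert (u x t) = 0 := by
    intro x hx
    refine hstay (u x) (fun t => Φ.coeff (u x t) x) ?_ (hu0 x hx) fun t ht =>
      ⟨hhalf (hu x hx t (hIcc t ht)).1, (hu x hx t (hIcc t ht)).2.hasDerivWithinAt⟩
    have hc : ContinuousOn (u x) (Icc 0 1) := fun t ht =>
      (hu x hx t (hIcc t ht)).2.continuousAt.continuousWithinAt
    exact (Φ.smooth_coeff.continuousOn.comp hc
      fun t ht => hV₂ (hhalf (hu x hx t (hIcc t ht)).1)).clm_apply continuousOn_const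
  set σ : K → E := fun x => u x 1 with hσdef
  have hσV : ∀ x ∈ ball (0 : K) r, σ x ∈ ball z₀ ρ := fun x hx =>
    hhalf (hu x (mem_ball_zero_iff.1 hx) 1 (hIcc 1 h1mem)).1
  -- Rays are motions of the family that start at `z₀`, so they stay in the locus and `vert`
  -- vanishes on them. Integrability is available there, and is required only there.
  have hσ' : ∀ x ∈ ball (0 : K) r, HasFDerivAt σ (Φ.frame (σ x)) x := by
    intro x hx
    rw [mem_ball_zero_iff] at hx
    refine hasFDerivAt_of_integrable_along hC hρ
      (fun z hz => Φ.differentiableAt_of_smooth Φ.smooth_frame (hV₂ hz))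
      (fun z hz => hWb z (hV₁ hz)) (hWl.mono hV₁) (fun z hz => hWd' z (hV₁ hz))
      (fun z hz z' hz' => hW₂ z (hV₁ hz) z' (hV₁ hz'))
      (fun x hx => ⟨hu0 x hx, fun t ht => hu x hx t (hIcc t ht)⟩) hx fun t ht h => ?_
    exact Φ.fderiv_frame_symm (hV₂ (hhalf (hu x hx t (hIcc t ht)).1)) (hray x hx t ht).1
      (hray x hx t ht).2 x h
  have hσpr : ∀ x ∈ ball (0 : K) r, Φ.proj (σ x) = Φ.proj z₀ + x := by
    intro x hx
    rw [mem_ball_zero_iff] at hx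
    have h := eq_add_smul_of_hasDerivAt (f := fun t => Φ.proj (u x t)) (x := x) fun t ht => by
      have h1 := hu x hx t (hIcc t ht)
      have h2 := Φ.proj.hasFDerivAt.comp_hasDerivAt t h1.2
      rw [Φ.proj_frame (hV₂ (hhalf h1.1))] at h2
      exact h2.hasDerivWithinAt
    simpa only [hu0 x hx] using h
  have hσ0 : σ 0 = z₀ := by
    have h0 : ‖(0 : K)‖ < r := by simpa using hr
    have h := eq_add_smul_of_hasDerivAt (f := u 0) (x := 0) fun t ht => by
      have h1 := (hu 0 h0 t (hIcc t ht)).2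
      rw [map_zero] at h1
      exact h1.hasDerivWithinAt
    rw [hu0 0 h0, add_zero] at h
    exact h
  -- Where `vert` vanishes, a velocity in the range of the anchor is the frame applied to its own
  -- projection, so `γ` solves the equation that `σ` satisfies along the projected curve.
  have hcurve : ∀ (γ : ℝ → E) (d : ℝ → E) (B : ℝ),
      (∀ t ∈ Icc (0 : ℝ) 1, γ t ∈ ball z₀ ρ ∧ Φ.proj (γ t) - Φ.proj z₀ ∈ ball 0 r ∧
        HasDerivWithinAt γ (d t) (Icc 0 1) t ∧ ‖d t‖ ≤ B ∧
        d t ∈ LinearMap.range (A.anchor (γ t)).toLinearMap ∧ Φ.vert (γ t) = 0) →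
      γ 0 = σ (Φ.proj (γ 0) - Φ.proj z₀) →
      ∀ t ∈ Icc (0 : ℝ) 1, γ t = σ (Φ.proj (γ t) - Φ.proj z₀) := by
    intro γ d B hγ h0
    have hB0 : 0 ≤ B := (norm_nonneg _).trans (hγ 0 h0mem).2.2.2.1
    refine eq_of_tangent_of_eq (hWl.mono hV₁) hσV hσ' (p := fun t => Φ.proj (γ t) - Φ.proj z₀)
      (p' := fun t => Φ.proj (d t)) (B := ⟨‖Φ.proj‖ * B, by positivity⟩) (fun t ht => ?_)
      (fun t ht => ?_) h0
    · obtain ⟨-, h2, h3, h4, -⟩ := hγ t ht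
      refine ⟨h2, (Φ.proj.hasFDerivAt.comp_hasDerivWithinAt t h3).sub_const _, ?_⟩
      refine (Φ.proj.le_opNorm _).trans ?_
      change _ ≤ ‖Φ.proj‖ * B
      gcongr
    · obtain ⟨h1, h2, h3, h4, ⟨b, hb⟩, h6⟩ := hγ t ht
      refine ⟨h1, ?_⟩
      have := Φ.anchor_eq_of_vert_eq_zero h6 b
      replace hb : A.anchor (γ t) b = d t := hb
      rw [hb] at this
      rwa [← this]
  -- the exponential map of the fields covers a neighbourhood of `z₀` in the plaque
  obtain ⟨ρ₃, hρ₃, hprball⟩ : ∃ ρ₃ > 0, ∀ z ∈ ball z₀ ρ₃, Φ.proj z - Φ.proj z₀ ∈ ball 0 r := by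
    have : ∀ᶠ z in 𝓝 z₀, Φ.proj z - Φ.proj z₀ ∈ ball 0 r :=
      (Φ.proj.continuous.sub continuous_const).continuousAt.eventually_mem
        (by rw [Pi.sub_apply, sub_self]; exact ball_mem_nhds _ hr)
    exact Metric.eventually_nhds_iff_ball.1 this
  -- The coefficients are frozen at `z₀`, so each solution is an integral curve of one field of the
  -- family. Along the rays that define `σ` the coefficients vary, so those need not be flow curves.
  set G : E → K →L[ℝ] E := fun z => A.anchor z ∘L Φ.coeff z₀ with hG
  have hGs : ContDiffAt ℝ ∞ G z₀ :=
    (Φ.smooth_anchor.clm_comp contDiffOn_const).contDiffAt hnhds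
  obtain ⟨ρ₄, hρ₄, C', hC', hGb, hGl, -, -⟩ :=
    exists_ball_estimates (contDiffAt_infty.1 hGs 2 : ContDiffAt ℝ 2 G z₀)
  obtain ⟨r', hr', he⟩ := exists_linear_family_solutions (K := K) (G := G)
    (hGs.of_le (by exact_mod_cast le_top))
    (ρ := min ρ (min ρ₃ ρ₄)) (lt_min hρ (lt_min hρ₃ hρ₄))
  choose! e he0 he using he
  have hb₁ : ball z₀ (min ρ (min ρ₃ ρ₄)) ⊆ ball z₀ ρ := ball_subset_ball (min_le_left _ _)
  have hb₃ : ball z₀ (min ρ (min ρ₃ ρ₄)) ⊆ ball z₀ ρ₃ :=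
    ball_subset_ball ((min_le_right _ _).trans (min_le_left _ _))
  have hb₄ : ball z₀ (min ρ (min ρ₃ ρ₄)) ⊆ ball z₀ ρ₄ :=
    ball_subset_ball ((min_le_right _ _).trans (min_le_right _ _))
  have hstrict := hasStrictFDerivAt_linear_family hC' hGb hGl hr' (u := e)
    fun x hx => ⟨he0 x hx, fun t ht => ⟨hb₄ (he x hx t (hIcc t ht)).1,
      (he x hx t (hIcc t ht)).2⟩⟩
  have he10 : e 0 1 = z₀ := by
    have h0 : ‖(0 : K)‖ < r' := by simpa using hr'
    have h := eq_add_smul_of_hasDerivAt (f := e 0) (x := 0) fun t ht => by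
      have h1 := (he 0 h0 t (hIcc t ht)).2
      rw [map_zero] at h1
      exact h1.hasDerivWithinAt
    rw [he0 0 h0, add_zero] at h
    exact h
  -- The projected time-one map has the identity as strict derivative at 0, so it covers a
  -- neighbourhood of 0. The end points lie on the plaque by `hcurve`, hence are determined by their
  -- projections.
  have hstrict' : HasStrictFDerivAt (fun x => Φ.proj (e x 1) - Φ.proj z₀)
      ((ContinuousLinearEquiv.refl ℝ K : K ≃L[ℝ] K) : K →L[ℝ] K) 0 := by
    have h := (Φ.proj.hasStrictFDerivAt.comp (0 : K) hstrict).sub_const (Φ.proj z₀)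
    convert! h using 1
    ext x
    exact (Φ.proj_anchor z₀ hΦ x).symm
  have hmap := hstrict'.map_nhds_eq_of_equiv
  rw [he10, sub_self] at hmap
  have hcover : (fun x => Φ.proj (e x 1) - Φ.proj z₀) '' ball 0 r' ∈ 𝓝 (0 : K) := by
    rw [← hmap]
    exact Filter.image_mem_map (ball_mem_nhds _ hr')
  obtain ⟨r'', hr'', hcov⟩ := Metric.mem_nhds_iff.1 hcover
  have hsub : ball (0 : K) (min r r'') ⊆ ball 0 r := ball_subset_ball (min_le_left _ _)
  refine ⟨ball z₀ ρ, Φ.proj, min r r'', σ, isOpen_ball, mem_ball_self hρ,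
    hV₂.trans Φ.domain_subset, lt_min hr hr'', hσ0,
    (contDiffOn_of_hasFDerivAt_comp isOpen_ball (Φ.smooth_frame.mono hV₂) hσV hσ').mono hsub,
    fun x hx => ?_, fun γ d B hγ h0 => ?_, fun γ a ha h0 hγ t ht => ?_, fun x hx => ?_⟩
  · replace hx := hsub hx
    have hx' := mem_ball_zero_iff.1 hx
    refine ⟨hσV x hx, (hray x hx' 1 h1mem).1, hσpr x hx, ?_⟩
    rw [(hσ' x hx).fderiv]
    exact Φ.range_frame_of_vert_eq_zero (hray x hx' 1 h1mem).2
  · refine hcurve γ d B (fun t ht => ?_) h0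
    obtain ⟨h1, h2, h3, h4, h5, h6⟩ := hγ t ht
    exact ⟨h1, hsub h2, h3, h4, h5, (Φ.vert_eq_zero_iff (hV₂ h1)).2 h6⟩
  · have h := hstay γ a ha h0 hγ t ht
    exact ⟨h.1, (Φ.vert_eq_zero_iff (hV₂ (hγ t ht).1)).1 h.2⟩
  · obtain ⟨ξ, hξ, hξx⟩ := hcov (ball_subset_ball (min_le_right _ _) hx)
    rw [mem_ball_zero_iff] at hξ
    refine ⟨Φ.coeff z₀ ξ, e ξ, he0 ξ hξ, ?_, fun t ht =>
      ⟨hb₁ (he ξ hξ t ht).1, (he ξ hξ t ht).2⟩⟩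
    have hst := hstay (e ξ) (fun _ => Φ.coeff z₀ ξ) continuousOn_const (he0 ξ hξ) fun t ht =>
      ⟨hb₁ (he ξ hξ t (hIcc t ht)).1, (he ξ hξ t (hIcc t ht)).2.hasDerivWithinAt⟩
    have hec : ContinuousOn (e ξ) (Icc 0 1) := fun t ht =>
      (he ξ hξ t (hIcc t ht)).2.continuousAt.continuousWithinAt
    have hdc : ContinuousOn (fun t => ‖G (e ξ t) ξ‖) (Icc 0 1) := by
      have h1 : ContinuousOn G Φ.domain :=
        (Φ.smooth_anchor.clm_comp contDiffOn_const).continuousOn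
      exact ((h1.comp hec fun t ht => hV₂ (hb₁ (he ξ hξ t (hIcc t ht)).1)).clm_apply
        continuousOn_const).norm
    obtain ⟨B, hB⟩ := isCompact_Icc.bddAbove_image hdc
    have hfin := hcurve (e ξ) (fun t => G (e ξ t) ξ) B (fun t ht => ?_) ?_ 1 h1mem
    · rw [hfin]
      exact congrArg σ hξx
    · have h1 := he ξ hξ t (hIcc t ht)
      exact ⟨hb₁ h1.1, hprball _ (hb₃ h1.1), h1.2.hasDerivWithinAt,
        hB (mem_image_of_mem _ ht), ⟨_, rfl⟩, (hst t ht).2⟩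
    · rw [he0 ξ hξ, sub_self, hσ0]

end Plaques

/-! ### Orbits of families of vector fields -/

section Orbits

variable {E H : Type*} [NormedAddCommGroup E] [NormedSpace ℝ E] [TopologicalSpace H]
  {I : ModelWithCorners ℝ E H} {X : Type u} [TopologicalSpace X] [ChartedSpace H X]
  {ι : Type*} {V : ι → ∀ x : X, TangentSpace I x}

theorem FlowStep.symm {z z' : X} (h : FlowStep V z z') : FlowStep V z' z := by
  obtain ⟨i, γ, a, b, s, t, hs, ht, hγ, h1, h2⟩ := h
  exact ⟨i, γ, a, b, t, s, ht, hs, hγ, h2, h1⟩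

theorem SameOrbit.symm {z z' : X} (h : SameOrbit V z z') : SameOrbit V z' z :=
  have : Std.Symm (FlowStep V) := ⟨fun _ _ h => FlowStep.symm h⟩
  Std.Symm.symm (r := Relation.ReflTransGen (FlowStep V)) _ _ h

theorem SameOrbit.trans {z z' z'' : X} (h : SameOrbit V z z') (h' : SameOrbit V z' z'') :
    SameOrbit V z z'' :=
  Relation.ReflTransGen.trans h h'

/-- A property that propagates locally in both directions along integral curves of the
fields of the family is constant along orbits. -/
theorem SameOrbit.induction {p : X → Prop}
    (hp : ∀ (i : ι) (γ : ℝ → X) (a b t : ℝ), t ∈ Ioo a b → IsMIntegralCurveOn γ (V i) (Ioo a b) →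
      (∀ s ∈ Ioo a b, SameOrbit V (γ t) (γ s)) →
      ∀ᶠ s in 𝓝 t, (p (γ t) → p (γ s)) ∧ (p (γ s) → p (γ t)))
    {z z' : X} (h : SameOrbit V z z') (hz : p z) : p z' := by
  induction h with
  | refl => exact hz
  | tail _ hstep ih =>
    obtain ⟨i, γ, a, b, s, t, hs, ht, hγ, rfl, rfl⟩ := hstep
    refine isPreconnected_Ioo.induction₂' (fun s t => p (γ s) → p (γ t)) (fun t ht => ?_)
      (fun _ _ _ _ _ _ h h' hx => h' (h hx)) hs ht ih
    exact (hp i γ a b t ht hγ fun s hs =>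
      .single ⟨i, γ, a, b, t, s, ht, hs, hγ, rfl, rfl⟩).filter_mono nhdsWithin_le_nhds

end Orbits

/-! ### The leaf structure on an orbit -/

section Leaves

variable {E H : Type*} [NormedAddCommGroup E] [NormedSpace ℝ E] [TopologicalSpace H]
  (I : ModelWithCorners ℝ E H) {X : Type u} [TopologicalSpace X] [ChartedSpace H X]
  (D : Distribution I X) (M : Set X) {ι : Type*} (V : ι → ∀ x : X, TangentSpace I x)

/-- A `k`-dimensional plaque through `w`: a small parametrized integral manifold of `D` in `M`
that is reached from `w` by the flows of the family `V`, and that contains all small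
integral manifolds and integral curves through its points. -/
structure Plaque (k : ℕ) (w : X) where
  /-- a neighbourhood of `w` -/
  nbhd : Set X
  isOpen_nbhd : IsOpen nbhd
  /-- the radius of the parameter domain -/
  radius : ℝ
  radius_pos : 0 < radius
  /-- the parametrization -/
  param : EuclideanSpace ℝ (Fin k) → X
  /-- a left inverse of the parametrization -/
  coord : X → EuclideanSpace ℝ (Fin k)
  coord_smooth : ContMDiffOn I 𝓘(ℝ, EuclideanSpace ℝ (Fin k)) ∞ coord nbhd
  param_smooth : ContMDiffOn 𝓘(ℝ, EuclideanSpace ℝ (Fin k)) I ∞ param (ball 0 radius)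
  param_zero : param 0 = w
  param_mem_nbhd : ∀ x ∈ ball 0 radius, param x ∈ nbhd
  param_mem : ∀ x ∈ ball 0 radius, param x ∈ M
  coord_param : ∀ x ∈ ball 0 radius, coord (param x) = x
  range_mfderiv : ∀ x ∈ ball 0 radius, LinearMap.range
    (mfderiv 𝓘(ℝ, EuclideanSpace ℝ (Fin k)) I param x).toLinearMap = D (param x)
  sameOrbit : ∀ x ∈ ball 0 radius, SameOrbit V w (param x)
  eventually_mem : ∀ (j : ℕ) (g : EuclideanSpace ℝ (Fin j) → X) (y : EuclideanSpace ℝ (Fin j)),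
    (∀ᶠ y' in 𝓝 y, ContMDiffAt 𝓘(ℝ, EuclideanSpace ℝ (Fin j)) I 1 g y' ∧ g y' ∈ M ∧
      finrank ℝ (D (g y')) = k ∧ LinearMap.range
        (mfderiv 𝓘(ℝ, EuclideanSpace ℝ (Fin j)) I g y').toLinearMap ≤ D (g y')) →
    (∃ x ∈ ball 0 radius, g y = param x) →
    ∀ᶠ y' in 𝓝 y, coord (g y') ∈ ball 0 radius ∧ g y' = param (coord (g y'))
  eventually_mem_flow : ∀ (i : ι) (γ : ℝ → X) (a b t : ℝ), t ∈ Ioo a b →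
    IsMIntegralCurveOn γ (V i) (Ioo a b) → γ t = w →
    ∀ᶠ s in 𝓝 t, coord (γ s) ∈ ball 0 radius ∧ γ s = param (coord (γ s))

/-- A choice of plaques through all points of a closed set. -/
structure PlaqueFamily where
  isClosed : IsClosed M
  /-- the plaques -/
  plaque : ∀ (k : ℕ) (w : X), w ∈ M → finrank ℝ (D w) = k → Plaque I D M V k w

variable {I D M V}

namespace Plaque

variable {k : ℕ} {w : X} (p : Plaque I D M V k w)

theorem contMDiffAt_param {x : EuclideanSpace ℝ (Fin k)} (hx : x ∈ ball 0 p.radius) :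
    ContMDiffAt 𝓘(ℝ, EuclideanSpace ℝ (Fin k)) I ∞ p.param x :=
  p.param_smooth.contMDiffAt (isOpen_ball.mem_nhds hx)

theorem contMDiffAt_coord {z : X} (hz : z ∈ p.nbhd) :
    ContMDiffAt I 𝓘(ℝ, EuclideanSpace ℝ (Fin k)) ∞ p.coord z :=
  p.coord_smooth.contMDiffAt (p.isOpen_nbhd.mem_nhds hz)

theorem zero_mem : (0 : EuclideanSpace ℝ (Fin k)) ∈ ball 0 p.radius := mem_ball_self p.radius_pos

theorem mem_nbhd : w ∈ p.nbhd := by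
  simpa only [p.param_zero] using p.param_mem_nbhd 0 p.zero_mem

theorem coord_self : p.coord w = 0 := by
  simpa only [p.param_zero] using p.coord_param 0 p.zero_mem

theorem mfderiv_injective {x : EuclideanSpace ℝ (Fin k)} (hx : x ∈ ball 0 p.radius) :
    Function.Injective (mfderiv 𝓘(ℝ, EuclideanSpace ℝ (Fin k)) I p.param x) := by
  have h1 := (p.contMDiffAt_param hx).mdifferentiableAt (by simp)
  have h2 := (p.contMDiffAt_coord (p.param_mem_nbhd x hx)).mdifferentiableAt (by simp)
  have h3 := h2.hasMFDerivAt.comp x h1.hasMFDerivAt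
  have h4 : p.coord ∘ p.param =ᶠ[𝓝 x] id := by
    filter_upwards [isOpen_ball.mem_nhds hx] with y hy using p.coord_param y hy
  have h5 := hasMFDerivAt_unique h3 ((hasMFDerivAt_id x).congr_of_eventuallyEq h4)
  exact Function.LeftInverse.injective (g := mfderiv I 𝓘(ℝ, EuclideanSpace ℝ (Fin k)) p.coord
    (p.param x)) fun v => congrArg (fun L => L v) h5

theorem finrank_param {x : EuclideanSpace ℝ (Fin k)} (hx : x ∈ ball 0 p.radius) :
    finrank ℝ (D (p.param x)) = k := by
  rw [← p.range_mfderiv x hx]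
  refine (LinearMap.finrank_range_of_inj (p.mfderiv_injective hx)).trans ?_
  exact finrank_euclideanSpace_fin

theorem tendsto_coord_flow (i : ι) (γ : ℝ → X) (a b t : ℝ) (ht : t ∈ Ioo a b)
    (hγ : IsMIntegralCurveOn γ (V i) (Ioo a b)) (hw : γ t = w) :
    Filter.Tendsto (fun s => p.coord (γ s)) (𝓝 t) (𝓝 0) := by
  have h1 : ContinuousAt γ t := (hγ.continuousOn).continuousAt (isOpen_Ioo.mem_nhds ht)
  have h2 : ContinuousAt p.coord (γ t) := by
    rw [hw]; exact (p.contMDiffAt_coord p.mem_nbhd).continuousAt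
  have h3 := h2.comp h1
  rw [ContinuousAt, Function.comp_apply, hw, p.coord_self] at h3
  exact h3

end Plaque

namespace PlaqueFamily

/-- A flow curve at a point of `M` stays for a short time in the plaque there, which lies in `M` and
has constant rank. At a point outside `M`, closedness keeps the curve outside for a short time, so
no curve can enter or leave `M`. -/
theorem mem_and_finrank_of_sameOrbit (Q : PlaqueFamily I D M V) {m z : X} (h : SameOrbit V m z) (hm : m ∈ M) :
    z ∈ M ∧ finrank ℝ (D z) = finrank ℝ (D m) := by
  refine SameOrbit.induction (p := fun z => z ∈ M ∧ finrank ℝ (D z) = finrank ℝ (D m))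
    (fun i γ a b t ht hγ _ => ?_) h ⟨hm, rfl⟩
  by_cases hw : γ t ∈ M
  · filter_upwards [(Q.plaque _ (γ t) hw rfl).eventually_mem_flow i γ a b t ht hγ rfl] with s hs
    have h1 : γ s ∈ M := by
      rw [hs.2]; exact Plaque.param_mem _ _ hs.1
    have h2 : finrank ℝ (D (γ s)) = finrank ℝ (D (γ t)) := by
      rw [hs.2]; exact Plaque.finrank_param _ hs.1
    rw [h2]
    exact ⟨fun h => ⟨h1, h.2⟩, fun h => ⟨hw, h.2⟩⟩
  · have h1 : ContinuousAt γ t := (hγ.continuousOn).continuousAt (isOpen_Ioo.mem_nhds ht)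
    filter_upwards [h1.eventually_mem (Q.isClosed.isOpen_compl.mem_nhds hw)] with s hs
    exact ⟨fun h => absurd h.1 hw, fun h => absurd h.1 hs⟩

/-- The underlying set of the leaf through `m`: the orbit of `m`. -/
structure Leaf (Q : PlaqueFamily I D M V) (m : M) : Type u where
  /-- the inclusion of the leaf -/
  incl : X
  sameOrbit : SameOrbit V m.1 incl

variable {Q : PlaqueFamily I D M V} {m : M}

/-- The dimension of a leaf. -/
noncomputable def leafDim (_ : PlaqueFamily I D M V) (m : M) : ℕ := finrank ℝ (D m.1)

namespace Leaf

theorem incl_injective : Function.Injective (Leaf.incl : Q.Leaf m → X) := by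
  rintro ⟨z, hz⟩ ⟨z', hz'⟩ h
  cases h
  rfl

theorem incl_mem (z : Q.Leaf m) : z.incl ∈ M :=
  (Q.mem_and_finrank_of_sameOrbit z.sameOrbit m.2).1

theorem finrank_incl (z : Q.Leaf m) : finrank ℝ (D z.incl) = Q.leafDim m :=
  (Q.mem_and_finrank_of_sameOrbit z.sameOrbit m.2).2

theorem range_incl : range (Leaf.incl : Q.Leaf m → X) = {z | SameOrbit V m.1 z} :=
  Subset.antisymm (by rintro _ ⟨z, rfl⟩; exact z.sameOrbit) fun z hz => ⟨⟨z, hz⟩, rfl⟩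

/-- The plaque through a point of a leaf. -/
noncomputable def plaque (z : Q.Leaf m) : Plaque I D M V (Q.leafDim m) z.incl :=
  Q.plaque _ z.incl z.incl_mem z.finrank_incl

/-- The points of the plaque through `z`, as points of the leaf. -/
theorem sameOrbit_param (z : Q.Leaf m) {x : EuclideanSpace ℝ (Fin (Q.leafDim m))}
    (hx : x ∈ ball 0 z.plaque.radius) : SameOrbit V m.1 (z.plaque.param x) :=
  z.sameOrbit.trans (z.plaque.sameOrbit x hx)

/-- The leaf topology: a set is open if it contains a neighbourhood of each of its points `z` in
the plaque through `z`. -/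
instance : TopologicalSpace (Q.Leaf m) where
  IsOpen U := ∀ z ∈ U, ∀ᶠ x in 𝓝 0, z.plaque.param x ∈ Leaf.incl '' U
  isOpen_univ z _ := by
    filter_upwards [ball_mem_nhds 0 z.plaque.radius_pos] with x hx
    exact ⟨⟨_, z.sameOrbit_param hx⟩, mem_univ _, rfl⟩
  isOpen_inter U U' hU hU' z hz := by
    filter_upwards [hU z hz.1, hU' z hz.2] with x hx hx'
    rw [image_inter incl_injective]
    exact ⟨hx, hx'⟩
  isOpen_sUnion 𝒰 h𝒰 z hz := by
    obtain ⟨U, hU, hzU⟩ := hz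
    filter_upwards [h𝒰 U hU z hzU] with x hx
    exact image_mono (subset_sUnion_of_mem hU) hx

theorem isOpen_iff {U : Set (Q.Leaf m)} :
    IsOpen U ↔ ∀ z ∈ U, ∀ᶠ x in 𝓝 0, z.plaque.param x ∈ Leaf.incl '' U := Iff.rfl

theorem continuous_incl : Continuous (Leaf.incl : Q.Leaf m → X) := by
  refine ⟨fun U hU => isOpen_iff.2 fun z hz => ?_⟩
  have h1 : ContinuousAt z.plaque.param 0 :=
    (z.plaque.contMDiffAt_param z.plaque.zero_mem).continuousAt
  have h2 : U ∈ 𝓝 (z.plaque.param 0) := by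
    rw [z.plaque.param_zero]; exact hU.mem_nhds hz
  filter_upwards [h1.eventually_mem h2, ball_mem_nhds 0 z.plaque.radius_pos] with x hx hx'
  exact ⟨⟨_, z.sameOrbit_param hx'⟩, hx, rfl⟩

theorem eventually_conditions (z : Q.Leaf m) {x : EuclideanSpace ℝ (Fin (Q.leafDim m))}
    (hx : x ∈ ball 0 z.plaque.radius) :
    ∀ᶠ y in 𝓝 x, ContMDiffAt 𝓘(ℝ, EuclideanSpace ℝ (Fin (Q.leafDim m))) I 1 z.plaque.param y ∧
      z.plaque.param y ∈ M ∧ finrank ℝ (D (z.plaque.param y)) = Q.leafDim m ∧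
      LinearMap.range (mfderiv 𝓘(ℝ, EuclideanSpace ℝ (Fin (Q.leafDim m))) I
        z.plaque.param y).toLinearMap ≤ D (z.plaque.param y) := by
  filter_upwards [isOpen_ball.mem_nhds hx] with y hy
  exact ⟨(z.plaque.contMDiffAt_param hy).of_le (by exact_mod_cast le_top), z.plaque.param_mem y hy,
    z.plaque.finrank_param hy, (z.plaque.range_mfderiv y hy).le⟩

/-- The leaf topology tests openness only at the centres of plaques. At another point of a plaque
the test concerns the plaque centred there, and by absorption that one contains the nearby points of
the first. -/
theorem eventually_param_mem (z : Q.Leaf m) {x : EuclideanSpace ℝ (Fin (Q.leafDim m))}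
    (hx : x ∈ ball 0 z.plaque.radius) {U : Set (Q.Leaf m)} (hU : IsOpen U)
    (hxU : (⟨_, z.sameOrbit_param hx⟩ : Q.Leaf m) ∈ U) :
    ∀ᶠ y in 𝓝 x, z.plaque.param y ∈ Leaf.incl '' U := by
  set w : Q.Leaf m := ⟨_, z.sameOrbit_param hx⟩
  have h1 := w.plaque.eventually_mem _ z.plaque.param x (z.eventually_conditions hx)
    ⟨0, w.plaque.zero_mem, w.plaque.param_zero.symm⟩
  have h2 : Filter.Tendsto (fun y => w.plaque.coord (z.plaque.param y)) (𝓝 x) (𝓝 0) := by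
    have h3 : ContinuousAt w.plaque.coord (z.plaque.param x) :=
      (w.plaque.contMDiffAt_coord w.plaque.mem_nbhd).continuousAt
    have h4 := h3.comp (z.plaque.contMDiffAt_param hx).continuousAt
    rw [ContinuousAt, Function.comp_apply,
      show w.plaque.coord (z.plaque.param x) = 0 from w.plaque.coord_self] at h4
    exact h4
  filter_upwards [h1, h2.eventually (isOpen_iff.1 hU w hxU)] with y hy hy'
  rw [hy.2]
  exact hy'

open Classical in
/-- The parametrization of the plaque through `z`, as a map to the leaf. -/
noncomputable def point (z : Q.Leaf m) (x : EuclideanSpace ℝ (Fin (Q.leafDim m))) : Q.Leaf m :=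
  if hx : x ∈ ball 0 z.plaque.radius then ⟨_, z.sameOrbit_param hx⟩ else z

theorem incl_point (z : Q.Leaf m) {x : EuclideanSpace ℝ (Fin (Q.leafDim m))}
    (hx : x ∈ ball 0 z.plaque.radius) : (z.point x).incl = z.plaque.param x := by
  rw [point, dif_pos hx]

/-- The chart of the leaf given by the plaque through `z`. -/
noncomputable def chart (z : Q.Leaf m) :
    OpenPartialHomeomorph (Q.Leaf m) (EuclideanSpace ℝ (Fin (Q.leafDim m))) where
  toFun y := z.plaque.coord y.incl
  invFun := z.point
  source := {y | z.plaque.coord y.incl ∈ ball 0 z.plaque.radius ∧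
    y.incl = z.plaque.param (z.plaque.coord y.incl)}
  target := ball 0 z.plaque.radius
  map_source' y hy := hy.1
  map_target' x hx := by
    rw [mem_ofPred_eq, z.incl_point hx, z.plaque.coord_param x hx]
    exact ⟨hx, rfl⟩
  left_inv' y hy := incl_injective ((z.incl_point hy.1).trans hy.2.symm)
  right_inv' x hx := by
    rw [z.incl_point hx]
    exact z.plaque.coord_param x hx
  -- By absorption, the plaque centred at a point `y` of the plaque through `z` lies in the latter
  -- near `y`.
  open_source := by
    refine isOpen_iff.2 fun y hy => ?_
    have h1 := z.plaque.eventually_mem _ y.plaque.param 0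
      (y.eventually_conditions y.plaque.zero_mem)
      ⟨_, hy.1, y.plaque.param_zero.trans hy.2⟩
    filter_upwards [h1, ball_mem_nhds 0 y.plaque.radius_pos] with x hx hx'
    exact ⟨⟨_, y.sameOrbit_param hx'⟩, hx, rfl⟩
  open_target := isOpen_ball
  continuousOn_toFun := by
    refine ContinuousOn.comp (t := z.plaque.nbhd) z.plaque.coord_smooth.continuousOn
      continuous_incl.continuousOn fun y hy => ?_
    rw [hy.2]
    exact z.plaque.param_mem_nbhd _ hy.1
  continuousOn_invFun := by
    intro x hx
    refine ContinuousAt.continuousWithinAt fun U hU => ?_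
    obtain ⟨U', hU'U, hU', hxU'⟩ := mem_nhds_iff.1 hU
    have hxp : (⟨_, z.sameOrbit_param hx⟩ : Q.Leaf m) = z.point x :=
      incl_injective (z.incl_point hx).symm
    change ∀ᶠ y in 𝓝 x, z.point y ∈ U
    filter_upwards [z.eventually_param_mem hx hU' (by rw [hxp]; exact hxU'),
      isOpen_ball.mem_nhds hx] with y hy hy'
    obtain ⟨y', hy'U, hyy'⟩ := hy
    rw [← z.incl_point hy'] at hyy'
    rw [← incl_injective hyy']
    exact hU'U hy'U

theorem incl_chart_symm (z : Q.Leaf m) {x : EuclideanSpace ℝ (Fin (Q.leafDim m))}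
    (hx : x ∈ ball 0 z.plaque.radius) : (z.chart.symm x).incl = z.plaque.param x :=
  z.incl_point hx

theorem incl_eq_param (z : Q.Leaf m) {y : Q.Leaf m} (hy : y ∈ z.chart.source) :
    y.incl = z.plaque.param (z.chart y) := hy.2

theorem mem_chart_source (z : Q.Leaf m) : z ∈ z.chart.source := by
  change z.plaque.coord z.incl ∈ _ ∧ z.incl = z.plaque.param (z.plaque.coord z.incl)
  rw [z.plaque.coord_self, z.plaque.param_zero]
  exact ⟨z.plaque.zero_mem, rfl⟩

noncomputable instance : ChartedSpace (EuclideanSpace ℝ (Fin (Q.leafDim m))) (Q.Leaf m) where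
  atlas := range chart
  chartAt := chart
  mem_chart_source := mem_chart_source
  chart_mem_atlas z := mem_range_self z

/-- A transition map is the coordinate of one plaque after the parametrization of another. Both are
smooth with respect to the ambient manifold. -/
instance : IsManifold 𝓘(ℝ, EuclideanSpace ℝ (Fin (Q.leafDim m))) ∞ (Q.Leaf m) := by
  refine isManifold_of_contDiffOn _ _ _ ?_
  rintro _ _ ⟨z, rfl⟩ ⟨z', rfl⟩
  simp only [modelWithCornersSelf_coe, modelWithCornersSelf_coe_symm, Function.comp_id,
    Function.id_comp, range_id, inter_univ, preimage_id]
  intro x hx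
  rw [OpenPartialHomeomorph.trans_source] at hx
  have hx1 : x ∈ ball 0 z.plaque.radius := hx.1
  have hx2 : z.chart.symm x ∈ z'.chart.source := hx.2
  have hmem : z.plaque.param x ∈ z'.plaque.nbhd := by
    rw [← z.incl_chart_symm hx1, z'.incl_eq_param hx2]
    exact z'.plaque.param_mem_nbhd _ (z'.chart.map_source hx2)
  have h1 := (z'.plaque.contMDiffAt_coord hmem).comp x (z.plaque.contMDiffAt_param hx1)
  refine (contMDiffAt_iff_contDiffAt.1 h1).contDiffWithinAt.congr_of_eventuallyEq ?_ ?_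
  · refine Filter.EventuallyEq.filter_mono ?_ nhdsWithin_le_nhds
    filter_upwards [isOpen_ball.mem_nhds hx1] with y hy
    exact congrArg z'.plaque.coord (z.incl_chart_symm hy)
  · exact congrArg z'.plaque.coord (z.incl_chart_symm hx1)

theorem contMDiff_incl : ContMDiff 𝓘(ℝ, EuclideanSpace ℝ (Fin (Q.leafDim m))) I ∞
    (Leaf.incl : Q.Leaf m → X) := by
  intro z
  have h1 : ContMDiffAt 𝓘(ℝ, EuclideanSpace ℝ (Fin (Q.leafDim m)))
      𝓘(ℝ, EuclideanSpace ℝ (Fin (Q.leafDim m))) ∞ z.chart z :=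
    contMDiffOn_chart.contMDiffAt (z.chart.open_source.mem_nhds z.mem_chart_source)
  have h2 := (z.plaque.contMDiffAt_param (z.chart.map_source z.mem_chart_source)).comp z h1
  refine h2.congr_of_eventuallyEq ?_
  filter_upwards [z.chart.open_source.mem_nhds z.mem_chart_source] with y hy
    using z.incl_eq_param hy

theorem mfderiv_incl (z : Q.Leaf m) :
    mfderiv 𝓘(ℝ, EuclideanSpace ℝ (Fin (Q.leafDim m))) I (Leaf.incl : Q.Leaf m → X) z =
      (mfderiv 𝓘(ℝ, EuclideanSpace ℝ (Fin (Q.leafDim m))) I z.plaque.param (z.chart z)).comp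
        (mfderiv 𝓘(ℝ, EuclideanSpace ℝ (Fin (Q.leafDim m)))
          𝓘(ℝ, EuclideanSpace ℝ (Fin (Q.leafDim m))) z.chart z) := by
  have h0 : (Leaf.incl : Q.Leaf m → X) =ᶠ[𝓝 z] z.plaque.param ∘ z.chart := by
    filter_upwards [z.chart.open_source.mem_nhds z.mem_chart_source] with y hy
      using z.incl_eq_param hy
  rw [h0.mfderiv_eq]
  refine mfderiv_comp_of_eq ?_ ?_ rfl
  · exact (z.plaque.contMDiffAt_param (z.chart.map_source z.mem_chart_source)).mdifferentiableAt
      (by simp)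
  · have h1 : ContMDiffAt 𝓘(ℝ, EuclideanSpace ℝ (Fin (Q.leafDim m)))
        𝓘(ℝ, EuclideanSpace ℝ (Fin (Q.leafDim m))) ∞ z.chart z :=
      contMDiffOn_chart.contMDiffAt (z.chart.open_source.mem_nhds z.mem_chart_source)
    exact h1.mdifferentiableAt (by simp)

theorem mfderiv_chart_bijective (z : Q.Leaf m) :
    Function.Bijective (mfderiv 𝓘(ℝ, EuclideanSpace ℝ (Fin (Q.leafDim m)))
          𝓘(ℝ, EuclideanSpace ℝ (Fin (Q.leafDim m))) z.chart z) := by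
  have : IsManifold 𝓘(ℝ, EuclideanSpace ℝ (Fin (Q.leafDim m))) 1 (Q.Leaf m) :=
    .of_le (n := ∞) (by exact_mod_cast le_top)
  exact (mdifferentiable_chart (I := 𝓘(ℝ, EuclideanSpace ℝ (Fin (Q.leafDim m))))
    z).mfderiv_bijective z.mem_chart_source

/-- Flow curves run inside plaques for short times, so they are continuous for the leaf topology.
Membership in a clopen set is therefore constant along them and spreads from `m` over its whole
orbit. -/
instance : ConnectedSpace (Q.Leaf m) where
  toNonempty := ⟨⟨m.1, .refl⟩⟩
  toPreconnectedSpace := by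
    have key : ∀ U : Set (Q.Leaf m), IsClopen U → ⟨m.1, .refl⟩ ∈ U → U = univ := by
      intro U hU hm
      refine eq_univ_of_forall fun z => ?_
      suffices h : SameOrbit V m.1 z.incl ∧ z.incl ∈ Leaf.incl '' U by
        obtain ⟨-, z', hz', h⟩ := h
        rwa [← incl_injective h]
      refine SameOrbit.induction (p := fun z => SameOrbit V m.1 z ∧ z ∈
        (Leaf.incl : Q.Leaf m → X) '' U) (fun i γ a b t ht hγ horb => ?_) z.sameOrbit
        ⟨.refl, _, hm, rfl⟩
      by_cases hw : SameOrbit V m.1 (γ t)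
      · let w : Q.Leaf m := ⟨γ t, hw⟩
        have h1 := w.plaque.eventually_mem_flow i γ a b t ht hγ rfl
        have h2 := w.plaque.tendsto_coord_flow i γ a b t ht hγ rfl
        by_cases hwU : w ∈ U
        · filter_upwards [h1, h2.eventually (isOpen_iff.1 hU.isOpen w hwU),
            isOpen_Ioo.mem_nhds ht] with s hs hs' hsI
          rw [← hs.2] at hs'
          exact ⟨fun _ => ⟨hw.trans (horb s hsI), hs'⟩, fun _ => ⟨hw, w, hwU, rfl⟩⟩
        · filter_upwards [h1, h2.eventually (isOpen_iff.1 hU.compl.isOpen w hwU)] with s hs hs'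
          rw [← hs.2] at hs'
          refine ⟨fun h => ?_, fun h => ?_⟩
          · obtain ⟨-, w', hw', hww'⟩ := h
            have : w' = w := incl_injective hww'
            exact absurd (this ▸ hw') hwU
          · obtain ⟨-, w', hw', hww'⟩ := h
            obtain ⟨w'', hw'', hww''⟩ := hs'
            have : w' = w'' := incl_injective (hww'.trans hww''.symm)
            exact absurd (this ▸ hw') hw''
      · filter_upwards [isOpen_Ioo.mem_nhds ht] with s hs
        exact ⟨fun h => absurd h.1 hw, fun h => absurd (h.1.trans (horb s hs).symm) hw⟩
    refine preconnectedSpace_iff_clopen.2 fun U hU => ?_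
    by_cases hm : (⟨m.1, .refl⟩ : Q.Leaf m) ∈ U
    · exact .inr (key U hU hm)
    · exact .inl (compl_univ_iff.1 (key Uᶜ hU.compl hm))

end Leaf

variable (Q m)

/-- The leaf through `m`, as an immersed submanifold. -/
noncomputable def leaf : ImmersedSubmanifold I X where
  Carrier := Q.Leaf m
  dim := Q.leafDim m
  incl := Leaf.incl
  incl_injective := Leaf.incl_injective
  incl_smooth := Leaf.contMDiff_incl
  incl_immersion z := by
    rw [Leaf.mfderiv_incl]
    exact (z.plaque.mfderiv_injective (z.chart.map_source z.mem_chart_source)).comp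
      z.mfderiv_chart_bijective.1

theorem image_leaf : (Q.leaf m).image = {z | SameOrbit V m.1 z} :=
  Leaf.range_incl (Q := Q)

theorem tangent_leaf (z : (Q.leaf m).Carrier) :
    (Q.leaf m).tangent z = D ((Q.leaf m).incl z) := by
  change Q.Leaf m at z
  have h1 : (Q.leaf m).tangent z = LinearMap.range
      (mfderiv 𝓘(ℝ, EuclideanSpace ℝ (Fin (Q.leafDim m))) I
        (Leaf.incl : Q.Leaf m → X) z).toLinearMap := rfl
  have h2 := z.plaque.range_mfderiv (z.chart z) (z.chart.map_source z.mem_chart_source)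
  have h3 : z.plaque.param (z.chart z) = z.incl := (z.incl_eq_param z.mem_chart_source).symm
  rw [h1]
  change _ = D z.incl
  ext v
  rw [← h3, ← h2]
  constructor
  · rintro ⟨x, rfl⟩
    exact ⟨mfderiv 𝓘(ℝ, EuclideanSpace ℝ (Fin (Q.leafDim m)))
          𝓘(ℝ, EuclideanSpace ℝ (Fin (Q.leafDim m))) z.chart z x,
      (congrArg (fun L => L x) z.mfderiv_incl).symm⟩
  · rintro ⟨x, rfl⟩
    obtain ⟨y, rfl⟩ := z.mfderiv_chart_bijective.2 x
    exact ⟨y, congrArg (fun L => L y) z.mfderiv_incl⟩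

theorem isIntegralManifold_leaf : IsIntegralManifold D M (Q.leaf m) := by
  refine ⟨inferInstanceAs (ConnectedSpace (Q.Leaf m)), ?_, Q.tangent_leaf m⟩
  rintro _ ⟨z, rfl⟩
  exact Leaf.incl_mem (Q := Q) z

end PlaqueFamily

end Leaves

/-! ### Orbits are the maximal connected integral manifolds -/

section Leaves

variable {E H : Type*} [NormedAddCommGroup E] [NormedSpace ℝ E] [TopologicalSpace H]
  {I : ModelWithCorners ℝ E H} {X : Type u} [TopologicalSpace X] [ChartedSpace H X]
  {D D' : Distribution I X} {M : Set X} {ι : Type*} {V : ι → ∀ x : X, TangentSpace I x}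

namespace PlaqueFamily

variable (Q : PlaqueFamily I D M V)

/-- The dimension of `N` equals the rank of `D` along it. In a chart of `N` the immersion thus meets
the conditions for absorption by the plaque through `N.incl n`, all of whose points are reached from
there by flows. -/
theorem eventually_sameOrbit_incl (Q : PlaqueFamily I D M V) {N : ImmersedSubmanifold I X}
    (hN : IsIntegralManifold D M N) (n : N.Carrier) :
    ∀ᶠ n' in 𝓝 n, SameOrbit V (N.incl n) (N.incl n') := by
  have hmem : ∀ n, N.incl n ∈ M := fun n => hN.2.1 (mem_range_self n)
  have hrank : ∀ n, finrank ℝ (D (N.incl n)) = N.dim := by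
    intro n
    rw [← hN.2.2 n]
    refine (LinearMap.finrank_range_of_inj (N.incl_immersion n)).trans ?_
    exact finrank_euclideanSpace_fin
  let φ := chartAt (EuclideanSpace ℝ (Fin N.dim)) n
  have hφ : ∀ y ∈ φ.target, ContMDiffAt 𝓘(ℝ, EuclideanSpace ℝ (Fin N.dim))
      𝓘(ℝ, EuclideanSpace ℝ (Fin N.dim)) ∞ φ.symm y := fun y hy =>
    contMDiffOn_chart_symm.contMDiffAt (φ.open_target.mem_nhds hy)
  have hn : n ∈ φ.source := mem_chart_source _ n
  let p := Q.plaque N.dim (N.incl n) (hmem n) (hrank n)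
  have hg := p.eventually_mem N.dim (N.incl ∘ φ.symm) (φ n) (by
    filter_upwards [φ.open_target.mem_nhds (φ.map_source hn)] with y hy
    have h1 := hφ y hy
    have h2 := (N.incl_smooth (φ.symm y)).comp y h1
    refine ⟨h2.of_le (by exact_mod_cast le_top), hmem _, hrank _, ?_⟩
    rw [mfderiv_comp y ((N.incl_smooth (φ.symm y)).mdifferentiableAt (by simp))
      (h1.mdifferentiableAt (by simp))]
    change _ ≤ D (N.incl (φ.symm y))
    rw [← hN.2.2 (φ.symm y)]
    rintro _ ⟨v, rfl⟩
    exact ⟨mfderiv 𝓘(ℝ, EuclideanSpace ℝ (Fin N.dim))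
      𝓘(ℝ, EuclideanSpace ℝ (Fin N.dim)) φ.symm y v, rfl⟩)
    ⟨0, p.zero_mem, by rw [p.param_zero, Function.comp_apply, φ.left_inv hn]⟩
  filter_upwards [(φ.continuousAt hn).eventually hg, φ.open_source.mem_nhds hn] with n' h hn'
  rw [Function.comp_apply, φ.left_inv hn'] at h
  rw [h.2]
  exact p.sameOrbit _ h.1

/-- A connected integral manifold lies in a single orbit. -/
theorem sameOrbit_of_isIntegralManifold (Q : PlaqueFamily I D M V) {N : ImmersedSubmanifold I X}
    (hN : IsIntegralManifold D M N) (n n' : N.Carrier) : SameOrbit V (N.incl n) (N.incl n') := by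
  have := hN.1
  refine isPreconnected_univ.induction₂' (fun n n' => SameOrbit V (N.incl n) (N.incl n'))
    (fun n _ => ?_) (fun _ _ _ _ _ _ h h' => h.trans h') (mem_univ n) (mem_univ n')
  rw [nhdsWithin_univ]
  filter_upwards [Q.eventually_sameOrbit_incl hN n] with n' h using ⟨h, h.symm⟩

/-- For maximality: a connected integral manifold that meets the orbit lies in a single orbit, hence
in this one. -/
theorem isLeaf_leaf (m : M) : IsLeaf D M (Q.leaf m) := by
  refine ⟨Q.isIntegralManifold_leaf m, fun N hN h => ?_⟩
  obtain ⟨_, ⟨n, rfl⟩, h⟩ := h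
  rw [Q.image_leaf] at h ⊢
  rintro _ ⟨n', rfl⟩
  exact SameOrbit.trans h (Q.sameOrbit_of_isIntegralManifold hN n n')

theorem mem_image_leaf (m : M) : m.1 ∈ (Q.leaf m).image := by
  rw [Q.image_leaf]
  exact .refl

theorem sameLeaf_iff (Q : PlaqueFamily I D M V) (m m' : M) :
    SameLeaf D M m m' ↔ SameOrbit V m.1 m'.1 := by
  constructor
  · rintro ⟨L, hL, ⟨n, hn⟩, ⟨n', hn'⟩⟩
    rw [← hn, ← hn']
    exact Q.sameOrbit_of_isIntegralManifold hL.1 n n'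
  · intro h
    refine ⟨Q.leaf m, Q.isLeaf_leaf m, Q.mem_image_leaf m, ?_⟩
    rw [Q.image_leaf]
    exact h

theorem equivalence_sameLeaf (Q : PlaqueFamily I D M V) : Equivalence (SameLeaf D M) := by
  refine ⟨fun m => ?_, fun h => ?_, fun h h' => ?_⟩
  · exact (Q.sameLeaf_iff m m).2 .refl
  · rw [Q.sameLeaf_iff] at h ⊢
    exact h.symm
  · rw [Q.sameLeaf_iff] at h h' ⊢
    exact h.trans h'

end PlaqueFamily

/-- This and its consequences allow the span of the `X̂_f` to be replaced by the null distribution,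
the two being compared only at points of `M`. -/
theorem isIntegralManifold_congr (h : ∀ z ∈ M, D z = D' z) (N : ImmersedSubmanifold I X) :
    IsIntegralManifold D M N ↔ IsIntegralManifold D' M N := by
  refine and_congr_right fun _ => and_congr_right fun hM => forall_congr' fun n => ?_
  rw [h _ (hM (mem_range_self n))]

theorem isLeaf_congr (h : ∀ z ∈ M, D z = D' z) (N : ImmersedSubmanifold I X) :
    IsLeaf D M N ↔ IsLeaf D' M N := by
  simp only [IsLeaf, isIntegralManifold_congr h]

theorem sameLeaf_congr (h : ∀ z ∈ M, D z = D' z) : SameLeaf D M = SameLeaf D' M := by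
  ext m m'
  simp only [SameLeaf, isLeaf_congr h]

theorem definesSingularFoliation_congr [IsManifold I 1 X] (h : ∀ z ∈ M, D z = D' z) :
    DefinesSingularFoliation D M ↔ DefinesSingularFoliation D' M := by
  simp only [DefinesSingularFoliation, isLeaf_congr h]
  refine and_congr_left fun _ => forall₂_congr fun m hm => ?_
  rw [h m hm]
  refine forall₂_congr fun v _ => exists_congr fun W => and_congr_right fun _ =>
    and_congr_right fun _ => forall₂_congr fun x hx => ?_
  rw [h x hx]

theorem exists_homeomorph_quot {Y : Type*} [TopologicalSpace Y] {r s : Y → Y → Prop} (h : r = s) :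
    ∃ Φ : Quot r ≃ₜ Quot s, ∀ y, Φ (Quot.mk _ y) = Quot.mk _ y := by
  subst h
  exact ⟨Homeomorph.refl _, fun _ => rfl⟩

end Leaves

/-! ### Local models of a distribution by involutive families in charts -/

section LocalModels

variable {E H : Type*} [NormedAddCommGroup E] [NormedSpace ℝ E] [TopologicalSpace H]
  (I : ModelWithCorners ℝ E H) {X : Type u} [TopologicalSpace X] [ChartedSpace H X]
  (D : Distribution I X) (M : Set X) {ι : Type*} (V : ι → ∀ x : X, TangentSpace I x)

/-- An involutive anchor that describes the distribution `D` along `M` and some of the fields of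
the family `V` in the chart around `w`. -/
structure LocalModel (F : Type*) [NormedAddCommGroup F] [NormedSpace ℝ F] (w : X) extends
    InvolutiveAnchor E F where
  domain_subset : domain ⊆ (extChartAt I w).target
  mem_domain : extChartAt I w w ∈ domain
  mem_locus_iff : ∀ y ∈ domain, y ∈ locus ↔ (extChartAt I w).symm y ∈ M
  mem_iff : ∀ z, extChartAt I w z ∈ domain → z ∈ (chartAt H w).source → z ∈ M →
    ∀ v : TangentSpace I z, v ∈ D z ↔
      mfderiv I 𝓘(ℝ, E) (extChartAt I w) z v ∈
        LinearMap.range (anchor (extChartAt I w z)).toLinearMap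
  /-- the fields of the family that are described by the model -/
  index : F → ι
  anchor_eq : ∀ z, extChartAt I w z ∈ domain → z ∈ (chartAt H w).source → ∀ b,
    mfderiv I 𝓘(ℝ, E) (extChartAt I w) z (V (index b) z) = anchor (extChartAt I w z) b

end LocalModels

/-! ### Tangent vectors and integral curves in charts -/

section Charts

variable {E H : Type*} [NormedAddCommGroup E] [NormedSpace ℝ E] [TopologicalSpace H]
  {I : ModelWithCorners ℝ E H} [I.Boundaryless] {X : Type u} [TopologicalSpace X]
  [ChartedSpace H X] [IsManifold I ∞ X]

theorem contMDiffAt_extChartAt_symm (w : X) {y : E} (hy : y ∈ (extChartAt I w).target) :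
    ContMDiffAt 𝓘(ℝ, E) I ∞ (extChartAt I w).symm y :=
  (contMDiffOn_extChartAt_symm w).contMDiffAt ((isOpen_extChartAt_target w).mem_nhds hy)

theorem mfderiv_extChartAt_symm_apply (w : X) {z : X} (hz : z ∈ (chartAt H w).source)
    (v : TangentSpace I z) :
    mfderiv 𝓘(ℝ, E) I (extChartAt I w).symm (extChartAt I w z)
      (mfderiv I 𝓘(ℝ, E) (extChartAt I w) z v) = v := by
  have hz' : z ∈ (extChartAt I w).source := by rwa [extChartAt_source]
  have h1 := (contMDiffAt_extChartAt_symm w ((extChartAt I w).map_source hz')).mdifferentiableAt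
    (by simp)
  have h2 : MDifferentiableAt I 𝓘(ℝ, E) (extChartAt I w) z := mdifferentiableAt_extChartAt hz
  have h3 := h1.hasMFDerivAt.comp z h2.hasMFDerivAt
  have h4 : (extChartAt I w).symm ∘ extChartAt I w =ᶠ[𝓝 z] id := by
    filter_upwards [(isOpen_extChartAt_source w).mem_nhds hz'] with z' hz'
      using (extChartAt I w).left_inv hz'
  have h5 := hasMFDerivAt_unique h3 ((hasMFDerivAt_id z).congr_of_eventuallyEq h4)
  exact congrArg (fun L => L v) h5

theorem mfderiv_extChartAt_injective (w : X) {z : X} (hz : z ∈ (chartAt H w).source) :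
    Function.Injective (mfderiv I 𝓘(ℝ, E) (extChartAt I w) z) := by
  intro v v' h
  rw [← mfderiv_extChartAt_symm_apply w hz v, h, mfderiv_extChartAt_symm_apply w hz v']

theorem mfderiv_extChartAt_surjective (w : X) {z : X} (hz : z ∈ (chartAt H w).source) :
    Function.Surjective (mfderiv I 𝓘(ℝ, E) (extChartAt I w) z) := by
  have h := isInvertible_mfderiv_extChartAt (I := I) (x := w) (y := z)
    (by rwa [extChartAt_source])
  obtain ⟨e, he⟩ := h
  intro v
  exact ⟨e.symm v, by rw [← he]; exact e.apply_symm_apply v⟩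

/-- An integral curve in a chart. -/
theorem hasDerivAt_extChartAt_comp (w : X) {γ : ℝ → X} {V : ∀ x : X, TangentSpace I x} {a b t : ℝ}
    (ht : t ∈ Ioo a b) (hγ : IsMIntegralCurveOn γ V (Ioo a b)) (hs : γ t ∈ (chartAt H w).source) :
    HasDerivAt (fun s => extChartAt I w (γ s))
      (mfderiv I 𝓘(ℝ, E) (extChartAt I w) (γ t) (V (γ t))) t := by
  have h1 := (hγ t ht).hasMFDerivAt (isOpen_Ioo.mem_nhds ht)
  have h2 : MDifferentiableAt I 𝓘(ℝ, E) (extChartAt I w) (γ t) := mdifferentiableAt_extChartAt hs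
  obtain ⟨L, hL, h3⟩ : ∃ L : ℝ →L[ℝ] E, L 1 = mfderiv I 𝓘(ℝ, E) (extChartAt I w) (γ t) (V (γ t)) ∧
      HasFDerivAt (fun s => extChartAt I w (γ s)) L t := by
    refine ⟨_, ?_, (h2.hasMFDerivAt.comp t h1).hasFDerivAt⟩
    change mfderiv I 𝓘(ℝ, E) (extChartAt I w) (γ t) ((1 : ℝ) • V (γ t)) = _
    rw [one_smul]
  exact h3.hasDerivAt.congr_deriv hL

/-- A curve in a chart that gives an integral curve. -/
theorem isMIntegralCurveOn_extChartAt_symm_comp (w : X) {c : ℝ → E} {V : ∀ x : X, TangentSpace I x}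
    {a b : ℝ} (hc : ∀ t ∈ Ioo a b, c t ∈ (extChartAt I w).target)
    (hc' : ∀ t ∈ Ioo a b, HasDerivAt c (mfderiv I 𝓘(ℝ, E) (extChartAt I w)
      ((extChartAt I w).symm (c t)) (V ((extChartAt I w).symm (c t)))) t) :
    IsMIntegralCurveOn (fun t => (extChartAt I w).symm (c t)) V (Ioo a b) := by
  intro t ht
  refine HasMFDerivAt.hasMFDerivWithinAt ?_
  have h1 := (contMDiffAt_extChartAt_symm w (hc t ht)).mdifferentiableAt (by simp)
  have h2 := h1.hasMFDerivAt.comp t (hc' t ht).hasFDerivAt.hasMFDerivAt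
  refine h2.congr_mfderiv ?_
  ext
  have hs : (extChartAt I w).symm (c t) ∈ (chartAt H w).source := by
    rw [← extChartAt_source (I := I)]
    exact (extChartAt I w).map_target (hc t ht)
  have h3 := mfderiv_extChartAt_symm_apply w hs (V ((extChartAt I w).symm (c t)))
  rw [(extChartAt I w).right_inv (hc t ht)] at h3
  change mfderiv 𝓘(ℝ, E) I (extChartAt I w).symm (c t) ((1 : ℝ) • _) = (1 : ℝ) • _
  exact (congrArg (mfderiv 𝓘(ℝ, E) I (extChartAt I w).symm (c t)) (one_smul ℝ _)).trans
    (h3.trans (one_smul ℝ _).symm)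

end Charts

/-! ### From local models to plaques on the manifold -/

section LocalModels

variable {E H : Type*} [NormedAddCommGroup E] [NormedSpace ℝ E] [FiniteDimensional ℝ E]
  [TopologicalSpace H]
  {I : ModelWithCorners ℝ E H} [I.Boundaryless] {X : Type u} [TopologicalSpace X]
  [ChartedSpace H X] [IsManifold I ∞ X]
  {D : Distribution I X} {M : Set X} {ι : Type*} {V : ι → ∀ x : X, TangentSpace I x}
  {F : Type*} [NormedAddCommGroup F] [NormedSpace ℝ F] [FiniteDimensional ℝ F]

theorem LocalModel.finrank_eq {w : X} (L : LocalModel I D M V F w) {z : X}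
    (hz : extChartAt I w z ∈ L.domain) (hs : z ∈ (chartAt H w).source) (hM : z ∈ M) :
    finrank ℝ (LinearMap.range (L.anchor (extChartAt I w z)).toLinearMap) =
      finrank ℝ (D z) := by
  have h1 : LinearMap.range (L.anchor (extChartAt I w z)).toLinearMap =
      (D z).map (mfderiv I 𝓘(ℝ, E) (extChartAt I w) z).toLinearMap := by
    ext v
    constructor
    · intro hv
      obtain ⟨u, rfl⟩ := mfderiv_extChartAt_surjective (I := I) w hs v
      exact ⟨u, (L.mem_iff z hz hs hM u).2 hv, rfl⟩
    · rintro ⟨u, hu, rfl⟩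
      exact (L.mem_iff z hz hs hM u).1 hu
  rw [h1]
  exact ((D z).equivMapOfInjective _ (mfderiv_extChartAt_injective (I := I) w hs)).finrank_eq.symm

/-- One model, chosen once, defines the plaque through the chart. It contains only some of the
fields, so a flow curve of field `i` is treated with a second model that contains `i`. The second
model shows that the curve stays in `M` with constant rank; the first then shows that it stays in
the plaque. -/
theorem Plaque.exists_of_localModel [Nonempty ι] {w : X} (hw : w ∈ M)
    (hL : ∀ i, ∃ (L : LocalModel I D M V F w) (b : F), L.index b = i) {k : ℕ}
    (hk : finrank ℝ (D w) = k) : Nonempty (Plaque I D M V k w) := by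
  set φ := extChartAt I w with hφ
  have hsrc : ∀ z, z ∈ φ.source ↔ z ∈ (chartAt H w).source := fun z => by
    rw [hφ, extChartAt_source]
  have hw_src : w ∈ φ.source := mem_extChartAt_source w
  have hex : ∀ L : LocalModel I D M V F w, _ := fun L =>
    L.toInvolutiveAnchor.exists_plaque (K := EuclideanSpace ℝ (Fin k)) L.mem_domain
      ((L.mem_locus_iff _ L.mem_domain).2 (by rw [φ.left_inv hw_src]; exact hw))
      (by rw [L.finrank_eq L.mem_domain ((hsrc w).1 hw_src) hw, hk, finrank_euclideanSpace_fin])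
  obtain ⟨L, -, -⟩ := hL (Classical.arbitrary ι)
  obtain ⟨V₀, pr, r, σ, hV₀, hwV₀, hV₀d, hr, hσ0, hσs, hσ, hcurve, -, hreach⟩ := hex L
  have hV₀t : V₀ ⊆ φ.target := hV₀d.trans L.domain_subset
  have hsymm_src : ∀ y ∈ φ.target, φ.symm y ∈ (chartAt H w).source := fun y hy =>
    (hsrc _).1 (φ.map_target hy)
  have hnbhd : IsOpen (φ.source ∩ φ ⁻¹' V₀) :=
    (continuousOn_extChartAt w).isOpen_inter_preimage (isOpen_extChartAt_source w) hV₀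
  have hpar : ∀ x ∈ ball 0 r, φ (φ.symm (σ x)) = σ x := fun x hx =>
    φ.right_inv (hV₀t (hσ x hx).1)
  have hcoord : ContMDiffOn I 𝓘(ℝ, EuclideanSpace ℝ (Fin k)) ∞ (fun z => pr (φ z) - pr (φ w))
      φ.source := by
    have h1 : ContDiff ℝ ∞ fun y : E => pr y - pr (φ w) := pr.contDiff.sub contDiff_const
    have h2 : ContMDiffOn I 𝓘(ℝ, E) ∞ φ φ.source := by
      intro z hz
      exact (contMDiffAt_extChartAt' ((hsrc z).1 hz)).contMDiffWithinAt
    exact h1.contMDiff.comp_contMDiffOn h2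
  have hcoordc : ∀ z ∈ φ.source, ContinuousAt (fun z => pr (φ z) - pr (φ w)) z := fun z hz =>
    (hcoord.contMDiffAt ((isOpen_extChartAt_source w).mem_nhds hz)).continuousAt
  have hparam : ∀ x ∈ ball 0 r, ContMDiffAt 𝓘(ℝ, EuclideanSpace ℝ (Fin k)) I ∞
      (fun x => φ.symm (σ x)) x := fun x hx =>
    (contMDiffAt_extChartAt_symm w (hV₀t (hσ x hx).1)).comp x
      (hσs.contDiffAt (isOpen_ball.mem_nhds hx)).contMDiffAt
  refine ⟨{
    nbhd := φ.source ∩ φ ⁻¹' V₀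
    isOpen_nbhd := hnbhd
    radius := r
    radius_pos := hr
    param := fun x => φ.symm (σ x)
    coord := fun z => pr (φ z) - pr (φ w)
    coord_smooth := hcoord.mono inter_subset_left
    param_smooth := fun x hx => (hparam x hx).contMDiffWithinAt
    param_zero := by rw [hσ0, φ.left_inv hw_src]
    param_mem_nbhd := fun x hx => ⟨φ.map_target (hV₀t (hσ x hx).1), by
      rw [mem_preimage, hpar x hx]; exact (hσ x hx).1⟩
    param_mem := fun x hx => (L.mem_locus_iff _ (hV₀d (hσ x hx).1)).1 (hσ x hx).2.1
    coord_param := fun x hx => by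
      rw [hpar x hx, (hσ x hx).2.2.1, add_sub_cancel_left]
    range_mfderiv := fun x hx => ?_
    sameOrbit := fun x hx => ?_
    eventually_mem := fun j g y hg hgy => ?_
    eventually_mem_flow := fun i γ a b t ht hγ hγw => ?_ }⟩
  · have hz := hsymm_src _ (hV₀t (hσ x hx).1)
    have hzM := (L.mem_locus_iff _ (hV₀d (hσ x hx).1)).1 (hσ x hx).2.1
    have h1 : MDifferentiableAt I 𝓘(ℝ, E) φ (φ.symm (σ x)) := mdifferentiableAt_extChartAt hz
    have h2 := h1.hasMFDerivAt.comp x ((hparam x hx).mdifferentiableAt (by simp)).hasMFDerivAt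
    have h3 : φ ∘ (fun x => φ.symm (σ x)) =ᶠ[𝓝 x] σ := by
      filter_upwards [isOpen_ball.mem_nhds hx] with x' hx' using hpar x' hx'
    have h4 := ((hσs.contDiffAt (isOpen_ball.mem_nhds hx)).differentiableAt (by simp)).hasFDerivAt
    have h5 := hasMFDerivAt_unique h2 (h4.hasMFDerivAt.congr_of_eventuallyEq h3)
    have h6 : ∀ v, mfderiv I 𝓘(ℝ, E) φ (φ.symm (σ x))
        (mfderiv 𝓘(ℝ, EuclideanSpace ℝ (Fin k)) I (fun x => φ.symm (σ x)) x v) =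
        fderiv ℝ σ x v := fun v => congrArg (fun L => L v) h5
    have h7 := L.mem_iff (φ.symm (σ x)) (by rw [hpar x hx]; exact hV₀d (hσ x hx).1) hz hzM
    rw [← hφ, hpar x hx, ← (hσ x hx).2.2.2] at h7
    ext v
    rw [h7]
    constructor
    · rintro ⟨u, rfl⟩
      exact ⟨u, (h6 u).symm⟩
    · rintro ⟨u, hu⟩
      exact ⟨u, mfderiv_extChartAt_injective (I := I) w hz ((h6 u).trans hu)⟩
  · obtain ⟨b, c, hc0, hc1, hc⟩ := hreach x hx
    refine .single ⟨L.index b, fun t => φ.symm (c t), -2, 2, 0, 1, by norm_num, by norm_num,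
      isMIntegralCurveOn_extChartAt_symm_comp w (fun t ht => hV₀t (hc t ht).1) fun t ht => ?_, ?_,
      ?_⟩
    · have hct := hV₀t (hc t ht).1
      have h1 := L.anchor_eq (φ.symm (c t)) (by rw [φ.right_inv hct]; exact hV₀d (hc t ht).1)
        (hsymm_src _ hct) b
      rw [← hφ, φ.right_inv hct] at h1
      exact (hc t ht).2.congr_deriv h1.symm
    · change φ.symm (c 0) = w
      rw [hc0, φ.left_inv hw_src]
    · change φ.symm (c 1) = _
      rw [hc1]
  · obtain ⟨x, hx, hgx⟩ := hgy
    have hgn : g y ∈ φ.source ∩ φ ⁻¹' V₀ := by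
      rw [hgx]
      exact ⟨φ.map_target (hV₀t (hσ x hx).1), by
        rw [mem_preimage, hpar x hx]; exact (hσ x hx).1⟩
    have hg1 := hg.self_of_nhds.1
    have hgc := hg1.continuousAt
    set f := fun y => φ (g y) with hf
    have hf1 : ContDiffAt ℝ 1 f y := by
      have h1 : ContMDiffAt I 𝓘(ℝ, E) 1 φ (g y) := contMDiffAt_extChartAt' ((hsrc _).1 hgn.1)
      exact (h1.comp y hg1).contDiffAt
    have hfb : ∀ᶠ y' in 𝓝 y, ‖fderiv ℝ f y'‖ < ‖fderiv ℝ f y‖ + 1 :=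
      ((hf1.fderiv_right (m := 0) (by simp)).continuousAt.norm).eventually_lt continuousAt_const
        (by simp)
    have hcb : ∀ᶠ y' in 𝓝 y, pr (f y') - pr (φ w) ∈ ball 0 r := by
      have h1 := (hcoordc _ hgn.1).comp hgc
      refine h1.eventually_mem (isOpen_ball.mem_nhds ?_)
      rw [Function.comp_apply, hgx, hpar x hx, (hσ x hx).2.2.1, add_sub_cancel_left]
      exact hx
    obtain ⟨ε, hε, hball⟩ := Metric.eventually_nhds_iff_ball.1
      ((hg.and (hgc.eventually_mem (hnbhd.mem_nhds hgn))).and (hfb.and hcb))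
    filter_upwards [ball_mem_nhds y hε] with y' hy'
    refine ⟨(hball y' hy').2.2, ?_⟩
    have hseg : ∀ t ∈ Icc (0 : ℝ) 1, y + t • (y' - y) ∈ ball y ε := fun t ht =>
      (convex_ball y ε).add_smul_sub_mem (mem_ball_self hε) hy' ht
    have hfd : ∀ z ∈ ball y ε, ∃ L : EuclideanSpace ℝ (Fin j) →L[ℝ] E,
        (∀ v, L v = mfderiv I 𝓘(ℝ, E) φ (g z)
          (mfderiv 𝓘(ℝ, EuclideanSpace ℝ (Fin j)) I g z v)) ∧ HasFDerivAt f L z := by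
      intro z hz
      obtain ⟨⟨h1, h2⟩, -⟩ := hball z hz
      have h3 : MDifferentiableAt I 𝓘(ℝ, E) φ (g z) :=
        mdifferentiableAt_extChartAt ((hsrc _).1 h2.1)
      exact ⟨_, fun v => rfl,
        (h3.hasMFDerivAt.comp z (h1.1.mdifferentiableAt (by simp)).hasMFDerivAt).hasFDerivAt⟩
    -- The segment from `y` to `y'` is mapped by `g` to a curve in `M` that is tangent to `D`, has
    -- rank `k` throughout and starts on the plaque.
    have key := hcurve (fun t => f (y + t • (y' - y)))
      (fun t => fderiv ℝ f (y + t • (y' - y)) (y' - y)) ((‖fderiv ℝ f y‖ + 1) * ‖y' - y‖)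
      (fun t ht => ?_) ?_ 1 (by norm_num)
    · rw [one_smul, add_sub_cancel] at key
      change g y' = φ.symm (σ (pr (f y') - pr (φ w)))
      rw [← key]
      exact (φ.left_inv (hball y' hy').1.2.1).symm
    · have hz := hseg t ht
      obtain ⟨⟨⟨h1, h2, h3, h4⟩, h5⟩, h6, h7⟩ := hball _ hz
      have h8 := (hsrc _).1 h5.1
      obtain ⟨L', hL', hf'⟩ := hfd _ hz
      refine ⟨h5.2, h7, ?_, ?_, ?_, ?_⟩
      · have h9 : HasDerivAt (fun t : ℝ => y + t • (y' - y)) (y' - y) t := by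
          simpa using ((hasDerivAt_id t).smul_const (y' - y)).const_add y
        exact (hf'.differentiableAt.hasFDerivAt.comp_hasDerivAt t h9).hasDerivWithinAt
      · exact (ContinuousLinearMap.le_opNorm _ _).trans (by gcongr)
      · rw [hf'.fderiv, hL']
        exact (L.mem_iff _ (hV₀d h5.2) h8 h2 _).1 (h4 ⟨y' - y, rfl⟩)
      · rw [finrank_euclideanSpace_fin]
        exact (L.finrank_eq (hV₀d h5.2) h8 h2).trans h3
    · simp only [zero_smul, add_zero]
      change φ (g y) = σ (pr (φ (g y)) - pr (φ w))
      rw [hgx, hpar x hx, (hσ x hx).2.2.1, add_sub_cancel_left]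
  · obtain ⟨L', b', hb'⟩ := hL i
    obtain ⟨V₁, -, -, -, hV₁, hwV₁, hV₁d, -, -, -, -, -, hflow, -⟩ := hex L'
    have hγc : ContinuousAt γ t := hγ.continuousOn.continuousAt (isOpen_Ioo.mem_nhds ht)
    have hnbhd' : IsOpen (φ.source ∩ φ ⁻¹' (V₀ ∩ V₁)) :=
      (continuousOn_extChartAt w).isOpen_inter_preimage (isOpen_extChartAt_source w)
        (hV₀.inter hV₁)
    have hγw' : γ t ∈ φ.source ∩ φ ⁻¹' (V₀ ∩ V₁) := by
      rw [hγw]; exact ⟨hw_src, hwV₀, hwV₁⟩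
    have hcb : ∀ᶠ s in 𝓝 t, pr (φ (γ s)) - pr (φ w) ∈ ball 0 r := by
      have h1 := (hcoordc _ hγw'.1).comp hγc
      refine h1.eventually_mem (isOpen_ball.mem_nhds ?_)
      rw [Function.comp_apply, hγw, sub_self]
      exact mem_ball_self hr
    obtain ⟨ε, hε, hball⟩ := Metric.eventually_nhds_iff_ball.1
      ((hγc.eventually_mem (hnbhd'.mem_nhds hγw')).and
        (hcb.and (isOpen_Ioo.eventually_mem ht)))
    filter_upwards [ball_mem_nhds t hε] with s hs
    refine ⟨(hball s hs).2.1, ?_⟩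
    have hseg : ∀ τ ∈ Icc (0 : ℝ) 1, t + τ * (s - t) ∈ ball t ε := fun τ hτ =>
      (convex_ball t ε).add_smul_sub_mem (mem_ball_self hε) hs hτ
    have hanchor : ∀ τ ∈ Icc (0 : ℝ) 1,
        mfderiv I 𝓘(ℝ, E) φ (γ (t + τ * (s - t))) (V i (γ (t + τ * (s - t)))) =
          L'.anchor (φ (γ (t + τ * (s - t)))) b' := by
      intro τ hτ
      have h1 := (hball _ (hseg τ hτ)).1
      rw [← hb']
      exact L'.anchor_eq _ (hV₁d h1.2.2) ((hsrc _).1 h1.1) b'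
    have hder : ∀ τ ∈ Icc (0 : ℝ) 1, HasDerivAt (fun τ => φ (γ (t + τ * (s - t))))
        (L'.anchor (φ (γ (t + τ * (s - t)))) ((s - t) • b')) τ := by
      intro τ hτ
      obtain ⟨h1, -, h2⟩ := hball _ (hseg τ hτ)
      have h3 := hasDerivAt_extChartAt_comp w h2 hγ ((hsrc _).1 h1.1)
      rw [hanchor τ hτ] at h3
      have h4 : HasDerivAt (fun τ : ℝ => t + τ * (s - t)) (s - t) τ := by
        simpa using ((hasDerivAt_id τ).mul_const (s - t)).const_add t
      rw [map_smul]
      exact h3.scomp τ h4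
    have hstay := hflow (fun τ => φ (γ (t + τ * (s - t)))) (fun _ => (s - t) • b')
      continuousOn_const (by simp only [zero_mul, add_zero]; rw [hγw])
      fun τ hτ => ⟨(hball _ (hseg τ hτ)).1.2.2, (hder τ hτ).hasDerivWithinAt⟩
    have hcc : ContinuousOn (fun τ => φ (γ (t + τ * (s - t)))) (Icc 0 1) := fun τ hτ =>
      (hder τ hτ).continuousAt.continuousWithinAt
    have hbd : ContinuousOn
        (fun τ => ‖L'.anchor (φ (γ (t + τ * (s - t)))) ((s - t) • b')‖) (Icc 0 1) :=
      ((L'.smooth.continuousOn.comp hcc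
        fun τ hτ => hV₁d (hball _ (hseg τ hτ)).1.2.2).clm_apply continuousOn_const).norm
    obtain ⟨B, hB⟩ := isCompact_Icc.bddAbove_image hbd
    have key := hcurve (fun τ => φ (γ (t + τ * (s - t))))
      (fun τ => L'.anchor (φ (γ (t + τ * (s - t)))) ((s - t) • b')) B
      (fun τ hτ => ?_) ?_ 1 (by norm_num)
    · simp only [one_mul, add_sub_cancel] at key
      rw [← key]
      exact (φ.left_inv (hball s hs).1.1).symm
    · obtain ⟨h1, h2, h3⟩ := hball _ (hseg τ hτ)
      have h4 := (hsrc _).1 h1.1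
      have h5 : γ (t + τ * (s - t)) ∈ M := by
        have := (L'.mem_locus_iff _ (hV₁d h1.2.2)).1 (hstay τ hτ).1
        rwa [← hφ, φ.left_inv h1.1] at this
      refine ⟨h1.2.1, h2, (hder τ hτ).hasDerivWithinAt,
        hB (mem_image_of_mem _ hτ), ?_, ?_⟩
      -- Along `M` both models describe the same `D`, so a velocity in the range of the second
      -- anchor is also in the range of the first.
      · rw [map_smul, ← hanchor τ hτ]
        refine Submodule.smul_mem _ _ ?_
        refine (L.mem_iff _ (hV₀d h1.2.1) h4 h5 _).1 ?_
        rw [L'.mem_iff _ (hV₁d h1.2.2) h4 h5, ← hφ, hanchor τ hτ]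
        exact ⟨b', rfl⟩
      · have h6 := (hstay τ hτ).2
        change finrank ℝ (LinearMap.range (L'.anchor (φ (γ (t + τ * (s - t))))).toLinearMap) = _
          at h6
        rw [← h6]
        exact (L.finrank_eq (hV₀d h1.2.1) h4 h5).trans (L'.finrank_eq (hV₁d h1.2.2) h4 h5).symm
    · simp only [zero_mul, add_zero]
      rw [hγw, sub_self, hσ0]

/-- Local models at all points of a closed set give plaques. -/
theorem PlaqueFamily.nonempty_of_localModel [Nonempty ι] (hM : IsClosed M)
    (hL : ∀ w ∈ M, ∀ i, ∃ (L : LocalModel I D M V F w) (b : F), L.index b = i) :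
    Nonempty (PlaqueFamily I D M V) :=
  ⟨⟨hM, fun _ w hw hk => (Plaque.exists_of_localModel hw (hL w hw) hk).some⟩⟩

end LocalModels

/-! ### Brackets of Hamiltonian vector fields on a vector space -/

section HamiltonianBracket

variable {E : Type*} [NormedAddCommGroup E] [NormedSpace ℝ E]

/-- On an open subset of a vector space, the Lie bracket of the Hamiltonian vector fields `ξ` of
`f` and `η` of `g` is the Hamiltonian vector field of `{f, g}`. -/
theorem form_lieBracket_eq_fderiv {B : E → E →L[ℝ] E →L[ℝ] ℝ} {y : E}
    (hB : DifferentiableAt ℝ B y) (hskew : ∀ v w, B y v w = -B y w v)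
    (hskew' : ∀ u v w, fderiv ℝ B y u v w = -fderiv ℝ B y u w v)
    (hclosed : ∀ u v w, fderiv ℝ B y u v w + fderiv ℝ B y v w u + fderiv ℝ B y w u v = 0)
    {f g : E → ℝ} (hf : ContDiffAt ℝ 2 f y) (hg : ContDiffAt ℝ 2 g y) {ξ η : E → E}
    (hξ : DifferentiableAt ℝ ξ y) (hη : DifferentiableAt ℝ η y)
    (hfξ : ∀ᶠ y' in 𝓝 y, ∀ w, B y' w (ξ y') = fderiv ℝ f y' w)
    (hgη : ∀ᶠ y' in 𝓝 y, ∀ w, B y' w (η y') = fderiv ℝ g y' w) (w : E) :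
    B y w (fderiv ℝ η y (ξ y) - fderiv ℝ ξ y (η y)) =
      fderiv ℝ (fun y' => B y' (ξ y') (η y')) y w := by
  -- This is the equation `B(w, η) = dg(w)`, differentiated in the direction `u` with `w` constant.
  have key : ∀ {g : E → ℝ} {η : E → E}, ContDiffAt ℝ 2 g y → DifferentiableAt ℝ η y →
      (∀ᶠ y' in 𝓝 y, ∀ w, B y' w (η y') = fderiv ℝ g y' w) → ∀ u w,
      fderiv ℝ B y u w (η y) + B y w (fderiv ℝ η y u) = fderiv ℝ (fderiv ℝ g) y u w := by
    intro g η hg hη hgη u w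
    have h1 : HasFDerivAt (fun y' => B y' w (η y')) _ y :=
      (hB.hasFDerivAt.clm_apply (hasFDerivAt_const w y)).clm_apply hη.hasFDerivAt
    have h2 : DifferentiableAt ℝ (fderiv ℝ g) y :=
      (hg.fderiv_right (m := 1) (by norm_num)).differentiableAt (by simp)
    have h3 : HasFDerivAt (fun y' => fderiv ℝ g y' w) _ y :=
      h2.hasFDerivAt.clm_apply (hasFDerivAt_const w y)
    have h4 := h1.unique (h3.congr_of_eventuallyEq (hgη.mono fun y' h => h w))
    have h5 := congrArg (fun L => L u) h4
    simp at h5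
    linarith
  have hsym : ∀ {g : E → ℝ}, ContDiffAt ℝ 2 g y → ∀ u w,
      fderiv ℝ (fderiv ℝ g) y u w = fderiv ℝ (fderiv ℝ g) y w u := fun hg u w =>
    (hg.isSymmSndFDerivAt (by simp)).eq u w
  have h6 : HasFDerivAt (fun y' => B y' (ξ y') (η y')) _ y :=
    (hB.hasFDerivAt.clm_apply hξ.hasFDerivAt).clm_apply hη.hasFDerivAt
  rw [h6.fderiv, map_sub]
  -- The second derivatives in the four instances of `key` cancel by symmetry. By skewness the
  -- remaining derivatives of `B` form the cyclic sum that vanishes by closedness.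
  have h7 := key hg hη hgη (ξ y) w
  have h8 := key hf hξ hfξ (η y) w
  have h9 := key hg hη hgη w (ξ y)
  have h10 := key hf hξ hfξ w (η y)
  have h11 := hsym hg (ξ y) w
  have h12 := hsym hf (η y) w
  have h13 := hclosed (ξ y) (η y) w
  have h14 := hskew (fderiv ℝ ξ y w) (η y)
  have h15 := hskew' (ξ y) w (η y)
  have h16 := hskew' w (ξ y) (η y)
  simp
  linarith

end HamiltonianBracket

/-! ### Hamiltonian vector fields in charts -/

section ChartField

variable {E : Type*} [NormedAddCommGroup E] [NormedSpace ℝ E] [FiniteDimensional ℝ E]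
  {S : Type*} [TopologicalSpace S] [ChartedSpace E S]

/-- The coordinate expression of a form field, with values in the continuous bilinear forms. -/
noncomputable def localFormL (Ω : FormField 𝓘(ℝ, E) S) (x₀ : S) (y : E) : E →L[ℝ] E →L[ℝ] ℝ :=
  LinearMap.toContinuousLinearMap
    ((LinearMap.toContinuousLinearMap (𝕜 := ℝ) (E := E) (F' := ℝ)).toLinearMap ∘ₗ
      (localForm Ω x₀ y : E →ₗ[ℝ] E →ₗ[ℝ] ℝ))

theorem localFormL_apply (Ω : FormField 𝓘(ℝ, E) S) (x₀ : S) (y v w : E) :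
    localFormL Ω x₀ y v w = localForm Ω x₀ y v w := rfl

theorem contDiffOn_localFormL (Ω : SymplecticForm E S) (x₀ : S) :
    ContDiffOn ℝ ∞ (localFormL Ω.form x₀) (extChartAt 𝓘(ℝ, E) x₀).target :=
  contDiffOn_clm_apply.2 fun v => contDiffOn_clm_apply.2 fun w => Ω.smooth x₀ v w

theorem fderiv_localFormL_apply (Ω : SymplecticForm E S) (x₀ : S) {y : E}
    (hy : y ∈ (extChartAt 𝓘(ℝ, E) x₀).target) (u v w : E) :
    fderiv ℝ (localFormL Ω.form x₀) y u v w =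
      fderiv ℝ (fun y => localForm Ω.form x₀ y v w) y u := by
  have h1 := (((contDiffOn_localFormL Ω x₀).contDiffAt
    ((isOpen_extChartAt_target x₀).mem_nhds hy)).differentiableAt (by simp)).hasFDerivAt
  have h2 : HasFDerivAt (fun y => localForm Ω.form x₀ y v w) _ y :=
    (h1.clm_apply (hasFDerivAt_const v y)).clm_apply (hasFDerivAt_const w y)
  rw [h2.fderiv]
  simp

/-- A Hamiltonian vector field in a chart. -/
noncomputable def chartField (Ω : FormField 𝓘(ℝ, E) S) (x₀ : S) (h : S → ℝ) (y : E) : E :=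
  mfderiv 𝓘(ℝ, E) 𝓘(ℝ, E) (extChartAt 𝓘(ℝ, E) x₀) ((extChartAt 𝓘(ℝ, E) x₀).symm y)
    (hamiltonian Ω h ((extChartAt 𝓘(ℝ, E) x₀).symm y))

theorem chartField_extChartAt (Ω : FormField 𝓘(ℝ, E) S) (x₀ : S) (h : S → ℝ) {x : S}
    (hx : x ∈ (extChartAt 𝓘(ℝ, E) x₀).source) :
    chartField Ω x₀ h (extChartAt 𝓘(ℝ, E) x₀ x) =
      mfderiv 𝓘(ℝ, E) 𝓘(ℝ, E) (extChartAt 𝓘(ℝ, E) x₀) x (hamiltonian Ω h x) :=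
  congrArg (fun x => (mfderiv 𝓘(ℝ, E) 𝓘(ℝ, E) (extChartAt 𝓘(ℝ, E) x₀) x
    (hamiltonian Ω h x) : E)) ((extChartAt 𝓘(ℝ, E) x₀).left_inv hx)

variable [IsManifold 𝓘(ℝ, E) ∞ S]

theorem mfderiv_symm_chartField (Ω : FormField 𝓘(ℝ, E) S) (x₀ : S) (h : S → ℝ) {y : E}
    (hy : y ∈ (extChartAt 𝓘(ℝ, E) x₀).target) :
    mfderiv 𝓘(ℝ, E) 𝓘(ℝ, E) (extChartAt 𝓘(ℝ, E) x₀).symm y (chartField (E := E) Ω x₀ h y) =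
      hamiltonian Ω h ((extChartAt 𝓘(ℝ, E) x₀).symm y) := by
  have h1 := mfderiv_extChartAt_symm_apply (I := 𝓘(ℝ, E)) x₀
    (z := (extChartAt 𝓘(ℝ, E) x₀).symm y)
    (by rw [← extChartAt_source 𝓘(ℝ, E)]; exact (extChartAt 𝓘(ℝ, E) x₀).map_target hy)
    (hamiltonian Ω h ((extChartAt 𝓘(ℝ, E) x₀).symm y))
  rw [(extChartAt 𝓘(ℝ, E) x₀).right_inv hy] at h1
  exact h1

theorem contDiffOn_comp_extChartAt_symm {h : S → ℝ} (hh : ContMDiff 𝓘(ℝ, E) 𝓘(ℝ, ℝ) ∞ h) (x₀ : S) :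
    ContDiffOn ℝ ∞ (fun y => h ((extChartAt 𝓘(ℝ, E) x₀).symm y))
      (extChartAt 𝓘(ℝ, E) x₀).target :=
  (hh.comp_contMDiffOn (contMDiffOn_extChartAt_symm x₀)).contDiffOn

/-- The defining property of Hamiltonian vector fields, in a chart. -/
theorem localFormL_chartField (Ω : SymplecticForm E S) (x₀ : S) {h : S → ℝ}
    (hh : ContMDiff 𝓘(ℝ, E) 𝓘(ℝ, ℝ) ∞ h) {y : E} (hy : y ∈ (extChartAt 𝓘(ℝ, E) x₀).target)
    (w : E) :
    localFormL Ω.form x₀ y w (chartField Ω.form x₀ h y) =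
      fderiv ℝ (fun y => h ((extChartAt 𝓘(ℝ, E) x₀).symm y)) y w := by
  rw [localFormL_apply, localForm_apply, mfderiv_symm_chartField _ _ _ hy,
    hamiltonian_spec _ Ω.nondegenerate]
  have h1 := (contMDiffAt_extChartAt_symm (I := 𝓘(ℝ, E)) x₀ hy).mdifferentiableAt (by simp)
  have h2 := (hh.mdifferentiableAt (x := (extChartAt 𝓘(ℝ, E) x₀).symm y) (by simp)).hasMFDerivAt.comp
    y h1.hasMFDerivAt
  obtain ⟨L, hL, h3⟩ : ∃ L : E →L[ℝ] ℝ, L w = differential 𝓘(ℝ, E) h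
      ((extChartAt 𝓘(ℝ, E) x₀).symm y)
      (mfderiv 𝓘(ℝ, E) 𝓘(ℝ, E) (extChartAt 𝓘(ℝ, E) x₀).symm y w) ∧
      HasFDerivAt (fun y => h ((extChartAt 𝓘(ℝ, E) x₀).symm y)) L y := ⟨_, rfl, h2.hasFDerivAt⟩
  rw [h3.fderiv, hL]

theorem localFormL_chartField_chartField (Ω : FormField 𝓘(ℝ, E) S) (x₀ : S) (f g : S → ℝ) {y : E}
    (hy : y ∈ (extChartAt 𝓘(ℝ, E) x₀).target) :
    localFormL Ω x₀ y (chartField Ω x₀ f y) (chartField Ω x₀ g y) =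
      bracket Ω f g ((extChartAt 𝓘(ℝ, E) x₀).symm y) := by
  rw [localFormL_apply, localForm_apply, mfderiv_symm_chartField _ _ _ hy,
    mfderiv_symm_chartField _ _ _ hy]
  rfl

theorem localFormL_injective (Ω : SymplecticForm E S) (x₀ : S) {y : E}
    (hy : y ∈ (extChartAt 𝓘(ℝ, E) x₀).target) {v v' : E}
    (h : ∀ w, localFormL Ω.form x₀ y w v = localFormL Ω.form x₀ y w v') : v = v' := by
  have hs : (extChartAt 𝓘(ℝ, E) x₀).symm y ∈ (chartAt E x₀).source := by
    rw [← extChartAt_source 𝓘(ℝ, E)]; exact (extChartAt 𝓘(ℝ, E) x₀).map_target hy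
  have h1 : ∀ u : E, mfderiv 𝓘(ℝ, E) 𝓘(ℝ, E) (extChartAt 𝓘(ℝ, E) x₀)
      ((extChartAt 𝓘(ℝ, E) x₀).symm y)
      (mfderiv 𝓘(ℝ, E) 𝓘(ℝ, E) (extChartAt 𝓘(ℝ, E) x₀).symm y u) = u := by
    intro u
    obtain ⟨a, ha⟩ := mfderiv_extChartAt_surjective (I := 𝓘(ℝ, E)) x₀ hs u
    have h2 := mfderiv_extChartAt_symm_apply (I := 𝓘(ℝ, E)) x₀ hs a
    rw [(extChartAt 𝓘(ℝ, E) x₀).right_inv hy] at h2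
    rw [← ha]
    exact congrArg _ h2
  have h2 : mfderiv 𝓘(ℝ, E) 𝓘(ℝ, E) (extChartAt 𝓘(ℝ, E) x₀).symm y v =
      mfderiv 𝓘(ℝ, E) 𝓘(ℝ, E) (extChartAt 𝓘(ℝ, E) x₀).symm y v' := by
    refine sub_eq_zero.1 ((Ω.nondegenerate _).2 _ fun a => ?_)
    obtain ⟨b, rfl⟩ : ∃ b : E, mfderiv 𝓘(ℝ, E) 𝓘(ℝ, E) (extChartAt 𝓘(ℝ, E) x₀).symm y b = a := by
      have h4 := mfderiv_extChartAt_symm_apply (I := 𝓘(ℝ, E)) x₀ hs a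
      rw [(extChartAt 𝓘(ℝ, E) x₀).right_inv hy] at h4
      exact ⟨_, h4⟩
    have h3 := h b
    rw [localFormL_apply, localFormL_apply, localForm_apply, localForm_apply] at h3
    rw [map_sub, sub_eq_zero]
    exact h3
  rw [← h1 v, h2, h1]

/-- Hamiltonian vector fields are smooth. -/
theorem contDiffOn_chartField (Ω : SymplecticForm E S) (x₀ : S) {h : S → ℝ}
    (hh : ContMDiff 𝓘(ℝ, E) 𝓘(ℝ, ℝ) ∞ h) :
    ContDiffOn ℝ ∞ (chartField Ω.form x₀ h) (extChartAt 𝓘(ℝ, E) x₀).target := by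
  have hopen := isOpen_extChartAt_target (I := 𝓘(ℝ, E)) x₀
  have h1 : ∀ y ∈ (extChartAt 𝓘(ℝ, E) x₀).target, ∃ e : E ≃L[ℝ] (E →L[ℝ] ℝ),
      (e : E →L[ℝ] E →L[ℝ] ℝ) = (localFormL Ω.form x₀ y).flip := by
    intro y hy
    have h2 : Function.Injective (localFormL Ω.form x₀ y).flip := fun v v' hv =>
      localFormL_injective Ω x₀ hy fun w => congrArg (fun L => L w) hv
    have h3 : finrank ℝ E = finrank ℝ (E →L[ℝ] ℝ) :=
      (Subspace.dual_finrank_eq (K := ℝ) (V := E)).symm.trans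
        (LinearMap.toContinuousLinearMap (𝕜 := ℝ) (E := E) (F' := ℝ)).finrank_eq
    have h4 := (LinearMap.injective_iff_surjective_of_finrank_eq_finrank
      (f := (localFormL Ω.form x₀ y).flip.toLinearMap) h3).1 h2
    exact ⟨(LinearEquiv.ofBijective (localFormL Ω.form x₀ y).flip.toLinearMap
      ⟨h2, h4⟩).toContinuousLinearEquiv, by ext; rfl⟩
  -- The field is the inverse of the form applied to `dh`; smoothness follows because inversion of
  -- operators is smooth.
  have h5 : ∀ y ∈ (extChartAt 𝓘(ℝ, E) x₀).target, chartField Ω.form x₀ h y =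
      ContinuousLinearMap.inverse (localFormL Ω.form x₀ y).flip
        (fderiv ℝ (fun y => h ((extChartAt 𝓘(ℝ, E) x₀).symm y)) y) := by
    intro y hy
    obtain ⟨e, he⟩ := h1 y hy
    rw [← he, ContinuousLinearMap.inverse_equiv]
    refine (e.symm_apply_eq.2 ?_).symm
    ext w
    rw [← localFormL_chartField Ω x₀ hh hy w]
    exact congrArg (fun L => L (chartField Ω.form x₀ h y) w) he.symm
  refine ContDiffOn.congr ?_ h5
  refine ContDiffOn.clm_apply (fun y hy => ?_) ?_
  · obtain ⟨e, he⟩ := h1 y hy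
    have h6 := contDiffAt_map_inverse (n := ∞) e
    rw [he] at h6
    refine (ContDiffAt.comp (f := fun y => (localFormL Ω.form x₀ y).flip) y h6
      ?_).contDiffWithinAt
    have h7 : ContDiffOn ℝ ∞ (fun y => (localFormL Ω.form x₀ y).flip)
        (extChartAt 𝓘(ℝ, E) x₀).target :=
      contDiffOn_clm_apply.2 fun v => contDiffOn_clm_apply.2 fun w => Ω.smooth x₀ w v
    exact h7.contDiffAt (hopen.mem_nhds hy)
  · exact (contDiffOn_comp_extChartAt_symm hh x₀).fderiv_of_isOpen hopen (by simp)

/-- In a chart, the Lie bracket of the Hamiltonian vector fields of `f` and `g` is the Hamiltonian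
vector field of `{f, g}`. -/
theorem fderiv_chartField_sub (Ω : SymplecticForm E S) (x₀ : S) {f g h : S → ℝ}
    (hf : ContMDiff 𝓘(ℝ, E) 𝓘(ℝ, ℝ) ∞ f) (hg : ContMDiff 𝓘(ℝ, E) 𝓘(ℝ, ℝ) ∞ g)
    (hh : ContMDiff 𝓘(ℝ, E) 𝓘(ℝ, ℝ) ∞ h) (hfg : ∀ x, bracket Ω.form f g x = h x) {y : E}
    (hy : y ∈ (extChartAt 𝓘(ℝ, E) x₀).target) :
    fderiv ℝ (chartField Ω.form x₀ g) y (chartField Ω.form x₀ f y) -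
      fderiv ℝ (chartField Ω.form x₀ f) y (chartField Ω.form x₀ g y) =
        chartField Ω.form x₀ h y := by
  have hy' := (isOpen_extChartAt_target (I := 𝓘(ℝ, E)) x₀).mem_nhds hy
  have hskew : ∀ y v w, localForm Ω.form x₀ y v w = -localForm Ω.form x₀ y w v := by
    intro y v w
    rw [localForm_apply, localForm_apply]
    exact ((Ω.alternating _).neg_eq _ _).symm
  refine localFormL_injective Ω x₀ hy fun w => ?_
  rw [form_lieBracket_eq_fderiv
    (((contDiffOn_localFormL Ω x₀).contDiffAt hy').differentiableAt (by simp))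
    (fun v w => hskew y v w) ?_ ?_
    (contDiffAt_infty.1 ((contDiffOn_comp_extChartAt_symm hf x₀).contDiffAt hy') 2)
    (contDiffAt_infty.1 ((contDiffOn_comp_extChartAt_symm hg x₀).contDiffAt hy') 2)
    (((contDiffOn_chartField Ω x₀ hf).contDiffAt hy').differentiableAt (by simp))
    (((contDiffOn_chartField Ω x₀ hg).contDiffAt hy').differentiableAt (by simp))
    (Filter.eventually_of_mem hy' fun y' h w => localFormL_chartField Ω x₀ hf h w)
    (Filter.eventually_of_mem hy' fun y' h w => localFormL_chartField Ω x₀ hg h w),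
    localFormL_chartField Ω x₀ hh hy]
  · refine congrArg (fun L : E →L[ℝ] ℝ => L w) (Filter.EventuallyEq.fderiv_eq ?_)
    refine Filter.eventually_of_mem hy' fun y' h' => ?_
    change localFormL _ _ _ _ _ = _
    rw [localFormL_chartField_chartField _ _ _ _ h', hfg]
  · intro u v w
    rw [fderiv_localFormL_apply Ω x₀ hy, fderiv_localFormL_apply Ω x₀ hy]
    simp_rw [hskew _ v w]
    rw [fderiv_fun_neg]
    rfl
  · intro u v w
    simp only [fderiv_localFormL_apply Ω x₀ hy]
    exact Ω.closed x₀ y hy u v w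

end ChartField

/-! ### Global functions with prescribed local behaviour -/

section LocalFunctions

variable {E P : Type*} [NormedAddCommGroup E] [NormedSpace ℝ E] [FiniteDimensional ℝ E]
  [TopologicalSpace P] [ChartedSpace E P] [IsManifold 𝓘(ℝ, E) ∞ P]

/-- Near a point, linear functions in a chart extend to smooth functions on the manifold. -/
theorem exists_smooth_extension_linear [T2Space P] (q₀ : P) :
    ∃ (lin : (E →L[ℝ] ℝ) →ₗ[ℝ] C^∞⟮𝓘(ℝ, E), P; ℝ⟯) (O : Set P), IsOpen O ∧ q₀ ∈ O ∧
      O ⊆ (chartAt E q₀).source ∧ ∀ p ∈ O, ∀ b, lin b p = b (extChartAt 𝓘(ℝ, E) q₀ p) := by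
  let ψ : SmoothBumpFunction 𝓘(ℝ, E) q₀ := Classical.arbitrary _
  obtain ⟨O, hO, hOo, hq⟩ := eventually_nhds_iff.1 ψ.eventuallyEq_one
  -- The same bump function serves all `b`, which makes the extension linear in `b` and the set `O`
  -- independent of it.
  refine ⟨{ toFun := fun b => ⟨fun p => ψ p • b (extChartAt 𝓘(ℝ, E) q₀ p),
              ψ.contMDiff_smul (b.contDiff.contMDiff.comp_contMDiffOn contMDiffOn_extChartAt)⟩
            map_add' := fun b b' => by
              ext p
              exact smul_add (ψ p) (b (extChartAt 𝓘(ℝ, E) q₀ p)) (b' (extChartAt 𝓘(ℝ, E) q₀ p))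
            map_smul' := fun c b => by
              ext p
              exact mul_left_comm (ψ p) c (b (extChartAt 𝓘(ℝ, E) q₀ p)) },
    O ∩ (chartAt E q₀).source, hOo.inter (chartAt E q₀).open_source,
    ⟨hq, mem_chart_source E q₀⟩, inter_subset_right, fun p hp b => ?_⟩
  change ψ p • b _ = _
  rw [hO p hp.1, Pi.one_apply, one_smul]

theorem differential_eq_fderiv_comp_extChartAt {f : P → ℝ} (hf : ContMDiff 𝓘(ℝ, E) 𝓘(ℝ, ℝ) ∞ f)
    (q₀ : P) {q : P} (hq : q ∈ (chartAt E q₀).source) (v : TangentSpace 𝓘(ℝ, E) q) :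
    differential 𝓘(ℝ, E) f q v =
      fderiv ℝ (fun y => f ((extChartAt 𝓘(ℝ, E) q₀).symm y)) (extChartAt 𝓘(ℝ, E) q₀ q)
        (mfderiv 𝓘(ℝ, E) 𝓘(ℝ, E) (extChartAt 𝓘(ℝ, E) q₀) q v) := by
  have hq' : q ∈ (extChartAt 𝓘(ℝ, E) q₀).source := by rwa [extChartAt_source]
  have h1 : MDifferentiableAt 𝓘(ℝ, E) 𝓘(ℝ, E) (extChartAt 𝓘(ℝ, E) q₀) q :=
    mdifferentiableAt_extChartAt hq
  have h2 := (((contDiffOn_comp_extChartAt_symm hf q₀).contDiffAt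
    ((isOpen_extChartAt_target q₀).mem_nhds
      ((extChartAt 𝓘(ℝ, E) q₀).map_source hq'))).differentiableAt (by simp)).hasFDerivAt
  have h3 := h2.hasMFDerivAt.comp q h1.hasMFDerivAt
  have h4 : f =ᶠ[𝓝 q] (fun y => f ((extChartAt 𝓘(ℝ, E) q₀).symm y)) ∘ extChartAt 𝓘(ℝ, E) q₀ := by
    filter_upwards [(isOpen_extChartAt_source (I := 𝓘(ℝ, E)) q₀).mem_nhds hq'] with p hp
    rw [Function.comp_apply, (extChartAt 𝓘(ℝ, E) q₀).left_inv hp]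
  rw [differential, (h3.congr_of_eventuallyEq h4).mfderiv]
  rfl

theorem differential_eq_of_eqOn_chart {f : P → ℝ} {b : E →L[ℝ] ℝ} {q₀ : P} {O : Set P} (hO : IsOpen O)
    (hOs : O ⊆ (chartAt E q₀).source) (hf : ∀ p ∈ O, f p = b (extChartAt 𝓘(ℝ, E) q₀ p)) {q : P}
    (hq : q ∈ O) (v : TangentSpace 𝓘(ℝ, E) q) :
    differential 𝓘(ℝ, E) f q v =
      b (mfderiv 𝓘(ℝ, E) 𝓘(ℝ, E) (extChartAt 𝓘(ℝ, E) q₀) q v) := by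
  have h1 : MDifferentiableAt 𝓘(ℝ, E) 𝓘(ℝ, E) (extChartAt 𝓘(ℝ, E) q₀) q :=
    mdifferentiableAt_extChartAt (hOs hq)
  have h3 := b.hasFDerivAt.hasMFDerivAt.comp q h1.hasMFDerivAt
  have h4 : f =ᶠ[𝓝 q] b ∘ extChartAt 𝓘(ℝ, E) q₀ := by
    filter_upwards [hO.mem_nhds hq] with p hp using hf p hp
  rw [differential, (h3.congr_of_eventuallyEq h4).mfderiv]
  rfl

/-- Both halves of the co-isotropy argument rest on this: covectors of `P` may be treated as
differentials of global functions. -/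
theorem exists_differential_eq [T2Space P] (q : P) (η : E →ₗ[ℝ] ℝ) :
    ∃ f : C^∞⟮𝓘(ℝ, E), P; ℝ⟯, ∀ v : E, differential 𝓘(ℝ, E) f q v = η v := by
  obtain ⟨lin, O, hO, hq, hOs, hlin⟩ := exists_smooth_extension_linear (E := E) q
  refine ⟨lin (LinearMap.toContinuousLinearMap (η ∘ₗ
    (mfderiv 𝓘(ℝ, E) 𝓘(ℝ, E) (extChartAt 𝓘(ℝ, E) q).symm (extChartAt 𝓘(ℝ, E) q q) :
      E →L[ℝ] E).toLinearMap)), fun v => ?_⟩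
  refine (differential_eq_of_eqOn_chart hO hOs (fun p hp => hlin p hp _) hq v).trans ?_
  exact congrArg η (mfderiv_extChartAt_symm_apply q (hOs hq) v)

end LocalFunctions

/-! ### The fields `X̂_f` at a point -/

section HatField

variable {ES ER EP : Type*}
  [NormedAddCommGroup ES] [NormedSpace ℝ ES] [FiniteDimensional ℝ ES]
  [NormedAddCommGroup ER] [NormedSpace ℝ ER] [FiniteDimensional ℝ ER]
  [NormedAddCommGroup EP] [NormedSpace ℝ EP]
  {S R P : Type*}
  [TopologicalSpace S] [ChartedSpace ES S]
  [TopologicalSpace R] [ChartedSpace ER R]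
  [TopologicalSpace P] [ChartedSpace EP P]
  {ΩS : SymplecticForm ES S} {ΩR : SymplecticForm ER R} {π : PoissonStructure EP P}
  {J : S → P} {ρ : R → P}

theorem differential_comp (hJ : ContMDiff 𝓘(ℝ, ES) 𝓘(ℝ, EP) ∞ J) (f : C^∞⟮𝓘(ℝ, EP), P; ℝ⟯) (x : S)
    (v : TangentSpace 𝓘(ℝ, ES) x) :
    differential 𝓘(ℝ, ES) (f ∘ J) x v =
      differential 𝓘(ℝ, EP) f (J x) (mfderiv 𝓘(ℝ, ES) 𝓘(ℝ, EP) J x v) := by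
  have h1 : MDifferentiableAt 𝓘(ℝ, EP) 𝓘(ℝ, ℝ) f (J x) :=
    f.contMDiff.mdifferentiableAt (by simp)
  have h2 : MDifferentiableAt 𝓘(ℝ, ES) 𝓘(ℝ, EP) J x := hJ.mdifferentiableAt (by simp)
  rw [differential, mfderiv_comp x h1 h2]
  rfl

theorem differential_hat (hJ : ContMDiff 𝓘(ℝ, ES) 𝓘(ℝ, EP) ∞ J)
    (hρ : ContMDiff 𝓘(ℝ, ER) 𝓘(ℝ, EP) ∞ ρ) (f : C^∞⟮𝓘(ℝ, EP), P; ℝ⟯) (x : S) (y : R) (v : ES)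
    (w : ER) :
    differential (𝓘(ℝ, ES).prod 𝓘(ℝ, ER)) (fun z : S × R => f (J z.1) - f (ρ z.2)) (x, y) (v, w) =
      differential 𝓘(ℝ, ES) (f ∘ J) x v - differential 𝓘(ℝ, ER) (f ∘ ρ) y w := by
  have h1 : MDifferentiableAt 𝓘(ℝ, ES) 𝓘(ℝ, ℝ) (f ∘ J) x :=
    (f.contMDiff.comp hJ).mdifferentiableAt (by simp)
  have h2 : MDifferentiableAt 𝓘(ℝ, ER) 𝓘(ℝ, ℝ) (f ∘ ρ) y :=
    (f.contMDiff.comp hρ).mdifferentiableAt (by simp)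
  have h3 := h1.hasMFDerivAt.comp (x, y)
    (hasMFDerivAt_fst (I := 𝓘(ℝ, ES)) (I' := 𝓘(ℝ, ER)) (x, y))
  have h4 := h2.hasMFDerivAt.comp (x, y)
    (hasMFDerivAt_snd (I := 𝓘(ℝ, ES)) (I' := 𝓘(ℝ, ER)) (x, y))
  have h5 := h3.sub h4
  exact congrArg (fun L => L (v, w)) h5.mfderiv

theorem hatField_eq (hJ : ContMDiff 𝓘(ℝ, ES) 𝓘(ℝ, EP) ∞ J)
    (hρ : ContMDiff 𝓘(ℝ, ER) 𝓘(ℝ, EP) ∞ ρ) (f : C^∞⟮𝓘(ℝ, EP), P; ℝ⟯) (x : S) (y : R) :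
    hatField ΩS ΩR J ρ f (x, y) =
      ((hamiltonian ΩS.form (f ∘ J) x, -hamiltonian ΩR.form (f ∘ ρ) y) : ES × ER) := by
  symm
  refine hamiltonian_unique _ (prodForm_nondegenerate _ _ ΩS.nondegenerate ΩR.nondegenerate) _ _ _ ?_
  rintro ⟨v, w⟩
  refine (prodForm_apply _ _ _ _ _ _ _ _).trans ((differential_hat hJ hρ f x y v w).trans ?_).symm
  have h1 := hamiltonian_spec ΩS.form ΩS.nondegenerate (f ∘ J) x v
  have h2 := hamiltonian_spec ΩR.form ΩR.nondegenerate (f ∘ ρ) y w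
  have h3 := map_neg (ΩR.form y w) (hamiltonian ΩR.form (f ∘ ρ) y)
  exact (congrArg₂ (· - ·) h1.symm h2.symm).trans
    ((sub_eq_add_neg _ _).trans (congrArg (_ + ·) h3.symm))

/-- On the fibre product both differentials are taken at the same point, so `X̂_f` represents the
pull-back of `df` under `J_* - ρ_*`, whose kernel is the tangent space. -/
theorem prodForm_hatField (hJ : ContMDiff 𝓘(ℝ, ES) 𝓘(ℝ, EP) ∞ J)
    (hρ : ContMDiff 𝓘(ℝ, ER) 𝓘(ℝ, EP) ∞ ρ) (f : C^∞⟮𝓘(ℝ, EP), P; ℝ⟯) (x : S) (y : R) (v : ES)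
    (w : ER) :
    prodForm ΩS.form ΩR.form (x, y) (v, w) (hatField ΩS ΩR J ρ f (x, y)) =
      differential 𝓘(ℝ, EP) f (J x) (mfderiv 𝓘(ℝ, ES) 𝓘(ℝ, EP) J x v) -
        differential 𝓘(ℝ, EP) f (ρ y) (mfderiv 𝓘(ℝ, ER) 𝓘(ℝ, EP) ρ y w) := by
  refine (hamiltonian_spec _ (prodForm_nondegenerate _ _ ΩS.nondegenerate ΩR.nondegenerate) _ _
    _).trans ((differential_hat hJ hρ f x y v w).trans ?_)
  exact congrArg₂ (· - ·) (differential_comp hJ f x v) (differential_comp hρ f y w)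

theorem mem_fibreTangent_iff (hJ : ContMDiff 𝓘(ℝ, ES) 𝓘(ℝ, EP) ∞ J)
    (hρ : ContMDiff 𝓘(ℝ, ER) 𝓘(ℝ, EP) ∞ ρ) (x : S) (y : R) (v : ES) (w : ER) :
    ((v, w) : ES × ER) ∈ fibreTangent ES ER EP J ρ (x, y) ↔
      (mfderiv 𝓘(ℝ, ES) 𝓘(ℝ, EP) J x v : EP) = (mfderiv 𝓘(ℝ, ER) 𝓘(ℝ, EP) ρ y w : EP) := by
  have h1 : MDifferentiableAt 𝓘(ℝ, ES) 𝓘(ℝ, EP) J x := hJ.mdifferentiableAt (by simp)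
  have h2 : MDifferentiableAt 𝓘(ℝ, ER) 𝓘(ℝ, EP) ρ y := hρ.mdifferentiableAt (by simp)
  have h3 := h1.hasMFDerivAt.comp (x, y)
    (hasMFDerivAt_fst (I := 𝓘(ℝ, ES)) (I' := 𝓘(ℝ, ER)) (x, y))
  have h4 := h2.hasMFDerivAt.comp (x, y)
    (hasMFDerivAt_snd (I := 𝓘(ℝ, ES)) (I' := 𝓘(ℝ, ER)) (x, y))
  have h5 : (mfderiv (𝓘(ℝ, ES).prod 𝓘(ℝ, ER)) 𝓘(ℝ, EP) (fun z : S × R => J z.1) (x, y) (v, w) : EP)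
      = mfderiv 𝓘(ℝ, ES) 𝓘(ℝ, EP) J x v := congrArg (fun L => L (v, w)) h3.mfderiv
  have h6 : (mfderiv (𝓘(ℝ, ES).prod 𝓘(ℝ, ER)) 𝓘(ℝ, EP) (fun z : S × R => ρ z.2) (x, y) (v, w) : EP)
      = mfderiv 𝓘(ℝ, ER) 𝓘(ℝ, EP) ρ y w := congrArg (fun L => L (v, w)) h4.mfderiv
  rw [← h5, ← h6]
  rfl

/-- A Poisson map sends Hamiltonian vector fields to Hamiltonian vector fields. -/
theorem IsPoissonMap.mfderiv_hamiltonian (hJ : IsPoissonMap ΩS π J)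
    (f g : C^∞⟮𝓘(ℝ, EP), P; ℝ⟯) (x : S) :
    differential 𝓘(ℝ, EP) g (J x) (mfderiv 𝓘(ℝ, ES) 𝓘(ℝ, EP) J x
      (hamiltonian ΩS.form (f ∘ J) x)) = π.bracket f g (J x) := by
  rw [← hJ.2, ← differential_hamiltonian _ ΩS.nondegenerate, differential_comp hJ.1]

theorem differential_add (f g : C^∞⟮𝓘(ℝ, EP), P; ℝ⟯) (q : P) :
    differential 𝓘(ℝ, EP) ⇑(f + g) q = differential 𝓘(ℝ, EP) f q + differential 𝓘(ℝ, EP) g q := by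
  ext v
  have h1 : MDifferentiableAt 𝓘(ℝ, EP) 𝓘(ℝ, ℝ) f q := f.contMDiff.mdifferentiableAt (by simp)
  have h2 : MDifferentiableAt 𝓘(ℝ, EP) 𝓘(ℝ, ℝ) g q := g.contMDiff.mdifferentiableAt (by simp)
  exact congrArg (fun L => L v) (h1.hasMFDerivAt.add h2.hasMFDerivAt).mfderiv

theorem differential_smul (c : ℝ) (f : C^∞⟮𝓘(ℝ, EP), P; ℝ⟯) (q : P) :
    differential 𝓘(ℝ, EP) ⇑(c • f) q = c • differential 𝓘(ℝ, EP) f q := by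
  ext v
  have h1 : MDifferentiableAt 𝓘(ℝ, EP) 𝓘(ℝ, ℝ) f q := f.contMDiff.mdifferentiableAt (by simp)
  exact congrArg (fun L => L v) (h1.hasMFDerivAt.const_smul c).mfderiv

theorem hamiltonian_comp_congr (hJ : ContMDiff 𝓘(ℝ, ES) 𝓘(ℝ, EP) ∞ J)
    {f g : C^∞⟮𝓘(ℝ, EP), P; ℝ⟯} {x : S}
    (h : differential 𝓘(ℝ, EP) f (J x) = differential 𝓘(ℝ, EP) g (J x)) :
    hamiltonian ΩS.form (f ∘ J) x = hamiltonian ΩS.form (g ∘ J) x := by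
  refine hamiltonian_unique _ ΩS.nondegenerate _ _ _ fun v => ?_
  rw [hamiltonian_spec _ ΩS.nondegenerate, differential_comp hJ, differential_comp hJ, h]

/-- The vector field `X̂_f` depends linearly on `f`. -/
noncomputable def hatFieldLinear (ΩS : SymplecticForm ES S) (ΩR : SymplecticForm ER R)
    (hJ : ContMDiff 𝓘(ℝ, ES) 𝓘(ℝ, EP) ∞ J) (hρ : ContMDiff 𝓘(ℝ, ER) 𝓘(ℝ, EP) ∞ ρ) (z : S × R) :
    C^∞⟮𝓘(ℝ, EP), P; ℝ⟯ →ₗ[ℝ] TangentSpace (𝓘(ℝ, ES).prod 𝓘(ℝ, ER)) z where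
  toFun f := hatField ΩS ΩR J ρ f z
  map_add' f g := by
    symm
    refine hamiltonian_unique _ (prodForm_nondegenerate _ _ ΩS.nondegenerate ΩR.nondegenerate)
      _ _ _ fun w => ?_
    have h1 : ∀ h, prodForm ΩS.form ΩR.form z w (hatField ΩS ΩR J ρ h z) = _ := fun h =>
      prodForm_hatField hJ hρ h z.1 z.2 w.1 w.2
    rw [map_add, h1, h1]
    refine Eq.trans ?_ ((h1 (f + g)).symm.trans
      (hamiltonian_spec _ (prodForm_nondegenerate _ _ ΩS.nondegenerate ΩR.nondegenerate) _ z w))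
    simp only [differential_add, LinearMap.add_apply]
    ring
  map_smul' c f := by
    symm
    refine hamiltonian_unique _ (prodForm_nondegenerate _ _ ΩS.nondegenerate ΩR.nondegenerate)
      _ _ _ fun w => ?_
    have h1 : ∀ h, prodForm ΩS.form ΩR.form z w (hatField ΩS ΩR J ρ h z) = _ := fun h =>
      prodForm_hatField hJ hρ h z.1 z.2 w.1 w.2
    rw [map_smul, h1]
    refine Eq.trans ?_ ((h1 (c • f)).symm.trans
      (hamiltonian_spec _ (prodForm_nondegenerate _ _ ΩS.nondegenerate ΩR.nondegenerate) _ z w))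
    simp only [differential_smul, LinearMap.smul_apply, smul_eq_mul, RingHom.id_apply]
    ring

/-- Linearity in `f` makes the set of values a subspace already, so no linear combinations are
needed. -/
theorem mem_hatSpan_iff (hJ : ContMDiff 𝓘(ℝ, ES) 𝓘(ℝ, EP) ∞ J)
    (hρ : ContMDiff 𝓘(ℝ, ER) 𝓘(ℝ, EP) ∞ ρ) (z : S × R)
    (v : TangentSpace (𝓘(ℝ, ES).prod 𝓘(ℝ, ER)) z) :
    v ∈ hatSpan EP ΩS ΩR J ρ z ↔ ∃ f : C^∞⟮𝓘(ℝ, EP), P; ℝ⟯, hatField ΩS ΩR J ρ f z = v := by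
  have h1 : hatSpan EP ΩS ΩR J ρ z = LinearMap.range (hatFieldLinear ΩS ΩR hJ hρ z) :=
    (LinearMap.range (hatFieldLinear ΩS ΩR hJ hρ z)).span_eq
  rw [h1]
  rfl

/-- Off the fibre product, `X̂_f` involves the differentials of `f` at the two points `J x` and `ρ
y`; on it these points coincide. Hence finitely many functions generate the span locally along `M`.
-/
theorem hatField_congr (hJ : ContMDiff 𝓘(ℝ, ES) 𝓘(ℝ, EP) ∞ J)
    (hρ : ContMDiff 𝓘(ℝ, ER) 𝓘(ℝ, EP) ∞ ρ) {z : S × R} (hz : z ∈ fibreProduct J ρ)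
    {f g : C^∞⟮𝓘(ℝ, EP), P; ℝ⟯}
    (h : differential 𝓘(ℝ, EP) f (J z.1) = differential 𝓘(ℝ, EP) g (J z.1)) :
    hatField ΩS ΩR J ρ f z = hatField ΩS ΩR J ρ g z := by
  have hz' : J z.1 = ρ z.2 := hz
  have h' : differential 𝓘(ℝ, EP) f (ρ z.2) = differential 𝓘(ℝ, EP) g (ρ z.2) := by
    rw [← hz']; exact h
  refine (hatField_eq hJ hρ f z.1 z.2).trans (Eq.trans ?_ (hatField_eq hJ hρ g z.1 z.2).symm)
  rw [hamiltonian_comp_congr hJ h, hamiltonian_comp_congr hρ h']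

end HatField

/-! ### Co-isotropy of the fibre product -/

section Coisotropic

variable {ES ER EP : Type*}
  [NormedAddCommGroup ES] [NormedSpace ℝ ES] [FiniteDimensional ℝ ES]
  [NormedAddCommGroup ER] [NormedSpace ℝ ER] [FiniteDimensional ℝ ER]
  [NormedAddCommGroup EP] [NormedSpace ℝ EP] [FiniteDimensional ℝ EP]
  {S R P : Type*}
  [TopologicalSpace S] [ChartedSpace ES S]
  [TopologicalSpace R] [ChartedSpace ER R]
  [TopologicalSpace P] [ChartedSpace EP P] [IsManifold 𝓘(ℝ, EP) ∞ P] [T2Space P]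
  {ΩS : SymplecticForm ES S} {ΩR : SymplecticForm ER R} {π : PoissonStructure EP P}
  {J : S → P} {ρ : R → P}

/-- The vector fields `X̂_f` span the symplectic orthogonal of the tangent space. -/
theorem hatSpan_eq_orthogonal (hJ : ContMDiff 𝓘(ℝ, ES) 𝓘(ℝ, EP) ∞ J)
    (hρ : ContMDiff 𝓘(ℝ, ER) 𝓘(ℝ, EP) ∞ ρ) {z : S × R} (hz : z ∈ fibreProduct J ρ) :
    hatSpan EP ΩS ΩR J ρ z =
      (prodForm ΩS.form ΩR.form z).orthogonal (fibreTangent ES ER EP J ρ z) := by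
  obtain ⟨x, y⟩ := z
  have hz' : J x = ρ y := hz
  obtain ⟨A, hA⟩ : ∃ A : ES →L[ℝ] EP, A = mfderiv 𝓘(ℝ, ES) 𝓘(ℝ, EP) J x := ⟨_, rfl⟩
  obtain ⟨B, hB⟩ : ∃ B : ER →L[ℝ] EP, B = mfderiv 𝓘(ℝ, ER) 𝓘(ℝ, EP) ρ y := ⟨_, rfl⟩
  have htangent : ∀ v w, ((v, w) : ES × ER) ∈ fibreTangent ES ER EP J ρ (x, y) ↔ A v = B w := by
    intro v w
    rw [hA, hB]
    exact mem_fibreTangent_iff hJ hρ x y v w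
  obtain ⟨d, hd⟩ : ∃ d : C^∞⟮𝓘(ℝ, EP), P; ℝ⟯ → (EP →ₗ[ℝ] ℝ),
      ∀ f, d f = differential 𝓘(ℝ, EP) f (J x) := ⟨_, fun f => rfl⟩
  have hd' : ∀ f, d f = differential 𝓘(ℝ, EP) f (ρ y) := by
    rw [← hz']; exact hd
  have hform : ∀ (f : C^∞⟮𝓘(ℝ, EP), P; ℝ⟯) (v : ES) (w : ER),
      prodForm ΩS.form ΩR.form (x, y) (v, w) (hatField ΩS ΩR J ρ f (x, y)) = d f (A v - B w) := by
    intro f v w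
    refine (prodForm_hatField hJ hρ f x y v w).trans ?_
    rw [map_sub, hA, hB]
    exact congrArg₂ (· - ·) (LinearMap.congr_fun (hd f) _).symm
      (LinearMap.congr_fun (hd' f) _).symm
  ext u
  rw [mem_hatSpan_iff hJ hρ]
  constructor
  · rintro ⟨f, rfl⟩ ⟨v, w⟩ hvw
    refine (hform f v w).trans ?_
    rw [(htangent v w).1 hvw, sub_self, map_zero]
  · intro hu
    let L : ES × ER →ₗ[ℝ] EP :=
      A.toLinearMap ∘ₗ LinearMap.fst ℝ ES ER - B.toLinearMap ∘ₗ LinearMap.snd ℝ ES ER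
    let α : ES × ER →ₗ[ℝ] ℝ := (prodForm ΩS.form ΩR.form (x, y)).flip u
    -- The functional `ω(·, u)` vanishes on `ker L`, so it factors through `L`; the factor `η` is
    -- then realised as a differential.
    have h1 : α ∈ LinearMap.range L.dualMap := by
      rw [LinearMap.range_dualMap_eq_dualAnnihilator_ker, Submodule.mem_dualAnnihilator]
      rintro ⟨v, w⟩ hvw
      exact hu (v, w) ((htangent v w).2 (sub_eq_zero.1 hvw))
    obtain ⟨η, hη⟩ := h1
    obtain ⟨f, hf⟩ := exists_differential_eq (J x) η
    refine ⟨f, sub_eq_zero.1 ((prodForm_nondegenerate _ _ ΩS.nondegenerate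
      ΩR.nondegenerate (x, y)).2 _ ?_)⟩
    rintro ⟨v, w⟩
    rw [map_sub, sub_eq_zero]
    refine (hform f v w).trans (Eq.trans ?_ ((hf (A v - B w)).trans ?_))
    · exact LinearMap.congr_fun (hd f) _
    · exact congrArg (fun β => β (v, w)) hη

/-- The fibre product is co-isotropic. -/
theorem hatSpan_le_fibreTangent (hJ : IsPoissonMap ΩS π.opposite J) (hρ : IsPoissonMap ΩR π ρ)
    {z : S × R} (hz : z ∈ fibreProduct J ρ) :
    hatSpan EP ΩS ΩR J ρ z ≤ fibreTangent ES ER EP J ρ z := by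
  obtain ⟨x, y⟩ := z
  have hz' : J x = ρ y := hz
  intro u hu
  obtain ⟨f, rfl⟩ := (mem_hatSpan_iff hJ.1 hρ.1 _ _).1 hu
  rw [hatField_eq hJ.1 hρ.1]
  refine (mem_fibreTangent_iff hJ.1 hρ.1 x y _ _).2 ?_
  have dual_ext : ∀ a b : EP, (∀ η : Dual ℝ EP, η a = η b) → a = b := fun a b h =>
    sub_eq_zero.1 ((Module.forall_dual_apply_eq_zero_iff ℝ _).1 fun η => by
      rw [map_sub, h, sub_self])
  -- With `η = dg` both sides equal `-{f, g}`: on the left because `J` is Poisson into `P^-`, on the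
  -- right because of the sign of the second component.
  have h1 : ∀ η : Dual ℝ EP, η (mfderiv 𝓘(ℝ, ES) 𝓘(ℝ, EP) J x (hamiltonian ΩS.form (f ∘ J) x)) =
      η (mfderiv 𝓘(ℝ, ER) 𝓘(ℝ, EP) ρ y (-hamiltonian ΩR.form (f ∘ ρ) y)) := by
    intro η
    obtain ⟨g, hg⟩ := exists_differential_eq (J x) η
    refine ((hg _).symm.trans (hJ.mfderiv_hamiltonian f g x)).trans (Eq.trans ?_ (hg _))
    rw [map_neg, hz']
    refine Eq.trans ?_ (map_neg _ _).symm
    exact congrArg Neg.neg (hρ.mfderiv_hamiltonian f g y).symm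
  exact dual_ext _ _ h1

end Coisotropic

/-! ### Smooth vector fields and products, in charts -/

section Charts

variable {E H : Type*} [NormedAddCommGroup E] [NormedSpace ℝ E] [TopologicalSpace H]
  {I : ModelWithCorners ℝ E H} {X : Type u} [TopologicalSpace X]
  [ChartedSpace H X] [IsManifold I ∞ X]

/-- A vector field whose coordinate expressions are smooth is smooth. -/
theorem isSmoothVectorField_of_chart [IsManifold I 1 X] {V : ∀ x : X, TangentSpace I x}
    (hV : ∀ w : X, ∃ r : E → E, ContDiffOn ℝ ∞ r (extChartAt I w).target ∧
      ∀ z ∈ (chartAt H w).source, mfderiv I 𝓘(ℝ, E) (extChartAt I w) z (V z) =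
        r (extChartAt I w z)) : IsSmoothVectorField V := by
  intro w
  obtain ⟨r, hr, hrV⟩ := hV w
  refine (Bundle.contMDiffAt_section w).2 ?_
  have h1 : ContMDiffOn I 𝓘(ℝ, E) ∞ (fun z => r (extChartAt I w z)) (chartAt H w).source :=
    hr.contMDiffOn.comp contMDiffOn_extChartAt fun z hz =>
      (extChartAt I w).map_source (by rwa [extChartAt_source])
  refine (h1.contMDiffAt ((chartAt H w).open_source.mem_nhds
    (mem_chart_source H w))).congr_of_eventuallyEq ?_
  filter_upwards [(chartAt H w).open_source.mem_nhds (mem_chart_source H w)] with z hz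
  refine Eq.trans ?_ ((congrArg (fun L => L (V z))
    (TangentBundle.continuousLinearMapAt_trivializationAt hz)).trans (hrV z hz))
  exact (congrFun (Bundle.Trivialization.coe_linearMapAt_of_mem (R := ℝ)
    (trivializationAt E (TangentSpace I) w) hz) (V z)).symm

end Charts

section ProductCharts

variable {E E' : Type*} [NormedAddCommGroup E] [NormedSpace ℝ E] 
  [NormedAddCommGroup E'] [NormedSpace ℝ E']
  {S R : Type*} [TopologicalSpace S] [ChartedSpace E S] [IsManifold 𝓘(ℝ, E) ∞ S]
  [TopologicalSpace R] [ChartedSpace E' R] [IsManifold 𝓘(ℝ, E') ∞ R]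

theorem mfderiv_extChartAt_prod (w z : S × R) (h1 : z.1 ∈ (chartAt E w.1).source)
    (h2 : z.2 ∈ (chartAt E' w.2).source) (v : E × E') :
    (mfderiv (𝓘(ℝ, E).prod 𝓘(ℝ, E')) 𝓘(ℝ, E × E') (extChartAt (𝓘(ℝ, E).prod 𝓘(ℝ, E')) w) z v :
      E × E') = ((mfderiv 𝓘(ℝ, E) 𝓘(ℝ, E) (extChartAt 𝓘(ℝ, E) w.1) z.1 v.1 : E),
        (mfderiv 𝓘(ℝ, E') 𝓘(ℝ, E') (extChartAt 𝓘(ℝ, E') w.2) z.2 v.2 : E')) := by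
  have hz : z ∈ (chartAt (ModelProd E E') w).source := by
    rw [prodChartedSpace_chartAt]
    exact ⟨h1, h2⟩
  have h3 : MDifferentiableAt (𝓘(ℝ, E).prod 𝓘(ℝ, E')) 𝓘(ℝ, E × E')
      (extChartAt (𝓘(ℝ, E).prod 𝓘(ℝ, E')) w) z := mdifferentiableAt_extChartAt hz
  have h4 : MDifferentiableAt 𝓘(ℝ, E) 𝓘(ℝ, E) (extChartAt 𝓘(ℝ, E) w.1) z.1 :=
    mdifferentiableAt_extChartAt h1
  have h5 : MDifferentiableAt 𝓘(ℝ, E') 𝓘(ℝ, E') (extChartAt 𝓘(ℝ, E') w.2) z.2 :=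
    mdifferentiableAt_extChartAt h2
  have h6 := (ContinuousLinearMap.fst ℝ E E').hasFDerivAt.hasMFDerivAt.comp z h3.hasMFDerivAt
  have h7 := (ContinuousLinearMap.snd ℝ E E').hasFDerivAt.hasMFDerivAt.comp z h3.hasMFDerivAt
  have h8 := h4.hasMFDerivAt.comp z (hasMFDerivAt_fst (I := 𝓘(ℝ, E)) (I' := 𝓘(ℝ, E')) z)
  have h9 := h5.hasMFDerivAt.comp z (hasMFDerivAt_snd (I := 𝓘(ℝ, E)) (I' := 𝓘(ℝ, E')) z)
  have h10 : ⇑(ContinuousLinearMap.fst ℝ E E') ∘ extChartAt (𝓘(ℝ, E).prod 𝓘(ℝ, E')) w =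
      extChartAt 𝓘(ℝ, E) w.1 ∘ Prod.fst := by
    rw [extChartAt_prod]; rfl
  have h11 : ⇑(ContinuousLinearMap.snd ℝ E E') ∘ extChartAt (𝓘(ℝ, E).prod 𝓘(ℝ, E')) w =
      extChartAt 𝓘(ℝ, E') w.2 ∘ Prod.snd := by
    rw [extChartAt_prod]; rfl
  rw [h10] at h6
  rw [h11] at h7
  exact Prod.ext (congrArg (fun L => L v) (hasMFDerivAt_unique h6 h8))
    (congrArg (fun L => L v) (hasMFDerivAt_unique h7 h9))

end ProductCharts

/-! ### The fields `X̂_f` and their brackets in product charts -/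

section HatFieldChart

variable {ES ER EP : Type*}
  [NormedAddCommGroup ES] [NormedSpace ℝ ES] [FiniteDimensional ℝ ES]
  [NormedAddCommGroup ER] [NormedSpace ℝ ER] [FiniteDimensional ℝ ER]
  [NormedAddCommGroup EP] [NormedSpace ℝ EP]
  {S R P : Type*}
  [TopologicalSpace S] [ChartedSpace ES S] [IsManifold 𝓘(ℝ, ES) ∞ S]
  [TopologicalSpace R] [ChartedSpace ER R] [IsManifold 𝓘(ℝ, ER) ∞ R]
  [TopologicalSpace P] [ChartedSpace EP P]
  {ΩS : SymplecticForm ES S} {ΩR : SymplecticForm ER R}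
  {J : S → P} {ρ : R → P}

/-- The vector field `X̂_f` in a product chart. -/
noncomputable def hatChartField (ΩS : SymplecticForm ES S) (ΩR : SymplecticForm ER R) (J : S → P)
    (ρ : R → P) (w : S × R) (f : C^∞⟮𝓘(ℝ, EP), P; ℝ⟯) (y : ES × ER) : ES × ER :=
  (chartField ΩS.form w.1 (f ∘ J) y.1, -chartField ΩR.form w.2 (f ∘ ρ) y.2)

theorem mfderiv_extChartAt_hatField (hJ : ContMDiff 𝓘(ℝ, ES) 𝓘(ℝ, EP) ∞ J)
    (hρ : ContMDiff 𝓘(ℝ, ER) 𝓘(ℝ, EP) ∞ ρ) (f : C^∞⟮𝓘(ℝ, EP), P; ℝ⟯) (w z : S × R)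
    (hz : z ∈ (chartAt (ModelProd ES ER) w).source) :
    mfderiv (𝓘(ℝ, ES).prod 𝓘(ℝ, ER)) 𝓘(ℝ, ES × ER) (extChartAt (𝓘(ℝ, ES).prod 𝓘(ℝ, ER)) w) z
      (hatField ΩS ΩR J ρ f z) =
        hatChartField ΩS ΩR J ρ w f (extChartAt (𝓘(ℝ, ES).prod 𝓘(ℝ, ER)) w z) := by
  rw [prodChartedSpace_chartAt] at hz
  obtain ⟨h1, h2⟩ := hz
  have h3 := mfderiv_extChartAt_prod w z h1 h2
    ((hamiltonian ΩS.form (f ∘ J) z.1, -hamiltonian ΩR.form (f ∘ ρ) z.2) : ES × ER)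
  rw [← extChartAt_source 𝓘(ℝ, ES)] at h1
  rw [← extChartAt_source 𝓘(ℝ, ER)] at h2
  have h4 : extChartAt (𝓘(ℝ, ES).prod 𝓘(ℝ, ER)) w z =
      (extChartAt 𝓘(ℝ, ES) w.1 z.1, extChartAt 𝓘(ℝ, ER) w.2 z.2) := by
    rw [extChartAt_prod]; rfl
  rw [h4]
  refine (congrArg _ (hatField_eq hJ hρ f z.1 z.2)).trans (h3.trans ?_)
  refine Prod.ext (chartField_extChartAt _ _ _ h1).symm ?_
  exact (map_neg _ _).trans (congrArg Neg.neg (chartField_extChartAt _ _ _ h2).symm)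

theorem extChartAt_prod_target (w : S × R) :
    (extChartAt (𝓘(ℝ, ES).prod 𝓘(ℝ, ER)) w).target =
      (extChartAt 𝓘(ℝ, ES) w.1).target ×ˢ (extChartAt 𝓘(ℝ, ER) w.2).target := by
  rw [extChartAt_prod, PartialEquiv.prod_target]

theorem contDiffOn_hatChartField (hJ : ContMDiff 𝓘(ℝ, ES) 𝓘(ℝ, EP) ∞ J)
    (hρ : ContMDiff 𝓘(ℝ, ER) 𝓘(ℝ, EP) ∞ ρ) (f : C^∞⟮𝓘(ℝ, EP), P; ℝ⟯) (w : S × R) :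
    ContDiffOn ℝ ∞ (hatChartField ΩS ΩR J ρ w f)
      (extChartAt (𝓘(ℝ, ES).prod 𝓘(ℝ, ER)) w).target := by
  rw [extChartAt_prod_target]
  exact ((contDiffOn_chartField ΩS w.1 (f.contMDiff.comp hJ)).comp contDiffOn_fst
    fun y hy => hy.1).prodMk
    ((contDiffOn_chartField ΩR w.2 (f.contMDiff.comp hρ)).comp contDiffOn_snd fun y hy => hy.2).neg

theorem isSmoothVectorField_hatField [IsManifold (𝓘(ℝ, ES).prod 𝓘(ℝ, ER)) 1 (S × R)]
    (hJ : ContMDiff 𝓘(ℝ, ES) 𝓘(ℝ, EP) ∞ J)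
    (hρ : ContMDiff 𝓘(ℝ, ER) 𝓘(ℝ, EP) ∞ ρ) (f : C^∞⟮𝓘(ℝ, EP), P; ℝ⟯) :
    IsSmoothVectorField (hatField ΩS ΩR J ρ f) :=
  isSmoothVectorField_of_chart fun w => ⟨hatChartField ΩS ΩR J ρ w f,
    contDiffOn_hatChartField hJ hρ f w, fun z hz => mfderiv_extChartAt_hatField hJ hρ f w z hz⟩

theorem fderiv_hatChartField (hJ : ContMDiff 𝓘(ℝ, ES) 𝓘(ℝ, EP) ∞ J)
    (hρ : ContMDiff 𝓘(ℝ, ER) 𝓘(ℝ, EP) ∞ ρ) (f : C^∞⟮𝓘(ℝ, EP), P; ℝ⟯) (w : S × R) {y : ES × ER}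
    (hy : y ∈ (extChartAt (𝓘(ℝ, ES).prod 𝓘(ℝ, ER)) w).target) (v : ES × ER) :
    fderiv ℝ (hatChartField ΩS ΩR J ρ w f) y v =
      (fderiv ℝ (chartField ΩS.form w.1 (f ∘ J)) y.1 v.1,
        -fderiv ℝ (chartField ΩR.form w.2 (f ∘ ρ)) y.2 v.2) := by
  rw [extChartAt_prod_target] at hy
  have h1 := (((contDiffOn_chartField ΩS w.1 (f.contMDiff.comp hJ)).contDiffAt
    ((isOpen_extChartAt_target w.1).mem_nhds hy.1)).differentiableAt (by simp)).hasFDerivAt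
  have h2 := (((contDiffOn_chartField ΩR w.2 (f.contMDiff.comp hρ)).contDiffAt
    ((isOpen_extChartAt_target w.2).mem_nhds hy.2)).differentiableAt (by simp)).hasFDerivAt
  have h3 : HasFDerivAt (hatChartField ΩS ΩR J ρ w f) _ y :=
    (h1.comp y hasFDerivAt_fst).prodMk (h2.comp y hasFDerivAt_snd).neg
  rw [h3.fderiv]
  rfl

/-- In a product chart, `[X̂_f, X̂_g] = X̂_h` for `h = -{f, g}`. -/
theorem fderiv_hatChartField_sub {π : PoissonStructure EP P} (hJ : IsPoissonMap ΩS π.opposite J)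
    (hρ : IsPoissonMap ΩR π ρ) (f g : C^∞⟮𝓘(ℝ, EP), P; ℝ⟯) (w : S × R) {y : ES × ER}
    (hy : y ∈ (extChartAt (𝓘(ℝ, ES).prod 𝓘(ℝ, ER)) w).target) :
    fderiv ℝ (hatChartField ΩS ΩR J ρ w g) y (hatChartField ΩS ΩR J ρ w f y) -
      fderiv ℝ (hatChartField ΩS ΩR J ρ w f) y (hatChartField ΩS ΩR J ρ w g y) =
        hatChartField ΩS ΩR J ρ w (π.bracket g f) y := by
  have hf := fun f : C^∞⟮𝓘(ℝ, EP), P; ℝ⟯ => f.contMDiff.comp hJ.1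
  have hf' := fun f : C^∞⟮𝓘(ℝ, EP), P; ℝ⟯ => f.contMDiff.comp hρ.1
  rw [fderiv_hatChartField hJ.1 hρ.1 _ _ hy, fderiv_hatChartField hJ.1 hρ.1 _ _ hy]
  rw [extChartAt_prod_target] at hy
  have h1 := fderiv_chartField_sub ΩS w.1 (hf f) (hf g) (hf (π.bracket g f)) (fun x => by
    rw [hJ.2, Function.comp_apply, π.skew g f]; rfl) hy.1
  -- On this factor the signs of the two fields cancel in the bracket while the result carries a
  -- sign, so `f` and `g` change places. On the first factor the sign of `P^-` has the same effect.
  have h2 := fderiv_chartField_sub ΩR w.2 (hf' g) (hf' f) (hf' (π.bracket g f))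
    (fun x => hρ.2 _ _ _) hy.2
  refine Prod.ext h1 ?_
  change -(fderiv ℝ (chartField ΩR.form w.2 (g ∘ ρ)) y.2 (-chartField ΩR.form w.2 (f ∘ ρ) y.2)) -
    -(fderiv ℝ (chartField ΩR.form w.2 (f ∘ ρ)) y.2 (-chartField ΩR.form w.2 (g ∘ ρ) y.2)) =
    -chartField ΩR.form w.2 (π.bracket g f ∘ ρ) y.2
  rw [← h2, map_neg, map_neg]
  abel

end HatFieldChart

/-! ### Hamiltonian motions on `P` in a chart -/

section LocalPoisson

variable {EP P : Type*} [NormedAddCommGroup EP] [NormedSpace ℝ EP]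
  [TopologicalSpace P] [ChartedSpace EP P]

/-- The Poisson bracket as a bilinear map. -/
noncomputable def PoissonStructure.bilinear (π : PoissonStructure EP P) :
    C^∞⟮𝓘(ℝ, EP), P; ℝ⟯ →ₗ[ℝ] C^∞⟮𝓘(ℝ, EP), P; ℝ⟯ →ₗ[ℝ] C^∞⟮𝓘(ℝ, EP), P; ℝ⟯ :=
  LinearMap.mk₂ ℝ π.bracket π.add_left π.smul_left
    (fun f g h => by rw [π.skew, π.add_left, neg_add, ← π.skew, ← π.skew])
    (fun c f g => by rw [π.skew, π.smul_left, ← smul_neg, ← π.skew])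

variable [FiniteDimensional ℝ EP] [IsManifold 𝓘(ℝ, EP) ∞ P] [T2Space P]

/-- Near a point of a Poisson manifold, the Hamiltonian fields of a finite-dimensional space of
functions that contains a given function and the linear functions of a chart. -/
theorem exists_local_hamiltonian_fields (π : PoissonStructure EP P) (q₀ : P)
    (f : C^∞⟮𝓘(ℝ, EP), P; ℝ⟯) :
    ∃ (G : ((EP →L[ℝ] ℝ) × ℝ) →ₗ[ℝ] C^∞⟮𝓘(ℝ, EP), P; ℝ⟯) (O : Set P)
      (K : EP → ((EP →L[ℝ] ℝ) × ℝ) →L[ℝ] EP) (C : NNReal),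
      IsOpen O ∧ q₀ ∈ O ∧ O ⊆ (chartAt EP q₀).source ∧ G (0, 1) = f ∧
      (∀ p ∈ O, ∀ b, G (b, 0) p = b (extChartAt 𝓘(ℝ, EP) q₀ p)) ∧
      LipschitzOnWith C K (extChartAt 𝓘(ℝ, EP) q₀ '' O) ∧
      ∀ p ∈ O, ∀ a b, b (K (extChartAt 𝓘(ℝ, EP) q₀ p) a) = -π.bracket (G a) (G (b, 0)) p := by
  obtain ⟨lin, O, hO, hq, hOs, hlin⟩ := exists_smooth_extension_linear (E := EP) q₀
  set φ := extChartAt 𝓘(ℝ, EP) q₀ with hφ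
  -- The coordinate functions already generate the span along `M`. The summand `ℝ` adds the given
  -- `f`, so that the flow of `X̂_f` itself becomes a motion of the model.
  let G : ((EP →L[ℝ] ℝ) × ℝ) →ₗ[ℝ] C^∞⟮𝓘(ℝ, EP), P; ℝ⟯ :=
    lin.coprod (LinearMap.toSpanSingleton ℝ _ f)
  have hGlin : ∀ b, G (b, 0) = lin b := fun b => by simp [G]
  let e := finBasis ℝ EP
  let ℓ : Fin (finrank ℝ EP) → EP →L[ℝ] ℝ := fun i => LinearMap.toContinuousLinearMap (e.coord i)
  let ev : P → C^∞⟮𝓘(ℝ, EP), P; ℝ⟯ →ₗ[ℝ] ℝ := fun p =>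
    { toFun := fun g => g p, map_add' := fun _ _ => rfl, map_smul' := fun _ _ => rfl }
  -- `K u a` is the Hamiltonian vector of `G a` for `P^-`; its coordinates are brackets with the
  -- coordinate functions.
  let K : EP → ((EP →L[ℝ] ℝ) × ℝ) →L[ℝ] EP := fun u => LinearMap.toContinuousLinearMap
    (∑ i, (-(ev (φ.symm u) ∘ₗ π.bilinear.flip (lin (ℓ i)) ∘ₗ G)).smulRight (e i))
  have hK : ∀ u a, K u a = ∑ i, (-π.bracket (G a) (lin (ℓ i)) (φ.symm u)) • e i := by
    intro u a
    change (∑ i, (-(ev (φ.symm u) ∘ₗ π.bilinear.flip (lin (ℓ i)) ∘ₗ G)).smulRight (e i)) a = _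
    rw [LinearMap.sum_apply]
    rfl
  have hKs : ContDiffOn ℝ ∞ K φ.target := by
    refine contDiffOn_clm_apply.2 fun a => ?_
    simp only [hK]
    refine ContDiffOn.sum fun i _ => ContDiffOn.smul (ContDiffOn.neg ?_) contDiffOn_const
    exact contDiffOn_comp_extChartAt_symm (π.bracket (G a) (lin (ℓ i))).contMDiff q₀
  have hqs : q₀ ∈ φ.source := mem_extChartAt_source q₀
  obtain ⟨C, t, ht, hC⟩ := (contDiffAt_infty.1 (hKs.contDiffAt
    ((isOpen_extChartAt_target q₀).mem_nhds (φ.map_source hqs))) 1).exists_lipschitzOnWith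
  have hO' : IsOpen (φ.source ∩ φ ⁻¹' interior t) :=
    (continuousOn_extChartAt q₀).isOpen_inter_preimage (isOpen_extChartAt_source q₀)
      isOpen_interior
  refine ⟨G, O ∩ (φ.source ∩ φ ⁻¹' interior t), K, C, hO.inter hO',
    ⟨hq, hqs, mem_interior_iff_mem_nhds.2 ht⟩, inter_subset_left.trans hOs, by simp [G],
    fun p hp b => by rw [hGlin]; exact hlin p hp.1 b, hC.mono ?_, fun p hp a b => ?_⟩
  · rintro _ ⟨p, hp, rfl⟩
    exact interior_subset hp.2.2
  · have h1 : b = ∑ i, b (e i) • ℓ i := by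
      ext v
      have h2 : b (∑ i, e.repr v i • e i) = ∑ i, e.repr v i • b (e i) := by
        rw [map_sum]
        simp only [map_smul]
      rw [e.sum_repr] at h2
      simp [h2, ℓ, mul_comm]
    have h2 : π.bracket (G a) (lin b) p = ∑ i, b (e i) * π.bracket (G a) (lin (ℓ i)) p := by
      have h3 : (ev p ∘ₗ π.bilinear (G a) ∘ₗ lin) b =
          ∑ i, b (e i) • (ev p ∘ₗ π.bilinear (G a) ∘ₗ lin) (ℓ i) := by
        conv_lhs => rw [h1]
        rw [map_sum]
        simp only [map_smul]
      exact h3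
    rw [hK, hGlin, φ.left_inv hp.2.1, h2, map_sum, ← Finset.sum_neg_distrib]
    refine Finset.sum_congr rfl fun i _ => ?_
    rw [map_smul, smul_eq_mul]
    ring

variable {E S : Type*} [NormedAddCommGroup E] [NormedSpace ℝ E] [FiniteDimensional ℝ E]
  [TopologicalSpace S] [ChartedSpace E S] [IsManifold 𝓘(ℝ, E) ∞ S]
  {Ω : SymplecticForm E S} {π : PoissonStructure EP P} {J : S → P}

theorem differentiableAt_in_charts (hJ : ContMDiff 𝓘(ℝ, E) 𝓘(ℝ, EP) ∞ J) (q₀ : P) (x₀ : S) {y : E}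
    (hy : y ∈ (extChartAt 𝓘(ℝ, E) x₀).target)
    (hyq : J ((extChartAt 𝓘(ℝ, E) x₀).symm y) ∈ (chartAt EP q₀).source) :
    DifferentiableAt ℝ (fun y => extChartAt 𝓘(ℝ, EP) q₀ (J ((extChartAt 𝓘(ℝ, E) x₀).symm y))) y := by
  have h1 := contMDiffAt_extChartAt_symm (I := 𝓘(ℝ, E)) x₀ hy
  have h2 : ContMDiffAt 𝓘(ℝ, EP) 𝓘(ℝ, EP) ∞ (extChartAt 𝓘(ℝ, EP) q₀)
      (J ((extChartAt 𝓘(ℝ, E) x₀).symm y)) := contMDiffAt_extChartAt' hyq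
  exact (h2.comp y (hJ.contMDiffAt.comp y h1)).contDiffAt.differentiableAt (by simp)

/-- A Poisson map sends Hamiltonian vector fields to Hamiltonian vector fields, in charts. -/
theorem IsPoissonMap.apply_fderiv_chartField (hJ : IsPoissonMap Ω π J) {q₀ : P} {O : Set P}
    (hO : IsOpen O) (hOs : O ⊆ (chartAt EP q₀).source) (x₀ : S) {y : E}
    (hy : y ∈ (extChartAt 𝓘(ℝ, E) x₀).target) (hyO : J ((extChartAt 𝓘(ℝ, E) x₀).symm y) ∈ O)
    {b : EP →L[ℝ] ℝ} {g : C^∞⟮𝓘(ℝ, EP), P; ℝ⟯}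
    (hg : ∀ p ∈ O, g p = b (extChartAt 𝓘(ℝ, EP) q₀ p)) (f : C^∞⟮𝓘(ℝ, EP), P; ℝ⟯) :
    b (fderiv ℝ (fun y => extChartAt 𝓘(ℝ, EP) q₀ (J ((extChartAt 𝓘(ℝ, E) x₀).symm y))) y
      (chartField Ω.form x₀ (f ∘ J) y)) = π.bracket f g (J ((extChartAt 𝓘(ℝ, E) x₀).symm y)) := by
  rw [← hJ.2, ← localFormL_chartField_chartField _ _ _ _ hy,
    localFormL_chartField Ω x₀ (g.contMDiff.comp hJ.1) hy]
  have h1 : HasFDerivAt _ _ y :=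
    b.hasFDerivAt.comp y (differentiableAt_in_charts hJ.1 q₀ x₀ hy (hOs hyO)).hasFDerivAt
  have h2 : (fun y => (g ∘ J) ((extChartAt 𝓘(ℝ, E) x₀).symm y)) =ᶠ[𝓝 y]
      ⇑b ∘ fun y => extChartAt 𝓘(ℝ, EP) q₀ (J ((extChartAt 𝓘(ℝ, E) x₀).symm y)) := by
    have h3 : ContinuousAt (fun y => J ((extChartAt 𝓘(ℝ, E) x₀).symm y)) y :=
      (hJ.1.contMDiffAt.comp y (contMDiffAt_extChartAt_symm (I := 𝓘(ℝ, E)) x₀ hy)).continuousAt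
    filter_upwards [h3.eventually_mem (hO.mem_nhds hyO)] with y' hy' using hg _ hy'
  rw [h2.fderiv_eq, h1.fderiv]
  rfl

end LocalPoisson

/-- A bilinear map on a finite-dimensional space, as a continuous bilinear map. -/
noncomputable def continuousBilinear {F F' : Type*} [NormedAddCommGroup F] [NormedSpace ℝ F]
    [FiniteDimensional ℝ F] [NormedAddCommGroup F'] [NormedSpace ℝ F'] (B : F →ₗ[ℝ] F →ₗ[ℝ] F') :
    F →L[ℝ] F →L[ℝ] F' :=
  LinearMap.toContinuousLinearMap
    ((LinearMap.toContinuousLinearMap (𝕜 := ℝ) (E := F) (F' := F')).toLinearMap ∘ₗ B)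

theorem continuousOn_continuousBilinear {X F F' : Type*} [TopologicalSpace X]
    [NormedAddCommGroup F] [NormedSpace ℝ F] [FiniteDimensional ℝ F] [NormedAddCommGroup F']
    [NormedSpace ℝ F'] {B : X → F →ₗ[ℝ] F →ₗ[ℝ] F'} {s : Set X}
    (h : ∀ a b, ContinuousOn (fun x => B x a b) s) :
    ContinuousOn (fun x => continuousBilinear (B x)) s :=
  continuousOn_clm_apply.2 fun a => continuousOn_clm_apply.2 fun b => h a b

/-! ### Coordinates of differentials on `P` -/

section ChartCoefficient

variable {EP P : Type*} [NormedAddCommGroup EP] [NormedSpace ℝ EP] [FiniteDimensional ℝ EP]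
  [TopologicalSpace P] [ChartedSpace EP P]

/-- The coordinates in a chart of the differential of a function. -/
noncomputable def chartCoefficient (q₀ q : P) : C^∞⟮𝓘(ℝ, EP), P; ℝ⟯ →ₗ[ℝ] EP →L[ℝ] ℝ where
  toFun f := LinearMap.toContinuousLinearMap ((differential 𝓘(ℝ, EP) f q : EP →ₗ[ℝ] ℝ) ∘ₗ
    (mfderiv 𝓘(ℝ, EP) 𝓘(ℝ, EP) (extChartAt 𝓘(ℝ, EP) q₀).symm (extChartAt 𝓘(ℝ, EP) q₀ q) :
      EP →L[ℝ] EP).toLinearMap)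
  map_add' f g := by
    ext v
    exact LinearMap.congr_fun (differential_add f g q) _
  map_smul' c f := by
    ext v
    exact LinearMap.congr_fun (differential_smul c f q) _

variable [IsManifold 𝓘(ℝ, EP) ∞ P]

theorem chartCoefficient_mfderiv (q₀ : P) {q : P} (hq : q ∈ (chartAt EP q₀).source)
    (f : C^∞⟮𝓘(ℝ, EP), P; ℝ⟯) (v : TangentSpace 𝓘(ℝ, EP) q) :
    chartCoefficient q₀ q f (mfderiv 𝓘(ℝ, EP) 𝓘(ℝ, EP) (extChartAt 𝓘(ℝ, EP) q₀) q v) =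
      differential 𝓘(ℝ, EP) f q v :=
  congrArg (differential 𝓘(ℝ, EP) f q) (mfderiv_extChartAt_symm_apply q₀ hq v)

/-- A derivative taken in one fixed chart varies continuously with `q`, which gives the continuity
of the structure functions. -/
theorem chartCoefficient_eq_fderiv (q₀ : P) {q : P} (hq : q ∈ (chartAt EP q₀).source)
    (f : C^∞⟮𝓘(ℝ, EP), P; ℝ⟯) :
    chartCoefficient q₀ q f =
      fderiv ℝ (fun y => f ((extChartAt 𝓘(ℝ, EP) q₀).symm y)) (extChartAt 𝓘(ℝ, EP) q₀ q) := by
  ext u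
  obtain ⟨v, rfl⟩ := mfderiv_extChartAt_surjective (I := 𝓘(ℝ, EP)) q₀ hq u
  exact (chartCoefficient_mfderiv q₀ hq f v).trans
    (differential_eq_fderiv_comp_extChartAt f.contMDiff q₀ hq v)

end ChartCoefficient

/-! ### The local models of the fields `X̂_f` -/

section Model

variable {ES ER EP : Type*}
  [NormedAddCommGroup ES] [NormedSpace ℝ ES] [FiniteDimensional ℝ ES]
  [NormedAddCommGroup ER] [NormedSpace ℝ ER] [FiniteDimensional ℝ ER]
  [NormedAddCommGroup EP] [NormedSpace ℝ EP] [FiniteDimensional ℝ EP]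
  {S R P : Type*}
  [TopologicalSpace S] [ChartedSpace ES S] [IsManifold 𝓘(ℝ, ES) ∞ S]
  [TopologicalSpace R] [ChartedSpace ER R] [IsManifold 𝓘(ℝ, ER) ∞ R]
  [TopologicalSpace P] [ChartedSpace EP P] [IsManifold 𝓘(ℝ, EP) ∞ P] [T2Space P]
  {ΩS : SymplecticForm ES S} {ΩR : SymplecticForm ER R} {π : PoissonStructure EP P}
  {J : S → P} {ρ : R → P}

/-- The maps `J` and `ρ` take the same values along a curve whose velocity is a time-dependent
combination of the fields `X̂_f`, if they do at its starting point. -/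
theorem eq_along_hatChartField (hJ : IsPoissonMap ΩS π.opposite J) (hρ : IsPoissonMap ΩR π ρ)
    {F : Type*} [NormedAddCommGroup F] [NormedSpace ℝ F] (w : S × R) {q₀ : P}
    {G : F → C^∞⟮𝓘(ℝ, EP), P; ℝ⟯} {e : (EP →L[ℝ] ℝ) → F} {O : Set P} {K : EP → F →L[ℝ] EP} {C : NNReal} (hO : IsOpen O)
    (hOs : O ⊆ (chartAt EP q₀).source)
    (hlin : ∀ p ∈ O, ∀ b, G (e b) p = b (extChartAt 𝓘(ℝ, EP) q₀ p))
    (hC : LipschitzOnWith C K (extChartAt 𝓘(ℝ, EP) q₀ '' O))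
    (hK : ∀ p ∈ O, ∀ a b,
      b (K (extChartAt 𝓘(ℝ, EP) q₀ p) a) = -π.bracket (G a) (G (e b)) p)
    {γ : ℝ → ES × ER} {a : ℝ → F} (ha : ContinuousOn a (Icc 0 1))
    (hγ : ∀ t ∈ Icc (0 : ℝ) 1, (γ t).1 ∈ (extChartAt 𝓘(ℝ, ES) w.1).target ∧
      (γ t).2 ∈ (extChartAt 𝓘(ℝ, ER) w.2).target ∧
      J ((extChartAt 𝓘(ℝ, ES) w.1).symm (γ t).1) ∈ O ∧
      ρ ((extChartAt 𝓘(ℝ, ER) w.2).symm (γ t).2) ∈ O)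
    (hγ' : ∀ t ∈ Icc (0 : ℝ) 1,
      HasDerivWithinAt γ (hatChartField ΩS ΩR J ρ w (G (a t)) (γ t)) (Icc 0 1) t)
    (h0 : J ((extChartAt 𝓘(ℝ, ES) w.1).symm (γ 0).1) =
      ρ ((extChartAt 𝓘(ℝ, ER) w.2).symm (γ 0).2)) {t : ℝ} (ht : t ∈ Icc (0 : ℝ) 1) :
    J ((extChartAt 𝓘(ℝ, ES) w.1).symm (γ t).1) =
      ρ ((extChartAt 𝓘(ℝ, ER) w.2).symm (γ t).2) := by
  set φ := extChartAt 𝓘(ℝ, EP) q₀ with hφ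
  have hdual : ∀ u v : EP, (∀ b : EP →L[ℝ] ℝ, b u = b v) → u = v := fun u v h =>
    sub_eq_zero.1 ((Module.forall_dual_apply_eq_zero_iff ℝ _).1 fun η => by
      rw [map_sub, sub_eq_zero]
      exact h (LinearMap.toContinuousLinearMap η))
  have hu : ∀ t ∈ Icc (0 : ℝ) 1,
      HasDerivWithinAt (fun t => φ (J ((extChartAt 𝓘(ℝ, ES) w.1).symm (γ t).1)))
        (K (φ (J ((extChartAt 𝓘(ℝ, ES) w.1).symm (γ t).1))) (a t)) (Icc 0 1) t := by
    intro t ht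
    obtain ⟨h1, -, h2, -⟩ := hγ t ht
    have h3 := (differentiableAt_in_charts hJ.1 q₀ w.1 h1 (hOs h2)).hasFDerivAt
    refine (h3.comp_hasDerivWithinAt t (hasFDerivAt_fst.comp_hasDerivWithinAt t
      (hγ' t ht))).congr_deriv (hdual _ _ fun b => ?_)
    have hb := fun p hp => hlin p hp b
    rw [hK _ h2]
    exact hJ.apply_fderiv_chartField hO hOs w.1 h1 h2 hb (G (a t))
  have hv : ∀ t ∈ Icc (0 : ℝ) 1,
      HasDerivWithinAt (fun t => φ (ρ ((extChartAt 𝓘(ℝ, ER) w.2).symm (γ t).2)))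
        (K (φ (ρ ((extChartAt 𝓘(ℝ, ER) w.2).symm (γ t).2))) (a t)) (Icc 0 1) t := by
    intro t ht
    obtain ⟨-, h1, -, h2⟩ := hγ t ht
    have h3 := (differentiableAt_in_charts hρ.1 q₀ w.2 h1 (hOs h2)).hasFDerivAt
    refine (h3.comp_hasDerivWithinAt t (hasFDerivAt_snd.comp_hasDerivWithinAt t
      (hγ' t ht))).congr_deriv (hdual _ _ fun b => ?_)
    have hb := fun p hp => hlin p hp b
    rw [hK _ h2, ← hρ.apply_fderiv_chartField hO hOs w.2 h1 h2 hb (G (a t)), ← map_neg,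
      ← map_neg]
    rfl
  obtain ⟨B, hB⟩ := isCompact_Icc.bddAbove_image ha.norm
  have hlip : ∀ t ∈ Ico (0 : ℝ) 1,
      LipschitzOnWith (C * B.toNNReal) (fun u => K u (a t)) (φ '' O) := by
    intro t ht
    refine LipschitzOnWith.of_dist_le_mul fun u hu v hv => ?_
    have h1 := hC.dist_le_mul u hu v hv
    have h2 : ‖a t‖ ≤ B.toNNReal :=
      (hB (mem_image_of_mem _ (Ico_subset_Icc_self ht))).trans (Real.le_coe_toNNReal B)
    rw [dist_eq_norm, ← sub_apply]
    refine ((K u - K v).le_opNorm (a t)).trans ?_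
    rw [dist_eq_norm] at h1
    calc ‖K u - K v‖ * ‖a t‖ ≤ (C * dist u v) * B.toNNReal := by gcongr
      _ = _ := by push_cast; ring
  have hIci : ∀ {f : ℝ → EP} {f' : EP} {t : ℝ}, t ∈ Ico (0 : ℝ) 1 →
      HasDerivWithinAt f f' (Icc 0 1) t → HasDerivWithinAt f f' (Ici t) t := fun ht h =>
    h.mono_of_mem_nhdsWithin (Icc_mem_nhdsGE_of_mem ht)
  -- Both image curves solve `u' = K u (a t)` in the chart of `P`, with a Lipschitz constant uniform
  -- in `t` because `a` is bounded, and they start at the same point.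
  have key := ODE_solution_unique_of_mem_Icc_right (v := fun t u => K u (a t))
    (s := fun _ => φ '' O) hlip
    (fun t ht => (hu t ht).continuousWithinAt)
    (fun t ht => hIci ht (hu t (Ico_subset_Icc_self ht)))
    (fun t ht => mem_image_of_mem _ (hγ t (Ico_subset_Icc_self ht)).2.2.1)
    (fun t ht => (hv t ht).continuousWithinAt)
    (fun t ht => hIci ht (hv t (Ico_subset_Icc_self ht)))
    (fun t ht => mem_image_of_mem _ (hγ t (Ico_subset_Icc_self ht)).2.2.2)
    (by simp only [h0])
  have hOs' : O ⊆ φ.source := by rw [hφ, extChartAt_source]; exact hOs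
  exact φ.injOn (hOs' (hγ t ht).2.2.1) (hOs' (hγ t ht).2.2.2) (key ht)

/-- A finite-dimensional family of functions that contains the linear functions of a chart of `P`
gives a local model. -/
theorem exists_localModel_of_family [IsManifold (𝓘(ℝ, ES).prod 𝓘(ℝ, ER)) ∞ (S × R)]
    (hJ : IsPoissonMap ΩS π.opposite J) (hρ : IsPoissonMap ΩR π ρ) {w : S × R}
    (hw : w ∈ fibreProduct J ρ) {F : Type*} [NormedAddCommGroup F] [NormedSpace ℝ F]
    [FiniteDimensional ℝ F] {q₀ : P} {G : F →ₗ[ℝ] C^∞⟮𝓘(ℝ, EP), P; ℝ⟯}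
    {e : (EP →L[ℝ] ℝ) →L[ℝ] F} {O : Set P} {K : EP → F →L[ℝ] EP} {C : NNReal} (hO : IsOpen O)
    (hq : J w.1 ∈ O) (hOs : O ⊆ (chartAt EP q₀).source)
    (hGlin : ∀ p ∈ O, ∀ b, G (e b) p = b (extChartAt 𝓘(ℝ, EP) q₀ p))
    (hC : LipschitzOnWith C K (extChartAt 𝓘(ℝ, EP) q₀ '' O))
    (hK : ∀ p ∈ O, ∀ a b,
      b (K (extChartAt 𝓘(ℝ, EP) q₀ p) a) = -π.bracket (G a) (G (e b)) p) :
    ∃ L : LocalModel (𝓘(ℝ, ES).prod 𝓘(ℝ, ER)) (hatSpan EP ΩS ΩR J ρ) (fibreProduct J ρ)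
      (fun f : C^∞⟮𝓘(ℝ, EP), P; ℝ⟯ => hatField ΩS ΩR J ρ f) F w, ∀ b, L.index b = G b := by
  set φ := extChartAt (𝓘(ℝ, ES).prod 𝓘(ℝ, ER)) w with hφ
  set φS := extChartAt 𝓘(ℝ, ES) w.1 with hφS
  set φR := extChartAt 𝓘(ℝ, ER) w.2 with hφR
  have htarget : ∀ y, y ∈ φ.target ↔ y.1 ∈ φS.target ∧ y.2 ∈ φR.target := fun y => by
    rw [hφ, extChartAt_prod_target]; rfl
  have hsymm : ∀ y, φ.symm y = (φS.symm y.1, φR.symm y.2) := fun y => by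
    rw [hφ, extChartAt_prod]; rfl
  have hsrc : ∀ z, z ∈ φ.source ↔ z ∈ (chartAt (ModelProd ES ER) w).source := fun z => by
    rw [hφ, extChartAt_source]
  have hws : w ∈ φ.source := mem_extChartAt_source w
  -- Both images are required to lie in `O`, since points of `U` need not belong to the fibre
  -- product.
  let U : Set (ES × ER) := φ.target ∩ φ.symm ⁻¹' {z | J z.1 ∈ O ∧ ρ z.2 ∈ O}
  have hU : IsOpen U := (continuousOn_extChartAt_symm w).isOpen_inter_preimage
    (isOpen_extChartAt_target w) ((hO.preimage (hJ.1.continuous.comp continuous_fst)).inter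
      (hO.preimage (hρ.1.continuous.comp continuous_snd)))
  let anchor : ES × ER → F →L[ℝ] ES × ER := fun y =>
    LinearMap.toContinuousLinearMap
      ((mfderiv (𝓘(ℝ, ES).prod 𝓘(ℝ, ER)) 𝓘(ℝ, ES × ER) φ (φ.symm y) :
        ES × ER →L[ℝ] ES × ER).toLinearMap ∘ₗ
        (hatFieldLinear ΩS ΩR hJ.1 hρ.1 (φ.symm y) : _ →ₗ[ℝ] ES × ER) ∘ₗ G)
  have hanchor : ∀ y ∈ φ.target, ∀ a, anchor y a = hatChartField ΩS ΩR J ρ w (G a) y := by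
    intro y hy a
    have h1 := mfderiv_extChartAt_hatField (ΩS := ΩS) (ΩR := ΩR) hJ.1 hρ.1 (G a) w (φ.symm y)
      ((hsrc _).1 (φ.map_target hy))
    rw [← hφ, φ.right_inv hy] at h1
    exact h1
  have hanchor' : ∀ z, φ z ∈ U → z ∈ (chartAt (ModelProd ES ER) w).source → ∀ a,
      mfderiv (𝓘(ℝ, ES).prod 𝓘(ℝ, ER)) 𝓘(ℝ, ES × ER) φ z (hatField ΩS ΩR J ρ (G a) z) =
        anchor (φ z) a := by
    intro z hz hzs a
    rw [hanchor _ hz.1]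
    exact mfderiv_extChartAt_hatField hJ.1 hρ.1 (G a) w z hzs
  -- Only the differential of `g` at `J z.1` matters on the fibre product, so `g` may be exchanged
  -- for the linear coordinate function with that differential.
  have hcoeff : ∀ z, J z.1 ∈ O → z ∈ fibreProduct J ρ → ∀ g : C^∞⟮𝓘(ℝ, EP), P; ℝ⟯,
      hatField ΩS ΩR J ρ g z = hatField ΩS ΩR J ρ (G (e (chartCoefficient q₀ (J z.1) g))) z := by
    intro z hzO hzM g
    refine hatField_congr hJ.1 hρ.1 hzM (LinearMap.ext fun v => ?_)
    rw [differential_eq_of_eqOn_chart hO hOs (fun p hp => hGlin p hp _) hzO]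
    exact (chartCoefficient_mfderiv q₀ (hOs hzO) g v).symm
  have hsmooth : ContDiffOn ℝ ∞ anchor U := contDiffOn_clm_apply.2 fun a =>
    ((contDiffOn_hatChartField hJ.1 hρ.1 (G a) w).congr fun y hy => hanchor y hy a).mono
      inter_subset_left
  -- The function `{G b, G a}` need not belong to the family. It is replaced by its linearisation at
  -- the image point, which is legitimate on the fibre product; so involutivity is claimed on the
  -- locus only.
  let br : ES × ER → F →L[ℝ] F →L[ℝ] F := fun y =>
    continuousBilinear ((π.bilinear.flip.compl₁₂ G G).compr₂
      (e.toLinearMap ∘ₗ chartCoefficient q₀ (J (φ.symm y).1)))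
  have hbr : ∀ y a b,
      br y a b = e (chartCoefficient q₀ (J (φ.symm y).1) (π.bracket (G b) (G a))) :=
    fun y a b => rfl
  have hbrc : ContinuousOn br U := by
    refine continuousOn_continuousBilinear fun a b => e.continuous.comp_continuousOn ?_
    have h1 : ContinuousOn (fderiv ℝ fun u =>
        π.bracket (G b) (G a) ((extChartAt 𝓘(ℝ, EP) q₀).symm u))
        (extChartAt 𝓘(ℝ, EP) q₀).target :=
      (contDiffOn_comp_extChartAt_symm (π.bracket (G b) (G a)).contMDiff q₀).continuousOn_fderiv_of_isOpen
        (isOpen_extChartAt_target q₀) (by simp)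
    have h2 : ContinuousOn (fun y => J (φ.symm y).1) U :=
      hJ.1.continuous.comp_continuousOn (continuous_fst.comp_continuousOn
        ((continuousOn_extChartAt_symm w).mono inter_subset_left))
    have hOs' : O ⊆ (extChartAt 𝓘(ℝ, EP) q₀).source := by rw [extChartAt_source]; exact hOs
    refine (h1.comp ((continuousOn_extChartAt q₀).comp h2 fun y hy => hOs' hy.2.1)
      fun y hy => (extChartAt 𝓘(ℝ, EP) q₀).map_source (hOs' hy.2.1)).congr fun y hy => ?_
    exact chartCoefficient_eq_fderiv q₀ (hOs hy.2.1) _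
  refine ⟨{
    domain := U
    isOpen_domain := hU
    locus := φ.symm ⁻¹' fibreProduct J ρ
    anchor := anchor
    smooth := hsmooth
    bracket := br
    continuousOn_bracket := hbrc
    bracket_spec := fun y hy hyM a b => ?_
    invariant := fun γ a ha hγ hγ' h0 t ht => ?_
    domain_subset := inter_subset_left
    mem_domain := ⟨φ.map_source hws, ?_⟩
    mem_locus_iff := fun y hy => Iff.rfl
    mem_iff := fun z hz hzs hzM v => ?_
    index := G
    anchor_eq := hanchor' }, fun b => rfl⟩
  · have h1 := (hsmooth.contDiffAt (hU.mem_nhds hy)).differentiableAt (by simp)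
    have h2 : ∀ a v, fderiv ℝ anchor y v a =
        fderiv ℝ (hatChartField ΩS ΩR J ρ w (G a)) y v := by
      intro a v
      have h3 : HasFDerivAt (fun y => anchor y a) _ y :=
        h1.hasFDerivAt.clm_apply (hasFDerivAt_const a y)
      have h4 : (fun y => anchor y a) =ᶠ[𝓝 y] hatChartField ΩS ΩR J ρ w (G a) := by
        filter_upwards [hU.mem_nhds hy] with y' hy' using hanchor y' hy'.1 a
      rw [← h4.fderiv_eq, h3.fderiv]
      simp
    rw [h2, h2, hanchor y hy.1, hanchor y hy.1,
      fderiv_hatChartField_sub hJ hρ (G a) (G b) w hy.1, hanchor y hy.1, hbr]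
    have h5 := hcoeff (φ.symm y) hy.2.1 hyM (π.bracket (G b) (G a))
    have hys := (hsrc _).1 (φ.map_target hy.1)
    have h6 := fun g : C^∞⟮𝓘(ℝ, EP), P; ℝ⟯ => mfderiv_extChartAt_hatField (ΩS := ΩS) (ΩR := ΩR)
      hJ.1 hρ.1 g w (φ.symm y) hys
    rw [← hφ, φ.right_inv hy.1] at h6
    rw [← h6, ← h6, h5]
  · have h1 : ∀ t ∈ Icc (0 : ℝ) 1, (γ t).1 ∈ φS.target ∧ (γ t).2 ∈ φR.target ∧
        J (φS.symm (γ t).1) ∈ O ∧ ρ (φR.symm (γ t).2) ∈ O := by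
      intro t ht
      obtain ⟨h2, h3⟩ := hγ t ht
      rw [mem_preimage, hsymm] at h3
      exact ⟨((htarget _).1 h2).1, ((htarget _).1 h2).2, h3⟩
    change φ.symm (γ 0) ∈ fibreProduct J ρ at h0
    change φ.symm (γ t) ∈ fibreProduct J ρ
    rw [hsymm] at h0 ⊢
    exact eq_along_hatChartField hJ hρ w hO hOs hGlin hC hK ha h1
      (fun t ht => (hγ' t ht).congr_deriv (hanchor _ (hγ t ht).1 _)) h0 ht
  · rw [mem_preimage, φ.left_inv hws]
    exact ⟨hq, by rw [show ρ w.2 = J w.1 from hw.symm]; exact hq⟩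
  · have hzO : J z.1 ∈ O := by
      have := hz.2.1
      rwa [φ.left_inv ((hsrc z).2 hzs)] at this
    rw [mem_hatSpan_iff hJ.1 hρ.1]
    constructor
    · rintro ⟨g, rfl⟩
      rw [hcoeff z hzO hzM g]
      exact ⟨_, (hanchor' z hz hzs _).symm⟩
    · rintro ⟨a, ha⟩
      exact ⟨G a, mfderiv_extChartAt_injective (I := 𝓘(ℝ, ES).prod 𝓘(ℝ, ER)) w hzs
        ((hanchor' z hz hzs a).trans ha)⟩

/-- The vector fields `X̂_f` have local models. -/
theorem exists_localModel_hatField [IsManifold (𝓘(ℝ, ES).prod 𝓘(ℝ, ER)) ∞ (S × R)]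
    (hJ : IsPoissonMap ΩS π.opposite J) (hρ : IsPoissonMap ΩR π ρ) {w : S × R}
    (hw : w ∈ fibreProduct J ρ) (f : C^∞⟮𝓘(ℝ, EP), P; ℝ⟯) :
    ∃ (L : LocalModel (𝓘(ℝ, ES).prod 𝓘(ℝ, ER)) (hatSpan EP ΩS ΩR J ρ) (fibreProduct J ρ)
      (fun f : C^∞⟮𝓘(ℝ, EP), P; ℝ⟯ => hatField ΩS ΩR J ρ f) ((EP →L[ℝ] ℝ) × ℝ) w)
      (b : (EP →L[ℝ] ℝ) × ℝ), L.index b = f := by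
  obtain ⟨G, O, K, C, hO, hq, hOs, hGf, hGlin, hC, hK⟩ :=
    exists_local_hamiltonian_fields π (J w.1) f
  obtain ⟨L, hL⟩ := exists_localModel_of_family
    (e := ContinuousLinearMap.inl ℝ (EP →L[ℝ] ℝ) ℝ) hJ hρ hw hO hq hOs hGlin hC hK
  exact ⟨L, (0, 1), (hL _).trans hGf⟩

end Model

/-! ### Kernels of pulled-back forms -/

section Immersed

variable {E H : Type*} [NormedAddCommGroup E] [NormedSpace ℝ E] [TopologicalSpace H]
  {I : ModelWithCorners ℝ E H} {X : Type u} [TopologicalSpace X] [ChartedSpace H X]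

/-- The kernel of the pull-back of a form to an immersed submanifold is `T ∩ T^⊥`. -/
theorem ImmersedSubmanifold.map_ker_pullback (N : ImmersedSubmanifold I X) {Ω : FormField I X}
    (hΩ : ∀ x, (Ω x).IsAlt) (n : N.Carrier) :
    (LinearMap.ker (N.pullback Ω n)).map (N.inclDeriv n) =
      N.tangent n ⊓ (Ω (N.incl n)).orthogonal (N.tangent n) := by
  ext v
  constructor
  · rintro ⟨u, hu, rfl⟩
    refine ⟨⟨u, rfl⟩, ?_⟩
    rintro _ ⟨u', rfl⟩
    have h1 : Ω (N.incl n) (N.inclDeriv n u) (N.inclDeriv n u') = 0 :=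
      LinearMap.congr_fun (LinearMap.mem_ker.1 hu) u'
    exact (hΩ (N.incl n)).isRefl _ _ h1
  · rintro ⟨⟨u, rfl⟩, hu⟩
    refine ⟨u, LinearMap.mem_ker.2 (LinearMap.ext fun u' => ?_), rfl⟩
    exact (hΩ (N.incl n)).isRefl _ _ (hu _ ⟨u', rfl⟩)

end Immersed

theorem prodForm_isAlt {E E' : Type*} [NormedAddCommGroup E] [NormedSpace ℝ E]
    [NormedAddCommGroup E'] [NormedSpace ℝ E']
    {S S' : Type*} [TopologicalSpace S] [ChartedSpace E S] [TopologicalSpace S']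
    [ChartedSpace E' S'] {Ω : FormField 𝓘(ℝ, E) S} {Ω' : FormField 𝓘(ℝ, E') S'}
    (h : ∀ x, (Ω x).IsAlt) (h' : ∀ y, (Ω' y).IsAlt) (z : S × S') : (prodForm Ω Ω' z).IsAlt := by
  rintro ⟨v, w⟩
  refine (prodForm_apply Ω Ω' z.1 z.2 v v w w).trans ?_
  rw [h z.1 v, h' z.2 w, add_zero]

/-! ### The two foliations of the fibre product -/

section Foliation

variable {ES ER EP : Type*}
  [NormedAddCommGroup ES] [NormedSpace ℝ ES] [FiniteDimensional ℝ ES]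
  [NormedAddCommGroup ER] [NormedSpace ℝ ER] [FiniteDimensional ℝ ER]
  [NormedAddCommGroup EP] [NormedSpace ℝ EP] [FiniteDimensional ℝ EP]
  {S R P : Type*}
  [TopologicalSpace S] [ChartedSpace ES S] [IsManifold 𝓘(ℝ, ES) ∞ S]
  [TopologicalSpace R] [ChartedSpace ER R] [IsManifold 𝓘(ℝ, ER) ∞ R]
  [TopologicalSpace P] [ChartedSpace EP P] [IsManifold 𝓘(ℝ, EP) ∞ P] [T2Space P]
  {ΩS : SymplecticForm ES S} {ΩR : SymplecticForm ER R} {π : PoissonStructure EP P}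
  {J : S → P} {ρ : R → P}

theorem nonempty_plaqueFamily_hatSpan (hJ : IsPoissonMap ΩS π.opposite J)
    (hρ : IsPoissonMap ΩR π ρ) :
    Nonempty (PlaqueFamily (𝓘(ℝ, ES).prod 𝓘(ℝ, ER)) (hatSpan EP ΩS ΩR J ρ) (fibreProduct J ρ)
      (fun f : C^∞⟮𝓘(ℝ, EP), P; ℝ⟯ => hatField ΩS ΩR J ρ f)) :=
  PlaqueFamily.nonempty_of_localModel (F := (EP →L[ℝ] ℝ) × ℝ)
    (isClosed_eq (hJ.1.continuous.comp continuous_fst) (hρ.1.continuous.comp continuous_snd))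
    fun _ hw f => exists_localModel_hatField hJ hρ hw f

theorem nullDistribution_eq_hatSpan (hJ : IsPoissonMap ΩS π.opposite J) (hρ : IsPoissonMap ΩR π ρ)
    {z : S × R} (hz : z ∈ fibreProduct J ρ) :
    nullDistribution EP ΩS ΩR J ρ z = hatSpan EP ΩS ΩR J ρ z := by
  rw [nullDistribution, ← hatSpan_eq_orthogonal hJ.1 hρ.1 hz]
  exact inf_eq_right.2 (hatSpan_le_fibreTangent hJ hρ hz)

/-- A vector of the span is the value of a single `X̂_f`, and this global field is the required
smooth extension; the leaves are the orbits. -/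
theorem definesSingularFoliation_hatSpan (hJ : IsPoissonMap ΩS π.opposite J)
    (hρ : IsPoissonMap ΩR π ρ) :
    DefinesSingularFoliation (hatSpan EP ΩS ΩR J ρ) (fibreProduct J ρ) := by
  obtain ⟨Q⟩ := nonempty_plaqueFamily_hatSpan hJ hρ
  refine ⟨fun m _ v hv => ?_, fun m hm => ⟨_, Q.isLeaf_leaf ⟨m, hm⟩, Q.mem_image_leaf ⟨m, hm⟩⟩⟩
  obtain ⟨f, rfl⟩ := (mem_hatSpan_iff hJ.1 hρ.1 m v).1 hv
  exact ⟨hatField ΩS ΩR J ρ f, isSmoothVectorField_hatField hJ.1 hρ.1 f, rfl,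
    fun x _ => (mem_hatSpan_iff hJ.1 hρ.1 x _).2 ⟨f, rfl⟩⟩

end Foliation

end SymplecticInduction

open SymplecticInduction in
theorem theorem1
    {ES ER EP : Type*}
    [NormedAddCommGroup ES] [NormedSpace ℝ ES] [FiniteDimensional ℝ ES]
    [NormedAddCommGroup ER] [NormedSpace ℝ ER] [FiniteDimensional ℝ ER]
    [NormedAddCommGroup EP] [NormedSpace ℝ EP] [FiniteDimensional ℝ EP]
    {S R P : Type*}
    [TopologicalSpace S] [ChartedSpace ES S] [IsManifold 𝓘(ℝ, ES) ∞ S]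
    [T2Space S] [SecondCountableTopology S] [ConnectedSpace S]
    [TopologicalSpace R] [ChartedSpace ER R] [IsManifold 𝓘(ℝ, ER) ∞ R]
    [T2Space R] [SecondCountableTopology R] [ConnectedSpace R]
    [TopologicalSpace P] [ChartedSpace EP P] [IsManifold 𝓘(ℝ, EP) ∞ P]
    [T2Space P] [SecondCountableTopology P]
    (ΩS : SymplecticForm ES S) (ΩR : SymplecticForm ER R) (π : PoissonStructure EP P)
    (J : S → P) (ρ : R → P)
    (hJ : IsPoissonMap ΩS π.opposite J) (hρ : IsPoissonMap ΩR π ρ) :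
    -- the fibre product is co-isotropic, and its symplectic orthogonal is spanned by the `X̂_f`
    (∀ z ∈ fibreProduct J ρ,
      (prodForm ΩS.form ΩR.form z).orthogonal (fibreTangent ES ER EP J ρ z)
          ≤ fibreTangent ES ER EP J ρ z ∧
      hatSpan EP ΩS ΩR J ρ z
          = (prodForm ΩS.form ΩR.form z).orthogonal (fibreTangent ES ER EP J ρ z)) ∧
    -- where it is an immersed submanifold with these tangent spaces, the immersion is co-isotropic,
    -- and the kernel of the pulled back form is spanned by the `X̂_f`
    (∀ N : ImmersedSubmanifold (𝓘(ℝ, ES).prod 𝓘(ℝ, ER)) (S × R),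
      N.image ⊆ fibreProduct J ρ →
      (∀ n, N.tangent n = fibreTangent ES ER EP J ρ (N.incl n)) →
      N.IsCoisotropic (prodForm ΩS.form ΩR.form) ∧
      ∀ n, (LinearMap.ker (N.pullback (prodForm ΩS.form ΩR.form) n)).map (N.inclDeriv n)
          = hatSpan EP ΩS ΩR J ρ (N.incl n)) ∧
    -- the `X̂_f` define a singular foliation of the fibre product, whose leaves are the orbits of
    -- their local flows
    DefinesSingularFoliation (hatSpan EP ΩS ΩR J ρ) (fibreProduct J ρ) ∧
    (∀ m m' : fibreProduct J ρ,
      SameLeaf (hatSpan EP ΩS ΩR J ρ) (fibreProduct J ρ) m m' ↔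
        SameOrbit (fun f : C^∞⟮𝓘(ℝ, EP), P; ℝ⟯ => hatField ΩS ΩR J ρ f) m.1 m'.1) ∧
    -- the null distribution defines a singular foliation, too, and both foliations have the same
    -- leaves and the same leaf space
    DefinesSingularFoliation (nullDistribution EP ΩS ΩR J ρ) (fibreProduct J ρ) ∧
    Equivalence (SameLeaf (hatSpan EP ΩS ΩR J ρ) (fibreProduct J ρ)) ∧
    (∀ m m' : fibreProduct J ρ,
      SameLeaf (hatSpan EP ΩS ΩR J ρ) (fibreProduct J ρ) m m' ↔
        SameLeaf (nullDistribution EP ΩS ΩR J ρ) (fibreProduct J ρ) m m') ∧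
    ∃ Φ : LeafSpace (hatSpan EP ΩS ΩR J ρ) (fibreProduct J ρ) ≃ₜ
        LeafSpace (nullDistribution EP ΩS ΩR J ρ) (fibreProduct J ρ),
      ∀ m : fibreProduct J ρ, Φ (Quot.mk _ m) = Quot.mk _ m := by

  obtain ⟨Q⟩ := nonempty_plaqueFamily_hatSpan hJ hρ
  have hortho := fun z (hz : z ∈ fibreProduct J ρ) =>
    hatSpan_eq_orthogonal (ΩS := ΩS) (ΩR := ΩR) hJ.1 hρ.1 hz
  have hle := fun z (hz : z ∈ fibreProduct J ρ) => hatSpan_le_fibreTangent hJ hρ hz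
  have hnull : ∀ z ∈ fibreProduct J ρ,
      hatSpan EP ΩS ΩR J ρ z = nullDistribution EP ΩS ΩR J ρ z :=
    fun z hz => (nullDistribution_eq_hatSpan hJ hρ hz).symm
  -- The two relations are equal, so the leaf spaces are the same quotient and the homeomorphism is
  -- the identity on representatives.
  have hsame := sameLeaf_congr hnull
  refine ⟨fun z hz => ⟨(hortho z hz).symm.trans_le (hle z hz), hortho z hz⟩, fun N hN hT =>
    ⟨fun n => ?_, fun n => ?_⟩, definesSingularFoliation_hatSpan hJ hρ, Q.sameLeaf_iff,
    (definesSingularFoliation_congr hnull).1 (definesSingularFoliation_hatSpan hJ hρ),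
    Q.equivalence_sameLeaf, fun m m' => by rw [hsame], exists_homeomorph_quot hsame⟩
  · have hn := hN ⟨n, rfl⟩
    rw [hT, ← hortho _ hn]
    exact hle _ hn
  · have hn := hN ⟨n, rfl⟩
    rw [N.map_ker_pullback (prodForm_isAlt ΩS.alternating ΩR.alternating), hT]
    exact nullDistribution_eq_hatSpan hJ hρ hn
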